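/- Let $\alpha\ge 0$, $\kappa>0$, $0<\beta<1$, $\eta\ge 0$, and $\gamma>\eta^2$ be real parameters. Let $H^m(0,1)$ denote the complex Sobolev spaces, and $H^m_*(0,1)=\{w\in H^m(0,1): w(1)=0\}$. Let $\mathscr X$ be the space of triples $x=\{(w_k,v_k)\}_{k=1}^3$ with $w_k\in H^2_*(0,1)$, $v_k\in L_2(0,1)$ and $w_j(0)=w_k(0)$ for all $j,k$, with the inner product $$(x,\tilde x)_{\mathscr X}=\sum_{k=1}^3\Big[\int_0^1 w_k''\overline{\tilde w_k''}\,ds+(\gamma-\eta^2)\int_0^1 w_k'\overline{\tilde w_k'}\,ds+\alpha w_k'(0)\overline{\tilde w_k'(0)}\Big]+\sum_{k=1}^3\int_0^1 v_k\overline{\tilde v_k}\,ds .$$ Let $\mathcal T$ be the operator in $\mathscr X$ given by $$\mathcal Tx=\{(v_k,\,-w_k^{(4)}+(\gamma-\eta^2)w_k''-2\beta\eta v_k')\}_{k=1}^3,$$ whose domain consists of the $x\in\mathscr X$ with $w_k\in H^4(0,1)$, $v_k\in H^2_*(0,1)$, $v_j(0)=v_k(0)$, $w_k''(1)=0$, $w_k''(0)-\alpha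 w_k'(0)-\kappa v_k'(0)=0$ for all $j,k$, and $\sum_{k=1}^3[w_k^{(3)}(0)-(\gamma-\eta^2)w_k'(0)+\beta\eta v_k(0)]=0$. For each $\lambda\in\mathbb C$ let $\varphi_1,\dots,\varphi_4$ (depending on $\lambda$) be any fundamental system of $$\varphi^{(4)}-(\gamma-\eta^2)\varphi''+2\lambda\beta\eta\varphi'=-\lambda^2\varphi ,$$ and let $\Delta_1(\lambda)$, $\Delta_2(\lambda)$ be the $4\times4$ determinants whose $r$-th columns are $$\begin{pmatrix}\varphi_r(1)\\ \varphi_r''(1)\\ \varphi_r''(0)-(\alpha+\lambda\kappa)\varphi_r'(0)\\ \varphi_r^{(3)}(0)-(\gamma-\eta^2)\varphi_r'(0)+\lambda\beta\eta\varphi_r(0)\end{pmatrix}\quad\text{and}\quad\begin{pmatrix}\varphi_r(1)\\ \varphi_r''(1)\\ \varphi_r''(0)-(\alpha+\lambda\kappa)\varphi_r'(0)\\ \varphi_r(0)\end{pmatrix},$$ respectively. Then: 1. The spectrum of $\mathcal T$ consists of eigenvalues, only finitely many of which lie in any given disc, and $\sigma(\mathcal T)=\sigma^{(1)}(\mathcal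 T)\cup\sigma^{(2)}(\mathcal T)$, where $\sigma^{(i)}(\mathcal T)=\{\lambda\in\mathbb C:\Delta_i(\lambda)=0\}$. 2. $\sigma(\mathcal T)$ lies in a vertical strip of the open left half-plane: there are $a\le b<0$ such that $a\le\operatorname{Re}\lambda\le b$ for all $\lambda\in\sigma(\mathcal T)$. 3. For $i=1,2$, the set $\sigma^{(i)}(\mathcal T)$ consists, up to finitely many elements, of pairwise distinct numbers $\lambda^{(i)}_{\pm n}$, $n\ge n_0$ (for some $n_0\ge1$), with $\lambda^{(i)}_{-n}=\overline{\lambda^{(i)}_{n}}$ and $\operatorname{Im}\lambda^{(i)}_n\to\infty$, such that as $n\to\infty$ $$\lambda^{(1)}_{\pm n}=-\frac1\kappa\pm i\Big((\tau^{(1)}_n)^2+\frac{\frac{\beta^2\eta^2}{2}+\gamma-\eta^2}{2}\Big)+\mathcal O\big((\tau_n^{(1)})^{-1}\big),\qquad \tau^{(1)}_n=\big(n+\tfrac12\big)\pi,$$ $$\lambda^{(2)}_{\pm n}=-\frac2\kappa\pm i\Big((\tau^{(2)}_n)^2+\frac{\frac{\beta^2\eta^2}{2}+\gamma-\eta^2}{2}\Big)+\mathcal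 O\big((\tau_n^{(2)})^{-1}\big),\qquad \tau^{(2)}_n=\big(n+\tfrac14\big)\pi .$$ -/

import Mathlib

open MeasureTheory Set Filter Topology Asymptotics
open scoped ContDiff ComplexConjugate

noncomputable section

namespace PipeStar

/-! ### Sobolev spaces on the unit interval -/

/-- The complex Hilbert space `L₂(0,1)`. -/
abbrev L2 : Type := Lp ℂ 2 (volume.restrict (Ioo (0 : ℝ) 1))

/-- `v ∈ L₂(0,1)` is the weak derivative of `u ∈ L₂(0,1)`, tested against `C_c^∞(0,1)`. -/
def HasWeakDeriv (u v : L2) : Prop :=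
  ∀ θ : ℝ → ℝ, ContDiff ℝ ∞ θ → HasCompactSupport θ → tsupport θ ⊆ Ioo 0 1 →
    ∫ s in Ioo (0 : ℝ) 1, deriv θ s • u s = -∫ s in Ioo (0 : ℝ) 1, θ s • v s

/-- Membership in the Sobolev space `H^m(0,1)` (with `H^0 = L₂`). -/
def MemH : ℕ → L2 → Prop
  | 0, _ => True
  | m + 1, u => ∃ v, HasWeakDeriv u v ∧ MemH m v

open Classical in
/-- The weak derivative of `u` (only used for `u ∈ H^1(0,1)`; zero if there is none). -/
def weakDeriv (u : L2) : L2 :=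
  if h : ∃ v, HasWeakDeriv u v then h.choose else 0

/-- The `j`-th weak derivative `u^{(j)}`. -/
def wd (j : ℕ) (u : L2) : L2 := weakDeriv^[j] u

/-- `c` is the value at `a ∈ [0,1]` of the representative of `u` that is continuous on `[0,1]`. -/
def HasPointValue (u : L2) (a : ℝ) (c : ℂ) : Prop :=
  ∃ U : ℝ → ℂ, ContinuousOn U (Icc 0 1) ∧
    (∀ᵐ s ∂(volume.restrict (Ioo (0 : ℝ) 1)), u s = U s) ∧ U a = c

open Classical in
/-- The point value `u(a)` of `u` (only used for `u ∈ H^1(0,1)` and `a ∈ [0,1]`). -/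
def pointVal (u : L2) (a : ℝ) : ℂ :=
  if h : ∃ c, HasPointValue u a c then h.choose else 0

/-- Weak derivatives are unique. -/
theorem HasWeakDeriv.unique {u v v' : L2} (h : HasWeakDeriv u v) (h' : HasWeakDeriv u v') :
    v = v' := by
  have hi : ∀ w : L2, IntegrableOn (fun s => w s) (Ioo (0 : ℝ) 1) := fun w =>
    (Lp.memLp w).integrable (by norm_num)
  have key := isOpen_Ioo.ae_eq_zero_of_integral_contDiff_smul_eq_zero (U := Ioo (0 : ℝ) 1)
    (μ := volume) (f := fun s => v s - v' s)
    (((hi v).sub (hi v')).locallyIntegrableOn) (by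
      intro θ h1 h2 h3
      have e : ∫ s in Ioo (0 : ℝ) 1, θ s • v s = ∫ s in Ioo (0 : ℝ) 1, θ s • v' s := by
        have a := h θ h1 h2 h3
        rw [h' θ h1 h2 h3] at a
        exact (neg_injective a).symm
      have hz : ∀ s, s ∉ Ioo (0 : ℝ) 1 → θ s • (v s - v' s) = 0 := by
        intro s hs
        rw [image_eq_zero_of_notMem_tsupport (fun h => hs (h3 h)), zero_smul]
      obtain ⟨C, hC⟩ := h1.continuous.bounded_above_of_compact_support h2
      have hb : ∀ w : L2, IntegrableOn (fun s => θ s • w s) (Ioo (0 : ℝ) 1) := fun w =>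
        (hi w).bdd_smul C h1.continuous.aestronglyMeasurable (Eventually.of_forall hC)
      rw [← setIntegral_eq_integral_of_forall_compl_eq_zero hz]
      simp only [smul_sub]
      rw [integral_sub (hb v) (hb v'), e, sub_self])
  refine Lp.ext ((ae_restrict_iff' measurableSet_Ioo).2 ?_)
  filter_upwards [key] with s hs hm
  exact sub_eq_zero.1 (hs hm)

theorem HasWeakDeriv.weakDeriv_eq {u v : L2} (h : HasWeakDeriv u v) : weakDeriv u = v := by
  have hex : ∃ v, HasWeakDeriv u v := ⟨v, h⟩
  rw [weakDeriv, dif_pos hex]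
  exact hex.choose_spec.unique h

/-- Point values in `[0,1]` are unique. -/
theorem HasPointValue.unique {u : L2} {a : ℝ} (ha : a ∈ Icc (0 : ℝ) 1) {c c' : ℂ}
    (h : HasPointValue u a c) (h' : HasPointValue u a c') : c = c' := by
  obtain ⟨U, hU, hu, rfl⟩ := h
  obtain ⟨V, hV, hv, rfl⟩ := h'
  have hae : U =ᵐ[volume.restrict (Ioo (0 : ℝ) 1)] V := by
    filter_upwards [hu, hv] with s h1 h2
    rw [← h1, h2]
  have hon : EqOn U V (Ioo (0 : ℝ) 1) :=
    Measure.eqOn_open_of_ae_eq hae isOpen_Ioo (hU.mono Ioo_subset_Icc_self)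
      (hV.mono Ioo_subset_Icc_self)
  have hcl := hon.of_subset_closure hU hV Ioo_subset_Icc_self
    (by rw [closure_Ioo (zero_ne_one)])
  exact hcl ha

theorem HasPointValue.pointVal_eq {u : L2} {a : ℝ} (ha : a ∈ Icc (0 : ℝ) 1) {c : ℂ}
    (h : HasPointValue u a c) : pointVal u a = c := by
  have hex : ∃ c, HasPointValue u a c := ⟨c, h⟩
  rw [pointVal, dif_pos hex]
  exact hex.choose_spec.unique ha h

/-- The space `H^m_*(0,1)` of those `w ∈ H^m(0,1)` with `w(1) = 0`. -/
def MemHStar (m : ℕ) (w : L2) : Prop := MemH m w ∧ pointVal w 1 = 0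

/-! ### The state space and the system operator -/

/-- The physical parameters. -/
structure Params where
  α : ℝ
  κ : ℝ
  β : ℝ
  γ : ℝ
  η : ℝ

/-- The standing restrictions on the parameters. -/
structure Params.Admissible (p : Params) : Prop where
  α_nonneg : 0 ≤ p.α
  κ_nonneg : 0 ≤ p.κ
  β_pos : 0 < p.β
  β_lt_one : p.β < 1
  γ_pos : 0 < p.γ
  η_nonneg : 0 ≤ p.η
  η_sq_lt : p.η ^ 2 < p.γ

/-- Triples `x = {(w_k, v_k)}` of pairs of `L₂(0,1)` functions, one pair for each edge;
`(x k).1 = w_k` and `(x k).2 = v_k`. -/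
abbrev Triple : Type := Fin 3 → L2 × L2

/-- The state space `𝒳 = H²_*(G) × L₂(G)`. -/
def stateSpace : Set Triple :=
  {x | (∀ k, MemHStar 2 (x k).1) ∧ ∀ j k, pointVal (x j).1 0 = pointVal (x k).1 0}

/-- The energy inner product of `𝒳` (linear in the first argument). -/
def energyInner (p : Params) (x y : Triple) : ℂ :=
  ∑ k, ((∫ s in Ioo (0 : ℝ) 1, wd 2 (x k).1 s * conj (wd 2 (y k).1 s))
    + ((p.γ - p.η ^ 2 : ℝ) : ℂ) * (∫ s in Ioo (0 : ℝ) 1, wd 1 (x k).1 s * conj (wd 1 (y k).1 s))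
    + (p.α : ℂ) * (pointVal (wd 1 (x k).1) 0 * conj (pointVal (wd 1 (y k).1) 0)))
  + ∑ k, ∫ s in Ioo (0 : ℝ) 1, (x k).2 s * conj ((y k).2 s)

/-- The norm of `𝒳`. -/
def energyNorm (p : Params) (x : Triple) : ℝ := Real.sqrt (energyInner p x x).re

/-- The domain `𝒟(𝒯) = 𝒟(𝒜)`. The condition `v_j(0) = v_k(0)` expresses that `𝒜 x`, whose first
components are the `v_k`, belongs to `𝒳`. -/
def domT (p : Params) : Set Triple :=
  {x | x ∈ stateSpace ∧
    (∀ k, MemH 4 (x k).1 ∧ MemHStar 2 (x k).2) ∧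
    (∀ j k, pointVal (x j).2 0 = pointVal (x k).2 0) ∧
    (∀ k, pointVal (wd 2 (x k).1) 1 = 0) ∧
    (∀ k, pointVal (wd 2 (x k).1) 0 - p.α * pointVal (wd 1 (x k).1) 0
      - p.κ * pointVal (wd 1 (x k).2) 0 = 0) ∧
    ∑ k, (pointVal (wd 3 (x k).1) 0 - (p.γ - p.η ^ 2) * pointVal (wd 1 (x k).1) 0
      + p.β * p.η * pointVal (x k).2 0) = 0}

/-- The operator `𝒜`. -/
def opA (p : Params) (x : Triple) : Triple := fun k =>
  ((x k).2, -wd 4 (x k).1 + ((p.γ - p.η ^ 2 : ℝ) : ℂ) • wd 2 (x k).1)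

/-- The operator `ℬ`. -/
def opB (p : Params) (x : Triple) : Triple := fun k =>
  (0, -((2 * p.β * p.η : ℝ) : ℂ) • wd 1 (x k).2)

/-- The system operator `𝒯 = 𝒜 + ℬ`, to be used on `domT p` only. -/
def opT (p : Params) (x : Triple) : Triple := opA p x + opB p x

/-- The resolvent set: `lam I - 𝒯` maps `𝒟(𝒯)` bijectively onto `𝒳`, with an inverse that is
bounded for the norm of `𝒳`. -/
def resolventT (p : Params) : Set ℂ :=
  {lam | (∀ y ∈ stateSpace, ∃! x, x ∈ domT p ∧ lam • x - opT p x = y) ∧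
    ∃ C : ℝ, ∀ x ∈ domT p, energyNorm p x ≤ C * energyNorm p (lam • x - opT p x)}

/-- The spectrum `σ(𝒯)`. -/
def spectrumT (p : Params) : Set ℂ := (resolventT p)ᶜ

/-- `lam` is an eigenvalue of `𝒯`. -/
def IsEigenvalueT (p : Params) (lam : ℂ) : Prop :=
  ∃ x ∈ domT p, x ≠ 0 ∧ opT p x = lam • x

/-! ### The characteristic determinants -/

/-- `f` solves `f⁗ - (γ - η²) f'' + 2 λ β η f' = -λ² f`. -/
def IsSolution (p : Params) (lam : ℂ) (f : ℝ → ℂ) : Prop :=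
  ContDiff ℝ 4 f ∧ ∀ s, iteratedDeriv 4 f s - (p.γ - p.η ^ 2) * iteratedDeriv 2 f s
    + 2 * lam * p.β * p.η * iteratedDeriv 1 f s = -lam ^ 2 * f s

/-- A fundamental system: four linearly independent solutions. -/
def IsFundamentalSystem (p : Params) (lam : ℂ) (φ : Fin 4 → ℝ → ℂ) : Prop :=
  (∀ r, IsSolution p lam (φ r)) ∧ LinearIndependent ℂ φ

/-- The companion matrix of the differential equation (used only to show that fundamental
systems exist). -/
def companion (p : Params) (lam : ℂ) : Matrix (Fin 4) (Fin 4) ℂ :=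
  !![0, 1, 0, 0; 0, 0, 1, 0; 0, 0, 0, 1;
    -lam ^ 2, -(2 * lam * p.β * p.η), (p.γ - p.η ^ 2 : ℂ), 0]

attribute [local instance] Matrix.linftyOpNormedRing Matrix.linftyOpNormedAlgebra in
theorem hasDerivAt_exp_companion (p : Params) (lam : ℂ) (i r : Fin 4) (s : ℝ) :
    HasDerivAt (fun t : ℝ => NormedSpace.exp (t • companion p lam) i r)
      (∑ j, companion p lam i j * NormedSpace.exp (s • companion p lam) j r) s := by
  have h := hasDerivAt_exp_smul_const' (𝕂 := ℝ) (companion p lam) s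
  have h2 := (hasDerivAt_pi.1 ((hasDerivAt_pi.1 h) i)) r
  simp only [Matrix.mul_apply] at h2
  exact h2

/-- Fundamental systems exist, for every value of the spectral parameter. -/
theorem exists_isFundamentalSystem (p : Params) (lam : ℂ) :
    ∃ φ, IsFundamentalSystem p lam φ := by
  set E : Fin 4 → Fin 4 → ℝ → ℂ := fun i r t => NormedSpace.exp (t • companion p lam) i r with hE
  have hd := hasDerivAt_exp_companion p lam
  have d0 : ∀ r, deriv (E 0 r) = E 1 r := fun r => funext fun s => by
    rw [(hd 0 r s).deriv]; simp [companion, Fin.sum_univ_four, hE]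
  have d1 : ∀ r, deriv (E 1 r) = E 2 r := fun r => funext fun s => by
    rw [(hd 1 r s).deriv]; simp [companion, Fin.sum_univ_four, hE]
  have d2 : ∀ r, deriv (E 2 r) = E 3 r := fun r => funext fun s => by
    rw [(hd 2 r s).deriv]; simp [companion, Fin.sum_univ_four, hE]
  have d3 : ∀ r s, deriv (E 3 r) s = -lam ^ 2 * E 0 r s - 2 * lam * p.β * p.η * E 1 r s
      + (p.γ - p.η ^ 2) * E 2 r s := fun r s => by
    rw [(hd 3 r s).deriv]; simp [companion, Fin.sum_univ_four, hE]; ring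
  have hdiff : ∀ i r, Differentiable ℝ (E i r) := fun i r s => (hd i r s).differentiableAt
  have i1 : ∀ r, iteratedDeriv 1 (E 0 r) = E 1 r := fun r => by
    rw [iteratedDeriv_one, d0]
  have i2 : ∀ r, iteratedDeriv 2 (E 0 r) = E 2 r := fun r => by
    rw [iteratedDeriv_succ, i1, d1]
  have i3 : ∀ r, iteratedDeriv 3 (E 0 r) = E 3 r := fun r => by
    rw [iteratedDeriv_succ, i2, d2]
  have i4 : ∀ r, iteratedDeriv 4 (E 0 r) = deriv (E 3 r) := fun r => by
    rw [iteratedDeriv_succ, i3]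
  have e0 : ∀ i r, E i r 0 = if i = r then 1 else 0 := fun i r => by
    simp [hE, Matrix.one_apply]
  have hc : ∀ r, ContDiff ℝ 4 (E 0 r) := fun r => by
    have hd3 : deriv (E 3 r) = fun s => -lam ^ 2 * E 0 r s - 2 * lam * p.β * p.η * E 1 r s
      + (p.γ - p.η ^ 2) * E 2 r s := funext (d3 r)
    have c3 : ContDiff ℝ 1 (E 3 r) := by
      refine contDiff_one_iff_deriv.2 ⟨hdiff 3 r, ?_⟩
      rw [hd3]
      have := (hdiff 0 r).continuous
      have := (hdiff 1 r).continuous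
      have := (hdiff 2 r).continuous
      fun_prop
    have c2 : ContDiff ℝ (1 + 1) (E 2 r) :=
      contDiff_succ_iff_deriv.2 ⟨hdiff 2 r, by simp, by rw [d2]; exact c3⟩
    have c1 : ContDiff ℝ (1 + 1 + 1) (E 1 r) :=
      contDiff_succ_iff_deriv.2 ⟨hdiff 1 r, by simp, by rw [d1]; exact c2⟩
    have c0 : ContDiff ℝ (1 + 1 + 1 + 1) (E 0 r) :=
      contDiff_succ_iff_deriv.2 ⟨hdiff 0 r, by simp, by rw [d0]; exact c1⟩
    convert c0 using 1
    norm_num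
  refine ⟨E 0, fun r => ⟨hc r, fun s => ?_⟩, ?_⟩
  · rw [i4, i2, i1, d3]; ring
  · rw [Fintype.linearIndependent_iff]
    intro c hsum r
    have h0 : (fun s => ∑ r, c r * E 0 r s) = 0 := by
      rw [← hsum]; funext s; simp [Finset.sum_apply]
    have step : ∀ i j : Fin 4, (∀ r, deriv (E i r) = E j r) →
        (fun s => ∑ r, c r * E i r s) = 0 → (fun s => ∑ r, c r * E j r s) = 0 := by
      intro i j hij hz
      funext s
      have hds : HasDerivAt (fun s => ∑ r, c r * E i r s) (∑ r, c r * E j r s) s := by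
        refine HasDerivAt.fun_sum fun r _ => ?_
        have := (hdiff i r s).hasDerivAt
        rw [hij] at this
        exact this.const_mul (c r)
      rw [hz] at hds
      exact hds.unique (hasDerivAt_const s 0)
    have h1 := step 0 1 d0 h0
    have h2 := step 1 2 d1 h1
    have h3 := step 2 3 d2 h2
    have g0 := congrFun h0 0
    have g1 := congrFun h1 0
    have g2 := congrFun h2 0
    have g3 := congrFun h3 0
    simp only [e0, mul_ite, mul_one, mul_zero, Finset.sum_ite_eq, Finset.mem_univ, if_true,
      Pi.zero_apply] at g0 g1 g2 g3
    fin_cases r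
    exacts [g0, g1, g2, g3]

/-- The vertex form `f''(0) - (α + λκ) f'(0)`. -/
def momentForm (p : Params) (lam : ℂ) (f : ℝ → ℂ) : ℂ :=
  iteratedDeriv 2 f 0 - (p.α + lam * p.κ) * iteratedDeriv 1 f 0

/-- The vertex form `f'''(0) - (γ - η²) f'(0) + λβη f(0)`. -/
def forceForm (p : Params) (lam : ℂ) (f : ℝ → ℂ) : ℂ :=
  iteratedDeriv 3 f 0 - (p.γ - p.η ^ 2) * iteratedDeriv 1 f 0 + lam * p.β * p.η * f 0

/-- The determinant `Δ₁(λ)` formed with the fundamental system `φ`. -/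
def Delta1 (p : Params) (lam : ℂ) (φ : Fin 4 → ℝ → ℂ) : ℂ :=
  Matrix.det (Matrix.of ![fun r => φ r 1, fun r => iteratedDeriv 2 (φ r) 1,
    fun r => momentForm p lam (φ r), fun r => forceForm p lam (φ r)])

/-- The determinant `Δ₂(λ)` formed with the fundamental system `φ`. -/
def Delta2 (p : Params) (lam : ℂ) (φ : Fin 4 → ℝ → ℂ) : ℂ :=
  Matrix.det (Matrix.of ![fun r => φ r 1, fun r => iteratedDeriv 2 (φ r) 1,
    fun r => momentForm p lam (φ r), fun r => φ r 0])

/-! ### Asymptotics of a branch -/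

/-- The leading part `τ² + (β²η²/2 + γ - η²)/2` of the imaginary parts. -/
def freq (p : Params) (τ : ℝ) : ℝ :=
  τ ^ 2 + (p.β ^ 2 * p.η ^ 2 / 2 + p.γ - p.η ^ 2) / 2

/-- Up to finitely many elements, `Z` is `{λ_{±n} | n ≥ n₀}`, where the `λ_{±n}` are pairwise
distinct, `λ_{-n}` is the complex conjugate of `λ_n`, `Im λ_n → ∞`, and
`λ_{±n} = a ± i (τ_n² + (β²η²/2 + γ - η²)/2) + O(1/τ_n)` with `τ_n = (n + δ)π`. -/
def HasBranchAsymptotics (p : Params) (Z : Set ℂ) (a δ : ℝ) : Prop :=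
  ∃ (lam : ℤ → ℂ) (n₀ : ℕ), 0 < n₀ ∧
    (∀ n, lam (-n) = conj (lam n)) ∧
    InjOn lam {n | (n₀ : ℤ) ≤ |n|} ∧
    lam '' {n | (n₀ : ℤ) ≤ |n|} ⊆ Z ∧
    (Z \ lam '' {n | (n₀ : ℤ) ≤ |n|}).Finite ∧
    Tendsto (fun n : ℕ => (lam n).im) atTop atTop ∧
    (fun n : ℕ => lam n - (a + Complex.I * freq p ((n + δ) * Real.pi)))
      =O[atTop] (fun n : ℕ => ((n + δ) * Real.pi)⁻¹) ∧
    (fun n : ℕ => lam (-n) - (a - Complex.I * freq p ((n + δ) * Real.pi)))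
      =O[atTop] (fun n : ℕ => ((n + δ) * Real.pi)⁻¹)

end PipeStar

end

/-! Reduction to finite dimensions. In the resolvent equation the first components give `v = lam • w
- f`, so each `w_k` solves an inhomogeneous fourth-order equation. Duhamel's formula expresses `w_k`
through its initial jet in `ℂ⁴`, and all end and vertex conditions become a linear system for three
jets, with matrix `vertexMap`. If that map is injective it is bijective, and elementary bounds make
the inverse of `lam I - 𝒯` bounded; if it has a kernel, a kernel vector yields an eigenvector.
Differences of edges satisfy the problem with `w(0) = 0`, and equal edges satisfy the problem with
the force condition, so injectivity means that both 4×4 determinants of `bcMat` are nonzero. These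
are `Δ₂` and `Δ₁` up to the nonzero determinant of initial jets (`Delta1_eq`, `Delta2_eq`).

Location. For `Re λ ≥ 0` neither boundary problem has a nontrivial solution
(`IsSolution.eq_zero_of_re_nonneg`): for `Re λ > 0` the power balance decides, at `λ = 0` its static
analogue, and on the rest of the imaginary axis the damping forces `f'(0) = 0`, after which
conservation laws annihilate the solution. The determinants are entire and nonzero at `0`, so their
zeros are finite in number in every disc.

Asymptotics. With `λ = i μ²` and `ε = 1/μ` the characteristic roots are `z(ε)/ε`, where `z` is
analytic and starts at a fourth root of unity (`exists_root_branch`). In a sector of large `μ` the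
determinant of exponentials is dominated by two terms, and its vanishing reads `exp(2iμ) = G H(μ)`
with `H(μ) = 1 + h/μ + O(μ⁻²)` (`exists_sector_equation`). Taking logarithms gives a contraction
near each `(n + δ)π`, with exactly one fixed point (`exists_fixed_point`, `fixed_point_unique`);
squaring it produces the stated expansion (`hasBranchAsymptotics_of_sector`). The real part of `h`
is `-1/κ` or `-2/κ`, its imaginary part is the frequency shift. As these real parts are negative and
all zeros have `Re λ < 0`, the strip follows. -/

noncomputable section

namespace PipeStar

/-! ### The first-order system and its propagator -/

/-- The fundamental matrix `exp (s A)` of the first-order system with companion matrix `A`. -/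
def propag (p : Params) (lam : ℂ) (s : ℝ) : Matrix (Fin 4) (Fin 4) ℂ :=
  NormedSpace.exp (s • companion p lam)

theorem propag_zero (p : Params) (lam : ℂ) : propag p lam 0 = 1 := by
  simp [propag]

theorem propag_mul_propag_neg (p : Params) (lam : ℂ) (s : ℝ) :
    propag p lam s * propag p lam (-s) = 1 := by
  unfold propag
  rw [← Matrix.exp_add_of_commute, neg_smul, add_neg_cancel, NormedSpace.exp_zero]
  rw [neg_smul]
  exact (Commute.refl _).neg_right

theorem propag_neg_mul_propag (p : Params) (lam : ℂ) (s : ℝ) :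
    propag p lam (-s) * propag p lam s = 1 := by
  simpa using propag_mul_propag_neg p lam (-s)

theorem hasDerivAt_propag (p : Params) (lam : ℂ) (i r : Fin 4) (s : ℝ) :
    HasDerivAt (fun t : ℝ => propag p lam t i r)
      (∑ j, companion p lam i j * propag p lam s j r) s :=
  hasDerivAt_exp_companion p lam i r s

attribute [local instance] Matrix.linftyOpNormedRing Matrix.linftyOpNormedAlgebra in
theorem hasDerivAt_propag_neg (p : Params) (lam : ℂ) (i r : Fin 4) (s : ℝ) :
    HasDerivAt (fun t : ℝ => propag p lam (-t) i r)
      (-∑ j, propag p lam (-s) i j * companion p lam j r) s := by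
  have h := hasDerivAt_exp_smul_const (𝕂 := ℝ) (companion p lam) (-s)
  have h2 := (hasDerivAt_pi.1 ((hasDerivAt_pi.1 h) i)) r
  simp only [Matrix.mul_apply] at h2
  have h3 := HasDerivAt.scomp s h2 (hasDerivAt_neg s)
  rw [neg_one_smul] at h3
  exact h3

theorem continuous_propag (p : Params) (lam : ℂ) (i r : Fin 4) :
    Continuous fun t : ℝ => propag p lam t i r :=
  continuous_iff_continuousAt.2 fun s => (hasDerivAt_propag p lam i r s).continuousAt

theorem continuous_propag_neg (p : Params) (lam : ℂ) (i r : Fin 4) :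
    Continuous fun t : ℝ => propag p lam (-t) i r :=
  (continuous_propag p lam i r).comp continuous_neg

/-- A chain of functions solving the first-order system is the jet of a solution. -/
theorem isSolution_of_chain {p : Params} {lam : ℂ} {y : Fin 4 → ℝ → ℂ}
    (h0 : ∀ s, HasDerivAt (y 0) (y 1 s) s) (h1 : ∀ s, HasDerivAt (y 1) (y 2 s) s)
    (h2 : ∀ s, HasDerivAt (y 2) (y 3 s) s)
    (h3 : ∀ s, HasDerivAt (y 3) (-lam ^ 2 * y 0 s - 2 * lam * p.β * p.η * y 1 s
      + (p.γ - p.η ^ 2) * y 2 s) s) :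
    IsSolution p lam (y 0) ∧ ∀ j : Fin 4, iteratedDeriv j (y 0) = y j := by
  have i1 : iteratedDeriv 1 (y 0) = y 1 := by
    rw [iteratedDeriv_one]; exact funext fun s => (h0 s).deriv
  have i2 : iteratedDeriv 2 (y 0) = y 2 := by
    rw [iteratedDeriv_succ, i1]; exact funext fun s => (h1 s).deriv
  have i3 : iteratedDeriv 3 (y 0) = y 3 := by
    rw [iteratedDeriv_succ, i2]; exact funext fun s => (h2 s).deriv
  have i4 : iteratedDeriv 4 (y 0) = fun s => -lam ^ 2 * y 0 s - 2 * lam * p.β * p.η * y 1 s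
      + (p.γ - p.η ^ 2) * y 2 s := by
    rw [iteratedDeriv_succ, i3]; exact funext fun s => (h3 s).deriv
  have c3 : ContDiff ℝ 1 (y 3) := by
    refine contDiff_one_iff_deriv.2 ⟨fun s => (h3 s).differentiableAt, ?_⟩
    rw [show deriv (y 3) = _ from funext fun s => (h3 s).deriv]
    have a0 : Continuous (y 0) := continuous_iff_continuousAt.2 fun s => (h0 s).continuousAt
    have a1 : Continuous (y 1) := continuous_iff_continuousAt.2 fun s => (h1 s).continuousAt
    have a2 : Continuous (y 2) := continuous_iff_continuousAt.2 fun s => (h2 s).continuousAt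
    fun_prop
  have c2 : ContDiff ℝ (1 + 1) (y 2) := contDiff_succ_iff_deriv.2
    ⟨fun s => (h2 s).differentiableAt, by simp, by
      rw [show deriv (y 2) = y 3 from funext fun s => (h2 s).deriv]; exact c3⟩
  have c1 : ContDiff ℝ (1 + 1 + 1) (y 1) := contDiff_succ_iff_deriv.2
    ⟨fun s => (h1 s).differentiableAt, by simp, by
      rw [show deriv (y 1) = y 2 from funext fun s => (h1 s).deriv]; exact c2⟩
  have c0 : ContDiff ℝ (1 + 1 + 1 + 1) (y 0) := contDiff_succ_iff_deriv.2
    ⟨fun s => (h0 s).differentiableAt, by simp, by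
      rw [show deriv (y 0) = y 1 from funext fun s => (h0 s).deriv]; exact c1⟩
  refine ⟨⟨?_, fun s => ?_⟩, fun j => ?_⟩
  · convert c0 using 1
    norm_num
  · rw [i4, i2, i1]; ring
  · fin_cases j
    exacts [by simp, i1, i2, i3]

theorem IsSolution.hasDerivAt_iteratedDeriv {p : Params} {lam : ℂ} {f : ℝ → ℂ}
    (hf : IsSolution p lam f) {j : ℕ} (hj : j < 4) (s : ℝ) :
    HasDerivAt (iteratedDeriv j f) (iteratedDeriv (j + 1) f s) s := by
  have := (hf.1.differentiable_iteratedDeriv j (by exact_mod_cast hj)) s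
  rw [iteratedDeriv_succ]
  exact this.hasDerivAt

theorem IsSolution.iteratedDeriv_four {p : Params} {lam : ℂ} {f : ℝ → ℂ}
    (hf : IsSolution p lam f) (s : ℝ) :
    iteratedDeriv 4 f s = -lam ^ 2 * iteratedDeriv 0 f s
      - 2 * lam * p.β * p.η * iteratedDeriv 1 f s + (p.γ - p.η ^ 2) * iteratedDeriv 2 f s := by
  have := hf.2 s
  rw [iteratedDeriv_zero]
  linear_combination this

/-- The jet of a solution satisfies the first-order system. -/
theorem IsSolution.hasDerivAt_jet {p : Params} {lam : ℂ} {f : ℝ → ℂ}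
    (hf : IsSolution p lam f) (i : Fin 4) (s : ℝ) :
    HasDerivAt (iteratedDeriv i f) (∑ j : Fin 4, companion p lam i j * iteratedDeriv j f s) s := by
  have h := hf.hasDerivAt_iteratedDeriv i.2 s
  convert h using 1
  have h4 := hf.iteratedDeriv_four s
  fin_cases i
  · simp [companion, Fin.sum_univ_four]
  · simp [companion, Fin.sum_univ_four]
  · simp [companion, Fin.sum_univ_four]
  · simp only [companion, Fin.sum_univ_four]
    simp only [Fin.reduceFinMk, Fin.isValue, Matrix.of_apply, Matrix.cons_val]
    simp only [Fin.val_zero, Fin.val_one, Fin.val_two, zero_mul, add_zero]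
    norm_num
    norm_num at h4
    rw [h4]; ring

/-- A solution is transported by the propagator. -/
theorem IsSolution.iteratedDeriv_eq {p : Params} {lam : ℂ} {f : ℝ → ℂ}
    (hf : IsSolution p lam f) (i : Fin 4) (s : ℝ) :
    iteratedDeriv i f s = ∑ r : Fin 4, propag p lam s i r * iteratedDeriv r f 0 := by
  set J : ℝ → Fin 4 → ℂ := fun s r => iteratedDeriv r f s with hJ
  -- `exp(-sA) J(s)` has zero derivative, hence equals `J(0)`; multiplying by `exp(sA)` then gives
  -- the claim.
  set h : Fin 4 → ℝ → ℂ := fun i s => ∑ r : Fin 4, propag p lam (-s) i r * J s r with hh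
  have hd : ∀ i s, HasDerivAt (h i) 0 s := by
    intro i s
    have : HasDerivAt (h i) (∑ r : Fin 4,
        ((-∑ j, propag p lam (-s) i j * companion p lam j r) * J s r
          + propag p lam (-s) i r * ∑ j, companion p lam r j * J s j)) s :=
      HasDerivAt.fun_sum fun r _ => (hasDerivAt_propag_neg p lam i r s).mul (hf.hasDerivAt_jet r s)
    convert this using 1
    rw [Finset.sum_add_distrib]
    simp only [neg_mul, Finset.sum_neg_distrib, Finset.sum_mul, Finset.mul_sum]
    rw [Finset.sum_comm (f := fun r j => propag p lam (-s) i r * (companion p lam r j * J s j))]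
    simp [mul_assoc]
  have hc : ∀ i s, h i s = J 0 i := by
    intro i s
    have := is_const_of_deriv_eq_zero (fun s => (hd i s).differentiableAt)
      (fun s => (hd i s).deriv) s 0
    rw [this]
    simp [hh, propag_zero, Matrix.one_apply]
  have hv : (propag p lam (-s)).mulVec (J s) = J 0 := funext fun i => hc i s
  have : J s = (propag p lam s).mulVec (J 0) := by
    rw [← hv, Matrix.mulVec_mulVec, propag_mul_propag_neg, Matrix.one_mulVec]
  exact congrFun this i

/-- The solution with initial jet `c`. -/
def solOf (p : Params) (lam : ℂ) (c : Fin 4 → ℂ) (s : ℝ) : ℂ :=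
  ∑ r, propag p lam s 0 r * c r

theorem solOf_spec (p : Params) (lam : ℂ) (c : Fin 4 → ℂ) :
    IsSolution p lam (solOf p lam c) ∧
      ∀ (j : Fin 4) (s : ℝ), iteratedDeriv j (solOf p lam c) s = ∑ r, propag p lam s j r * c r := by
  have hd : ∀ (i : Fin 4) (s : ℝ), HasDerivAt (fun s => ∑ r, propag p lam s i r * c r)
      (∑ j, companion p lam i j * ∑ r, propag p lam s j r * c r) s := by
    intro i s
    have : HasDerivAt (fun s => ∑ r, propag p lam s i r * c r)
        (∑ r, (∑ j, companion p lam i j * propag p lam s j r) * c r) s :=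
      HasDerivAt.fun_sum fun r _ => (hasDerivAt_propag p lam i r s).mul_const (c r)
    convert this using 1
    simp only [Finset.sum_mul, Finset.mul_sum]
    rw [Finset.sum_comm]
    simp [mul_assoc]
  have := isSolution_of_chain (p := p) (lam := lam) (y := fun i s => ∑ r, propag p lam s i r * c r)
    (fun s => by have := hd 0 s; simpa [companion, Fin.sum_univ_four] using this)
    (fun s => by have := hd 1 s; simpa [companion, Fin.sum_univ_four] using this)
    (fun s => by have := hd 2 s; simpa [companion, Fin.sum_univ_four] using this)
    (fun s => by
      have := hd 3 s
      convert this using 1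
      simp [companion, Fin.sum_univ_four]; ring)
  exact ⟨this.1, fun j s => congrFun (this.2 j) s⟩

/-- The propagator is invertible, so a jet that vanishes at any one point comes from the zero
initial jet. -/
theorem IsSolution.eq_zero_of_jet {p : Params} {lam : ℂ} {f : ℝ → ℂ}
    (hf : IsSolution p lam f) {t : ℝ} (h : ∀ r : Fin 4, iteratedDeriv r f t = 0) : f = 0 := by
  have h0 : (propag p lam t).mulVec (fun r : Fin 4 => iteratedDeriv r f 0) = 0 :=
    funext fun i => by
      have := hf.iteratedDeriv_eq i t
      rw [h i] at this
      exact this.symm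
  have h1 : (fun r : Fin 4 => iteratedDeriv r f 0) = 0 := by
    rw [← Matrix.one_mulVec (fun r : Fin 4 => iteratedDeriv r f 0), ← propag_neg_mul_propag p lam t,
      ← Matrix.mulVec_mulVec, h0, Matrix.mulVec_zero]
  funext s
  have := hf.iteratedDeriv_eq 0 s
  simp only [Fin.val_zero, iteratedDeriv_zero] at this
  rw [this, Pi.zero_apply]
  exact Finset.sum_eq_zero fun r _ => by rw [congrFun h1 r]; simp

/-! ### Boundary matrices -/

/-- The boundary conditions shared by both families, with a free last condition, as a matrix acting
on initial jets. -/
def bcMat (p : Params) (lam : ℂ) (l : Fin 4 → ℂ) : Matrix (Fin 4) (Fin 4) ℂ :=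
  Matrix.of ![propag p lam 1 0, propag p lam 1 2, ![0, -(p.α + lam * p.κ), 1, 0], l]

/-- The force condition on initial jets. -/
def forceRow (p : Params) (lam : ℂ) : Fin 4 → ℂ :=
  ![lam * p.β * p.η, -(p.γ - p.η ^ 2), 0, 1]

/-- The Dirichlet condition on initial jets. -/
def pinRow : Fin 4 → ℂ := ![1, 0, 0, 0]

/-- The matrix of initial jets of a family of four functions. -/
def jetMat (φ : Fin 4 → ℝ → ℂ) : Matrix (Fin 4) (Fin 4) ℂ :=
  Matrix.of fun j r => iteratedDeriv j (φ r) 0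

/-- Each row of `Δ₁` is a linear functional of the solution and factors through its initial jet, so
the matrix is a product. This is why the zero set does not depend on the fundamental system. -/
theorem Delta1_eq {p : Params} {lam : ℂ} {φ : Fin 4 → ℝ → ℂ} (hφ : ∀ r, IsSolution p lam (φ r)) :
    Delta1 p lam φ = (bcMat p lam (forceRow p lam)).det * (jetMat φ).det := by
  rw [← Matrix.det_mul, Delta1]
  congr 1
  ext i r
  have h0 := (hφ r).iteratedDeriv_eq 0 1
  have h2 := (hφ r).iteratedDeriv_eq 2 1
  simp only [Fin.val_zero, iteratedDeriv_zero] at h0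
  rw [Matrix.mul_apply]
  fin_cases i
  · simpa [bcMat, jetMat] using h0
  · simpa [bcMat, jetMat] using h2
  · simp [bcMat, jetMat, momentForm, Fin.sum_univ_four]; ring
  · simp [bcMat, jetMat, forceForm, forceRow, Fin.sum_univ_four]; ring

theorem Delta2_eq {p : Params} {lam : ℂ} {φ : Fin 4 → ℝ → ℂ} (hφ : ∀ r, IsSolution p lam (φ r)) :
    Delta2 p lam φ = (bcMat p lam pinRow).det * (jetMat φ).det := by
  rw [← Matrix.det_mul, Delta2]
  congr 1
  ext i r
  have h0 := (hφ r).iteratedDeriv_eq 0 1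
  have h2 := (hφ r).iteratedDeriv_eq 2 1
  simp only [Fin.val_zero, iteratedDeriv_zero] at h0
  rw [Matrix.mul_apply]
  fin_cases i
  · simpa [bcMat, jetMat] using h0
  · simpa [bcMat, jetMat] using h2
  · simp [bcMat, jetMat, momentForm, Fin.sum_univ_four]; ring
  · simp [bcMat, jetMat, pinRow, Fin.sum_univ_four]

/-- A kernel vector would give a linear combination with zero initial jet, hence a vanishing
combination. -/
theorem IsFundamentalSystem.det_jetMat_ne_zero {p : Params} {lam : ℂ} {φ : Fin 4 → ℝ → ℂ}
    (hφ : IsFundamentalSystem p lam φ) : (jetMat φ).det ≠ 0 := by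
  intro h
  obtain ⟨c, hc, hc0⟩ := Matrix.exists_mulVec_eq_zero_iff.2 h
  have hz : ∀ s, ∑ r, c r * φ r s = 0 := by
    intro s
    have : ∀ r, φ r s = ∑ j : Fin 4, propag p lam s 0 j * iteratedDeriv j (φ r) 0 := fun r => by
      have h0 := (hφ.1 r).iteratedDeriv_eq 0 s
      simpa using h0
    simp only [this, Finset.mul_sum]
    rw [Finset.sum_comm]
    refine Finset.sum_eq_zero fun j _ => ?_
    have hj := congrFun hc0 j
    simp only [Matrix.mulVec, dotProduct, jetMat, Matrix.of_apply, Pi.zero_apply] at hj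
    calc ∑ r, c r * (propag p lam s 0 j * iteratedDeriv j (φ r) 0)
        = propag p lam s 0 j * ∑ r, iteratedDeriv j (φ r) 0 * c r := by
          rw [Finset.mul_sum]; exact Finset.sum_congr rfl fun r _ => by ring
      _ = 0 := by rw [hj, mul_zero]
  refine hc (funext fun r => Fintype.linearIndependent_iff.1 hφ.2 c ?_ r)
  funext s
  simpa using hz s

theorem Delta1_eq_zero_iff {p : Params} {lam : ℂ} {φ : Fin 4 → ℝ → ℂ}
    (hφ : IsFundamentalSystem p lam φ) :
    Delta1 p lam φ = 0 ↔ (bcMat p lam (forceRow p lam)).det = 0 := by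
  rw [Delta1_eq hφ.1, mul_eq_zero, or_iff_left hφ.det_jetMat_ne_zero]

theorem Delta2_eq_zero_iff {p : Params} {lam : ℂ} {φ : Fin 4 → ℝ → ℂ}
    (hφ : IsFundamentalSystem p lam φ) :
    Delta2 p lam φ = 0 ↔ (bcMat p lam pinRow).det = 0 := by
  rw [Delta2_eq hφ.1, mul_eq_zero, or_iff_left hφ.det_jetMat_ne_zero]

/-! ### Absence of modes in the closed right half-plane -/

/-- An antitone function that does not drop from `0` to `1` is constant in between. In the
applications `K` is an energy flux and `K'` minus a sum of squares. -/
theorem deriv_eq_zero_of_nonpos {K K' : ℝ → ℝ} (hK : ∀ s, HasDerivAt K (K' s) s)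
    (hK' : ∀ s, K' s ≤ 0) (h01 : K 0 ≤ K 1) {s : ℝ} (hs : s ∈ Ioo (0 : ℝ) 1) : K' s = 0 := by
  have hanti : Antitone K := antitone_of_hasDerivAt_nonpos hK hK'
  have hc : ∀ t ∈ Ioo (0 : ℝ) 1, K t = K 0 := fun t ht =>
    le_antisymm (hanti ht.1.le) (h01.trans (hanti ht.2.le))
  have he : K =ᶠ[𝓝 s] fun _ => K 0 := by
    filter_upwards [isOpen_Ioo.mem_nhds hs] with t ht using hc t ht
  exact (hK s).unique ((hasDerivAt_const s (K 0)).congr_of_eventuallyEq he)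

theorem IsSolution.eq_zero_of_eqOn {p : Params} {lam : ℂ} {f : ℝ → ℂ}
    (hf : IsSolution p lam f) (h : ∀ s ∈ Ioo (0 : ℝ) 1, f s = 0) : f = 0 := by
  refine hf.eq_zero_of_jet (t := 1 / 2) fun r => ?_
  have he : f =ᶠ[𝓝 (1 / 2 : ℝ)] fun _ => 0 := by
    filter_upwards [isOpen_Ioo.mem_nhds (show (1 / 2 : ℝ) ∈ Ioo (0 : ℝ) 1 by norm_num)] with t ht
      using h t ht
  rw [he.iteratedDeriv_eq]
  simp

theorem eq_zero_and_eq_zero_of_sq_add_sq {x y : ℝ} (h : x ^ 2 + y ^ 2 = 0) : x = 0 ∧ y = 0 := by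
  constructor <;> nlinarith [sq_nonneg x, sq_nonneg y]

/-! ### Energy identities for the real and imaginary parts of a solution -/

section RealSystem

variable {g b l m : ℝ} {u v : Fin 4 → ℝ → ℝ}

/-- Real and imaginary parts of the jet of a solution, with `λ = l + i m`. -/
structure RealJet (g b l m : ℝ) (u v : Fin 4 → ℝ → ℝ) : Prop where
  u0 : ∀ s, HasDerivAt (u 0) (u 1 s) s
  u1 : ∀ s, HasDerivAt (u 1) (u 2 s) s
  u2 : ∀ s, HasDerivAt (u 2) (u 3 s) s
  u3 : ∀ s, HasDerivAt (u 3) (-((l ^ 2 - m ^ 2) * u 0 s - 2 * l * m * v 0 s)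
    - 2 * b * (l * u 1 s - m * v 1 s) + g * u 2 s) s
  v0 : ∀ s, HasDerivAt (v 0) (v 1 s) s
  v1 : ∀ s, HasDerivAt (v 1) (v 2 s) s
  v2 : ∀ s, HasDerivAt (v 2) (v 3 s) s
  v3 : ∀ s, HasDerivAt (v 3) (-((l ^ 2 - m ^ 2) * v 0 s + 2 * l * m * u 0 s)
    - 2 * b * (l * v 1 s + m * u 1 s) + g * v 2 s) s

/-- The power balance. -/
theorem RealJet.hasDerivAt_power (h : RealJet g b l m u v) (s : ℝ) :
    HasDerivAt (fun s => l * (u 3 s * u 0 s + v 3 s * v 0 s - (u 2 s * u 1 s + v 2 s * v 1 s)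
        - g * (u 1 s * u 0 s + v 1 s * v 0 s))
      + m * (v 3 s * u 0 s - u 3 s * v 0 s - (v 2 s * u 1 s - u 2 s * v 1 s)
        - g * (v 1 s * u 0 s - u 1 s * v 0 s))
      + (l ^ 2 + m ^ 2) * b * (u 0 s * u 0 s + v 0 s * v 0 s))
      (-(l * ((l ^ 2 + m ^ 2) * (u 0 s ^ 2 + v 0 s ^ 2) + u 2 s ^ 2 + v 2 s ^ 2
        + g * (u 1 s ^ 2 + v 1 s ^ 2)))) s := by
  -- With `f = u + iv` this is the real part of the equation tested with the conjugate of `λ f`. The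
  -- gyroscopic term becomes the total derivative of `|λ|² b |f|²`, and is absorbed in the flux.
  have a0 := h.u0 s
  have a1 := h.u1 s
  have a2 := h.u2 s
  have a3 := h.u3 s
  have b0 := h.v0 s
  have b1 := h.v1 s
  have b2 := h.v2 s
  have b3 := h.v3 s
  refine (((((((a3.mul a0).add (b3.mul b0)).sub ((a2.mul a1).add (b2.mul b1))).sub
    (((a1.mul a0).add (b1.mul b0)).const_mul g)).const_mul l).add
    (((((b3.mul a0).sub (a3.mul b0)).sub ((b2.mul a1).sub (a2.mul b1))).sub
    (((b1.mul a0).sub (a1.mul b0)).const_mul g)).const_mul m)).add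
    (((a0.mul a0).add (b0.mul b0)).const_mul ((l ^ 2 + m ^ 2) * b))).congr_deriv ?_
  ring

/-- At `λ = 0` the multiplier of the power balance vanishes, so the equation is tested with the
conjugate of `f` instead. -/
theorem RealJet.hasDerivAt_static (h : RealJet g b 0 0 u v) (s : ℝ) :
    HasDerivAt (fun s => u 3 s * u 0 s + v 3 s * v 0 s - (u 2 s * u 1 s + v 2 s * v 1 s)
        - g * (u 1 s * u 0 s + v 1 s * v 0 s))
      (-(u 2 s ^ 2 + v 2 s ^ 2 + g * (u 1 s ^ 2 + v 1 s ^ 2))) s := by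
  have a0 := h.u0 s
  have a1 := h.u1 s
  have a2 := h.u2 s
  have a3 := h.u3 s
  have b0 := h.v0 s
  have b1 := h.v1 s
  have b2 := h.v2 s
  have b3 := h.v3 s
  refine (((((a3.mul a0).add (b3.mul b0)).sub ((a2.mul a1).add (b2.mul b1))).sub
    (((a1.mul a0).add (b1.mul b0)).const_mul g))).congr_deriv ?_
  ring

/-- On the imaginary axis, translation invariance gives a first integral. -/
theorem RealJet.hasDerivAt_hamiltonian (h : RealJet g b 0 m u v) (s : ℝ) :
    HasDerivAt (fun s => u 3 s * u 1 s + v 3 s * v 1 s - (1 / 2) * (u 2 s * u 2 s + v 2 s * v 2 s)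
      - g / 2 * (u 1 s * u 1 s + v 1 s * v 1 s) - m ^ 2 / 2 * (u 0 s * u 0 s + v 0 s * v 0 s))
      0 s := by
  -- The multiplier is now the conjugate of `f'`. For imaginary `λ` the gyroscopic term `2λb|f'|²`
  -- has no real part, and `λ²` is real.
  have a0 := h.u0 s
  have a1 := h.u1 s
  have a2 := h.u2 s
  have a3 := h.u3 s
  have b0 := h.v0 s
  have b1 := h.v1 s
  have b2 := h.v2 s
  have b3 := h.v3 s
  refine (((((a3.mul a1).add (b3.mul b1)).sub (((a2.mul a2).add (b2.mul b2)).const_mul (1 / 2))).sub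
    (((a1.mul a1).add (b1.mul b1)).const_mul (g / 2))).sub
    (((a0.mul a0).add (b0.mul b0)).const_mul (m ^ 2 / 2))).congr_deriv ?_
  ring

/-- The derivative of a solution on the imaginary axis is again a solution. -/
theorem RealJet.derivative (h : RealJet g b 0 m u v) :
    RealJet g b 0 m
      ![u 1, u 2, u 3, fun s => m ^ 2 * u 0 s + 2 * b * m * v 1 s + g * u 2 s]
      ![v 1, v 2, v 3, fun s => m ^ 2 * v 0 s - 2 * b * m * u 1 s + g * v 2 s] where
  u0 := h.u1
  u1 := h.u2
  u2 s := (h.u3 s).congr_deriv (by simp only [Matrix.cons_val]; ring)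
  u3 s := ((((h.u0 s).const_mul (m ^ 2)).add ((h.v1 s).const_mul (2 * b * m))).add
    ((h.u2 s).const_mul g)).congr_deriv (by
      simp only [Matrix.cons_val, Matrix.cons_val_zero, Matrix.cons_val_one]; ring)
  v0 := h.v1
  v1 := h.v2
  v2 s := (h.v3 s).congr_deriv (by simp only [Matrix.cons_val]; ring)
  v3 s := ((((h.v0 s).const_mul (m ^ 2)).sub ((h.u1 s).const_mul (2 * b * m))).add
    ((h.v2 s).const_mul g)).congr_deriv (by
      simp only [Matrix.cons_val, Matrix.cons_val_zero, Matrix.cons_val_one]; ring)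

theorem eq_of_hasDerivAt_zero {K : ℝ → ℝ} (hK : ∀ s, HasDerivAt K 0 s) : K 0 = K 1 :=
  is_const_of_deriv_eq_zero (fun s => (hK s).differentiableAt) (fun s => (hK s).deriv) 0 1

/-- With `f`, `f'`, `f''` zero at `0` the Hamiltonian vanishes identically and expresses `Re (f'''
conj f')` as a sum of squares. The function `-Re (f'' conj f')` is then nonincreasing and zero at
both ends, so all the squares vanish. -/
theorem RealJet.eq_zero_of_pinned (h : RealJet g b 0 m u v) (hg : 0 < g) (hm : m ≠ 0)
    (h1 : u 2 1 = 0 ∧ v 2 1 = 0) (h0 : ∀ i : Fin 3, u i.castSucc 0 = 0 ∧ v i.castSucc 0 = 0) :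
    ∀ s ∈ Ioo (0 : ℝ) 1, u 0 s = 0 ∧ v 0 s = 0 := by
  have e0 := h0 0
  have e1 := h0 1
  have e2 := h0 2
  simp only [Fin.castSucc_zero, Fin.castSucc_one] at e0 e1
  replace e2 : u 2 0 = 0 ∧ v 2 0 = 0 := e2
  have hH : ∀ s, u 3 s * u 1 s + v 3 s * v 1 s = (1 / 2) * (u 2 s * u 2 s + v 2 s * v 2 s)
      + g / 2 * (u 1 s * u 1 s + v 1 s * v 1 s) + m ^ 2 / 2 * (u 0 s * u 0 s + v 0 s * v 0 s) := by
    intro s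
    have := is_const_of_deriv_eq_zero (fun s => (h.hasDerivAt_hamiltonian s).differentiableAt)
      (fun s => (h.hasDerivAt_hamiltonian s).deriv) s 0
    simp only [e0.1, e0.2, e1.1, e1.2, e2.1, e2.2] at this
    linarith
  have hQ : ∀ s, HasDerivAt (fun s => -(u 2 s * u 1 s + v 2 s * v 1 s))
      (-(3 / 2 * (u 2 s ^ 2 + v 2 s ^ 2) + g / 2 * (u 1 s ^ 2 + v 1 s ^ 2)
        + m ^ 2 / 2 * (u 0 s ^ 2 + v 0 s ^ 2))) s := by
    intro s
    refine (((h.u2 s).mul (h.u1 s)).add ((h.v2 s).mul (h.v1 s))).neg.congr_deriv ?_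
    have := hH s
    linarith
  intro s hs
  have := deriv_eq_zero_of_nonpos hQ (fun s => neg_nonpos.2 (by positivity))
    (by simp [h1.1, h1.2, e1.1, e1.2]) hs
  have hm2 : 0 < m ^ 2 / 2 := by positivity
  have p1 : 0 ≤ 3 / 2 * (u 2 s ^ 2 + v 2 s ^ 2) := by positivity
  have p2 : 0 ≤ g / 2 * (u 1 s ^ 2 + v 1 s ^ 2) := by positivity
  have p3 : 0 ≤ m ^ 2 / 2 * (u 0 s ^ 2 + v 0 s ^ 2) := by positivity
  have p4 : m ^ 2 / 2 * (u 0 s ^ 2 + v 0 s ^ 2) = 0 := by linarith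
  have p5 : u 0 s ^ 2 + v 0 s ^ 2 = 0 := (mul_eq_zero.1 p4).resolve_left hm2.ne'
  exact eq_zero_and_eq_zero_of_sq_add_sq p5

/-- The conservation laws applied to `f'` yield `f'(1) = 0`: the power balance of `f'` gives `m² b
|f'(1)|² = 0`, which settles `b ≠ 0`, and for `b = 0` one has `f'''(0) = 0`, so the Hamiltonian of
`f'` does it. The Hamiltonian of `f` is then `0` at `1` and `-m²|f(0)|²/2` at `0`. -/
theorem RealJet.eq_zero_of_free (h : RealJet g b 0 m u v) (hm : m ≠ 0)
    (h1 : u 0 1 = 0 ∧ v 0 1 = 0 ∧ u 2 1 = 0 ∧ v 2 1 = 0)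
    (h0 : u 1 0 = 0 ∧ v 1 0 = 0 ∧ u 2 0 = 0 ∧ v 2 0 = 0)
    (hf : u 3 0 = m * b * v 0 0 ∧ v 3 0 = -(m * b * u 0 0)) :
    u 0 0 = 0 ∧ v 0 0 = 0 := by
  obtain ⟨a0, b0, a2, b2⟩ := h1
  obtain ⟨c1, d1, c2, d2⟩ := h0
  have hH := eq_of_hasDerivAt_zero h.hasDerivAt_hamiltonian
  have hH2 := eq_of_hasDerivAt_zero h.derivative.hasDerivAt_hamiltonian
  have hC := eq_of_hasDerivAt_zero fun s =>
    (h.derivative.hasDerivAt_power s).congr_deriv (by rw [zero_mul, neg_zero])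
  simp only [Matrix.cons_val, Matrix.cons_val_zero, Matrix.cons_val_one, a0, b0, a2, b2, c1, d1, c2,
    d2, hf.1, hf.2] at hH hH2 hC
  have hC' : m ^ 2 * b * (u 1 1 ^ 2 + v 1 1 ^ 2) = 0 := by linarith
  have h11 : u 1 1 = 0 ∧ v 1 1 = 0 := by
    have key : u 1 1 ^ 2 + v 1 1 ^ 2 = 0 := by
      rcases mul_eq_zero.1 hC' with hb | hb
      · have hb : b = 0 := (mul_eq_zero.1 hb).resolve_left (by positivity)
        rw [hb] at hH2
        have hm2 : 0 < m ^ 2 := by positivity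
        have : m ^ 2 * (u 1 1 ^ 2 + v 1 1 ^ 2) = 0 := by
          have p1 : 0 ≤ m ^ 2 * (u 1 1 ^ 2 + v 1 1 ^ 2) := by positivity
          have p2 := sq_nonneg (u 3 1)
          have p3 := sq_nonneg (v 3 1)
          linarith
        exact (mul_eq_zero.1 this).resolve_left hm2.ne'
      · exact hb
    exact eq_zero_and_eq_zero_of_sq_add_sq key
  rw [h11.1, h11.2] at hH
  have hm2 : m ^ 2 ≠ 0 := by positivity
  have : m ^ 2 * (u 0 0 ^ 2 + v 0 0 ^ 2) = 0 := by linarith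
  exact eq_zero_and_eq_zero_of_sq_add_sq ((mul_eq_zero.1 this).resolve_left hm2)

/-- The flux vanishes at `1`, and at `0` the vertex conditions turn it into `-(lα + |λ|²κ)|f'(0)|² ≤
0`; under the force condition the `b` terms cancel. Hence the energy density is zero. -/
theorem RealJet.eq_zero_of_pos {α κ : ℝ} (h : RealJet g b l m u v) (hg : 0 < g) (hα : 0 ≤ α)
    (hκ : 0 < κ) (hl : 0 < l) (h1 : u 0 1 = 0 ∧ v 0 1 = 0 ∧ u 2 1 = 0 ∧ v 2 1 = 0)
    (m1 : u 2 0 = (α + l * κ) * u 1 0 - m * κ * v 1 0)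
    (m2 : v 2 0 = (α + l * κ) * v 1 0 + m * κ * u 1 0)
    (hB : (u 3 0 = g * u 1 0 - b * (l * u 0 0 - m * v 0 0) ∧
      v 3 0 = g * v 1 0 - b * (l * v 0 0 + m * u 0 0)) ∨ (u 0 0 = 0 ∧ v 0 0 = 0)) :
    ∀ s ∈ Ioo (0 : ℝ) 1, u 0 s = 0 ∧ v 0 s = 0 := by
  intro s hs
  obtain ⟨u01, v01, u21, v21⟩ := h1
  have := deriv_eq_zero_of_nonpos h.hasDerivAt_power
    (fun s => neg_nonpos.2 (by positivity)) (by
      rw [u01, v01, u21, v21]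
      have q : 0 ≤ l * α * (u 1 0 ^ 2 + v 1 0 ^ 2) := by positivity
      have q2 : 0 ≤ κ * (l ^ 2 + m ^ 2) * (u 1 0 ^ 2 + v 1 0 ^ 2) := by positivity
      rcases hB with ⟨w1, w2⟩ | ⟨w1, w2⟩
      · rw [w1, w2, m1, m2]; linarith
      · rw [w1, w2, m1, m2]; linarith) hs
  have p0 := (mul_eq_zero.1 (neg_eq_zero.1 this)).resolve_left hl.ne'
  have p1 : 0 ≤ u 2 s ^ 2 + v 2 s ^ 2 := by positivity
  have p2 : 0 ≤ g * (u 1 s ^ 2 + v 1 s ^ 2) := by positivity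
  have p3 : 0 ≤ (l ^ 2 + m ^ 2) * (u 0 s ^ 2 + v 0 s ^ 2) := by positivity
  have p4 : (l ^ 2 + m ^ 2) * (u 0 s ^ 2 + v 0 s ^ 2) = 0 := by linarith
  have p5 := (mul_eq_zero.1 p4).resolve_left (by positivity)
  exact eq_zero_and_eq_zero_of_sq_add_sq p5

theorem RealJet.deriv_eq_zero_of_static {α : ℝ} (h : RealJet g b 0 0 u v) (hg : 0 < g) (hα : 0 ≤ α)
    (h1 : u 0 1 = 0 ∧ v 0 1 = 0 ∧ u 2 1 = 0 ∧ v 2 1 = 0)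
    (m1 : u 2 0 = α * u 1 0) (m2 : v 2 0 = α * v 1 0)
    (hB : (u 3 0 = g * u 1 0 ∧ v 3 0 = g * v 1 0) ∨ (u 0 0 = 0 ∧ v 0 0 = 0)) :
    ∀ s ∈ Ioo (0 : ℝ) 1, u 1 s = 0 ∧ v 1 s = 0 := by
  intro s hs
  obtain ⟨u01, v01, u21, v21⟩ := h1
  have := deriv_eq_zero_of_nonpos h.hasDerivAt_static
    (fun s => neg_nonpos.2 (by positivity)) (by
      rw [u01, v01, u21, v21]
      have q : 0 ≤ α * (u 1 0 ^ 2 + v 1 0 ^ 2) := by positivity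
      rcases hB with ⟨w1, w2⟩ | ⟨w1, w2⟩
      · rw [w1, w2, m1, m2]; linarith
      · rw [w1, w2, m1, m2]; linarith) hs
  have p1 : 0 ≤ u 2 s ^ 2 + v 2 s ^ 2 := by positivity
  have p2 : 0 ≤ g * (u 1 s ^ 2 + v 1 s ^ 2) := by positivity
  have p3 : g * (u 1 s ^ 2 + v 1 s ^ 2) = 0 := by linarith
  have p4 := (mul_eq_zero.1 p3).resolve_left hg.ne'
  exact eq_zero_and_eq_zero_of_sq_add_sq p4

/-- On the imaginary axis the flux is conserved. Its end values give `κ m² |f'(0)|² = 0`, so the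
damper is at rest and `f'(0) = f''(0) = 0`. The free case then supplies `f(0) = 0` if it is not
already imposed, and the pinned case concludes. -/
theorem RealJet.eq_zero_of_imaginary {α κ : ℝ} (h : RealJet g b 0 m u v) (hg : 0 < g)
    (hκ : 0 < κ) (hm : m ≠ 0) (h1 : u 0 1 = 0 ∧ v 0 1 = 0 ∧ u 2 1 = 0 ∧ v 2 1 = 0)
    (m1 : u 2 0 = α * u 1 0 - m * κ * v 1 0) (m2 : v 2 0 = α * v 1 0 + m * κ * u 1 0)
    (hB : (u 3 0 = g * u 1 0 + b * m * v 0 0 ∧ v 3 0 = g * v 1 0 - b * m * u 0 0) ∨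
      (u 0 0 = 0 ∧ v 0 0 = 0)) :
    ∀ s ∈ Ioo (0 : ℝ) 1, u 0 s = 0 ∧ v 0 s = 0 := by
  have hK := eq_of_hasDerivAt_zero fun s =>
    (h.hasDerivAt_power s).congr_deriv (by rw [zero_mul, neg_zero])
  simp only [h1.1, h1.2.1, h1.2.2.1, h1.2.2.2] at hK
  have hκm : 0 < κ * m ^ 2 := by positivity
  have h10 : κ * m ^ 2 * (u 1 0 ^ 2 + v 1 0 ^ 2) = 0 := by
    rcases hB with ⟨w1, w2⟩ | ⟨w1, w2⟩
    · rw [w1, w2, m1, m2] at hK; linarith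
    · rw [w1, w2, m1, m2] at hK; linarith
  have h10' := (mul_eq_zero.1 h10).resolve_left hκm.ne'
  obtain ⟨u10, v10⟩ := eq_zero_and_eq_zero_of_sq_add_sq h10'
  have u20 : u 2 0 = 0 := by rw [m1, u10, v10]; ring
  have v20 : v 2 0 = 0 := by rw [m2, u10, v10]; ring
  have h00 : u 0 0 = 0 ∧ v 0 0 = 0 := by
    rcases hB with ⟨w1, w2⟩ | h'
    · exact h.eq_zero_of_free hm h1 ⟨u10, v10, u20, v20⟩
        ⟨by rw [w1, u10]; ring, by rw [w2, v10]; ring⟩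
    · exact h'
  refine h.eq_zero_of_pinned hg hm h1.2.2 fun i => ?_
  fin_cases i
  exacts [h00, ⟨u10, v10⟩, ⟨u20, v20⟩]

end RealSystem

theorem IsSolution.realJet {p : Params} {lam : ℂ} {f : ℝ → ℂ} (hf : IsSolution p lam f) :
    RealJet (p.γ - p.η ^ 2) (p.β * p.η) lam.re lam.im
      (fun i s => (iteratedDeriv i f s).re) (fun i s => (iteratedDeriv i f s).im) := by
  have hre : ∀ (j : ℕ), j < 4 → ∀ s, HasDerivAt (fun s => (iteratedDeriv j f s).re)
      (iteratedDeriv (j + 1) f s).re s := fun j hj s =>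
    Complex.reCLM.hasFDerivAt.comp_hasDerivAt s (hf.hasDerivAt_iteratedDeriv hj s)
  have him : ∀ (j : ℕ), j < 4 → ∀ s, HasDerivAt (fun s => (iteratedDeriv j f s).im)
      (iteratedDeriv (j + 1) f s).im s := fun j hj s =>
    Complex.imCLM.hasFDerivAt.comp_hasDerivAt s (hf.hasDerivAt_iteratedDeriv hj s)
  refine ⟨hre 0 (by norm_num), hre 1 (by norm_num), hre 2 (by norm_num), fun s => ?_,
    him 0 (by norm_num), him 1 (by norm_num), him 2 (by norm_num), fun s => ?_⟩
  · refine (hre 3 (by norm_num) s).congr_deriv ?_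
    rw [hf.iteratedDeriv_four s]
    simp [pow_two]
    ring
  · refine (him 3 (by norm_num) s).congr_deriv ?_
    rw [hf.iteratedDeriv_four s]
    simp [pow_two]
    ring

/-- There is no nontrivial solution of either boundary value problem when `0 ≤ Re λ`. -/
theorem IsSolution.eq_zero_of_re_nonneg {p : Params} (hp : p.Admissible) (hκ : 0 < p.κ) {lam : ℂ}
    (hlam : 0 ≤ lam.re) {f : ℝ → ℂ} (hf : IsSolution p lam f) (h1 : f 1 = 0)
    (h2 : iteratedDeriv 2 f 1 = 0) (hm : momentForm p lam f = 0)
    (hB : forceForm p lam f = 0 ∨ f 0 = 0) : f = 0 := by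
  have hg : 0 < p.γ - p.η ^ 2 := sub_pos.2 hp.η_sq_lt
  have hα := hp.α_nonneg
  have hJ := hf.realJet
  set g := p.γ - p.η ^ 2 with hgdef
  set b := p.β * p.η with hbdef
  set u : Fin 4 → ℝ → ℝ := fun i s => (iteratedDeriv i f s).re with hu
  set v : Fin 4 → ℝ → ℝ := fun i s => (iteratedDeriv i f s).im with hv
  set l := lam.re with hl
  set m := lam.im with hmdef
  have u01 : u 0 1 = 0 := by simp [hu, h1]
  have v01 : v 0 1 = 0 := by simp [hv, h1]
  have u21 : u 2 1 = 0 := by simp [hu, h2]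
  have v21 : v 2 1 = 0 := by simp [hv, h2]
  have m1 : u 2 0 = (p.α + l * p.κ) * u 1 0 - m * p.κ * v 1 0 := by
    have := congrArg Complex.re hm
    simp [momentForm] at this
    simp only [hu, Fin.val_one, Fin.val_two, iteratedDeriv_one, hv]
    linarith
  have m2 : v 2 0 = (p.α + l * p.κ) * v 1 0 + m * p.κ * u 1 0 := by
    have := congrArg Complex.im hm
    simp [momentForm] at this
    simp only [hu, Fin.val_one, Fin.val_two, iteratedDeriv_one, hv]
    linarith
  have hB' : (u 3 0 = g * u 1 0 - b * (l * u 0 0 - m * v 0 0) ∧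
      v 3 0 = g * v 1 0 - b * (l * v 0 0 + m * u 0 0)) ∨ (u 0 0 = 0 ∧ v 0 0 = 0) := by
    rcases hB with hB | hB
    · left
      have e1 := congrArg Complex.re hB
      have e2 := congrArg Complex.im hB
      simp [forceForm, pow_two] at e1 e2
      simp only [hu, hv, hgdef, hbdef, Fin.val_zero, Fin.val_one, iteratedDeriv_one,
        iteratedDeriv_zero, show ((3 : Fin 4) : ℕ) = 3 from rfl, pow_two]
      constructor <;> linarith
    · right; simp [hu, hv, hB]
  have conv : (∀ s ∈ Ioo (0 : ℝ) 1, u 0 s = 0 ∧ v 0 s = 0) → f = 0 := fun h =>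
    hf.eq_zero_of_eqOn fun s hs => by
      have := h s hs
      simp only [hu, hv, Fin.val_zero, iteratedDeriv_zero] at this
      exact Complex.ext this.1 this.2
  rcases hlam.eq_or_lt with hl0 | hlpos
  · rw [← hl0] at hJ m1 m2 hB'
    -- At `λ = 0` the energy controls only `f'`; the solution is then constant and the end condition
    -- `f(1) = 0` removes the constant.
    by_cases hm0 : m = 0
    · rw [hm0] at hJ m1 m2 hB'
      have hz := hJ.deriv_eq_zero_of_static hg hα ⟨u01, v01, u21, v21⟩ (by rw [m1]; ring)
        (by rw [m2]; ring) (hB'.imp (fun h => ⟨by rw [h.1]; ring, by rw [h.2]; ring⟩) id)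
      have hder : ∀ s ∈ Ioo (0 : ℝ) 1, deriv f s = 0 := fun s hs => by
        have := hz s hs
        simp only [hu, hv, Fin.val_one, iteratedDeriv_one] at this
        exact Complex.ext this.1 this.2
      have hdiff : Differentiable ℝ f := hf.1.differentiable (by norm_num)
      refine hf.eq_zero_of_eqOn fun s hs => ?_
      rw [← h1]
      have hconst := constant_of_derivWithin_zero (f := f) (a := s) (b := 1)
        hdiff.differentiableOn (fun t ht => by
          rw [(hdiff t).derivWithin ((uniqueDiffOn_Icc hs.2) t ⟨ht.1, ht.2.le⟩)]
          exact hder t ⟨hs.1.trans_le ht.1, ht.2⟩)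
      exact (hconst 1 ⟨hs.2.le, le_rfl⟩).symm
    · exact conv (hJ.eq_zero_of_imaginary (α := p.α) hg hκ hm0 ⟨u01, v01, u21, v21⟩ (by rw [m1]; ring)
        (by rw [m2]; ring) (hB'.imp (fun h => ⟨by rw [h.1]; ring, by rw [h.2]; ring⟩) id))
  · exact conv (hJ.eq_zero_of_pos hg hα hκ hlpos ⟨u01, v01, u21, v21⟩ m1 m2 hB')

theorem exists_solution_of_det_eq_zero {p : Params} {lam : ℂ} {l : Fin 4 → ℂ}
    (h : (bcMat p lam l).det = 0) : ∃ c : Fin 4 → ℂ, c ≠ 0 ∧ (bcMat p lam l).mulVec c = 0 :=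
  Matrix.exists_mulVec_eq_zero_iff.2 h

theorem solOf_ne_zero {p : Params} {lam : ℂ} {c : Fin 4 → ℂ} (hc : c ≠ 0) :
    solOf p lam c ≠ 0 := by
  intro h
  refine hc (funext fun r => ?_)
  have := (solOf_spec p lam c).2 r 0
  rw [h] at this
  simpa [propag_zero, Matrix.one_apply] using this.symm

theorem solOf_boundary {p : Params} {lam : ℂ} {l c : Fin 4 → ℂ}
    (hc : (bcMat p lam l).mulVec c = 0) :
    solOf p lam c 1 = 0 ∧ iteratedDeriv 2 (solOf p lam c) 1 = 0 ∧
      momentForm p lam (solOf p lam c) = 0 ∧ ∑ r, l r * c r = 0 := by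
  have hj := (solOf_spec p lam c).2
  have e0 := congrFun hc 0
  have e1 := congrFun hc 1
  have e2 := congrFun hc 2
  have e3 := congrFun hc 3
  simp only [bcMat, Matrix.mulVec, dotProduct, Matrix.of_apply, Pi.zero_apply, Matrix.cons_val] at e0 e1 e2 e3
  refine ⟨e0, ?_, ?_, e3⟩
  · exact (hj 2 1).trans e1
  · have j1 := hj 1 0
    have j2 := hj 2 0
    simp [propag_zero, Matrix.one_apply] at j1 j2
    simp [Fin.sum_univ_four] at e2
    simp [momentForm, j1, j2]
    linear_combination e2

/-- A kernel vector is the initial jet of a nontrivial solution of the boundary problem with the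
force condition, and there is none. -/
theorem det_bcMat_force_ne_zero {p : Params} (hp : p.Admissible) (hκ : 0 < p.κ) {lam : ℂ}
    (hlam : 0 ≤ lam.re) : (bcMat p lam (forceRow p lam)).det ≠ 0 := by
  intro h
  obtain ⟨c, hc, hc0⟩ := exists_solution_of_det_eq_zero h
  obtain ⟨h1, h2, h3, h4⟩ := solOf_boundary hc0
  refine solOf_ne_zero hc ((solOf_spec p lam c).1.eq_zero_of_re_nonneg hp hκ hlam h1 h2 h3 (Or.inl ?_))
  have hj := (solOf_spec p lam c).2
  have j0 := hj 0 0
  have j1 := hj 1 0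
  have j3 := hj 3 0
  rw [show ((3 : Fin 4) : ℕ) = 3 from rfl] at j3
  simp [propag_zero, Matrix.one_apply] at j0 j1 j3
  simp [Fin.sum_univ_four, forceRow] at h4
  simp [forceForm, j0, j1, j3]
  linear_combination h4

theorem det_bcMat_pin_ne_zero {p : Params} (hp : p.Admissible) (hκ : 0 < p.κ) {lam : ℂ}
    (hlam : 0 ≤ lam.re) : (bcMat p lam pinRow).det ≠ 0 := by
  intro h
  obtain ⟨c, hc, hc0⟩ := exists_solution_of_det_eq_zero h
  obtain ⟨h1, h2, h3, h4⟩ := solOf_boundary hc0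
  refine solOf_ne_zero hc ((solOf_spec p lam c).1.eq_zero_of_re_nonneg hp hκ hlam h1 h2 h3 (Or.inr ?_))
  have j0 := (solOf_spec p lam c).2 0 0
  simp [propag_zero, Matrix.one_apply] at j0
  simp [Fin.sum_univ_four, pinRow] at h4
  rw [j0, h4]

/-! ### Primitives on the unit interval and weak derivatives -/

/-- `U` is a primitive of the integrable function `V` on `[0,1]`. -/
structure IsPrim (U V : ℝ → ℂ) : Prop where
  intervalIntegrable : IntervalIntegrable V volume 0 1
  eq_add : ∀ s ∈ Icc (0 : ℝ) 1, U s = U 0 + ∫ t in (0 : ℝ)..s, V t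

/-- The real and imaginary parts are treated as real integrals and recombined. -/
theorem absolutelyContinuousOnInterval_integral {f : ℝ → ℂ}
    (hf : IntervalIntegrable f volume 0 1) :
    AbsolutelyContinuousOnInterval (fun s => ∫ t in (0 : ℝ)..s, f t) 0 1 := by
  have hre : IntervalIntegrable (fun t => (f t).re) volume 0 1 := ⟨hf.1.re, hf.2.re⟩
  have him : IntervalIntegrable (fun t => (f t).im) volume 0 1 := ⟨hf.1.im, hf.2.im⟩
  have c : ∀ z : ℂ, AbsolutelyContinuousOnInterval (fun _ : ℝ => z) 0 1 := fun z =>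
    (LipschitzWith.const z).lipschitzOnWith.absolutelyContinuousOnInterval
  have key := ((hre.absolutelyContinuousOnInterval_intervalIntegral (c := 0) (by simp)).fun_smul
    (c 1)).fun_add ((him.absolutelyContinuousOnInterval_intervalIntegral (c := 0)
      (by simp)).fun_smul (c Complex.I))
  rw [absolutelyContinuousOnInterval_iff] at key ⊢
  have e : ∀ s ∈ uIcc (0 : ℝ) 1, ∫ t in (0 : ℝ)..s, f t = (∫ t in (0 : ℝ)..s, (f t).re) • (1 : ℂ)
      + (∫ t in (0 : ℝ)..s, (f t).im) • Complex.I := by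
    intro s hs
    have hfs : IntervalIntegrable f volume 0 s :=
      hf.mono_set (uIcc_subset_uIcc_left hs)
    have h1 := Complex.reCLM.intervalIntegral_comp_comm hfs
    have h2 := Complex.imCLM.intervalIntegral_comp_comm hfs
    simp only [Complex.reCLM_apply, Complex.imCLM_apply] at h1 h2
    rw [h1, h2]
    apply Complex.ext <;> simp
  intro ε hε
  obtain ⟨δ, hδ, h⟩ := key ε hε
  refine ⟨δ, hδ, fun E hE hl => ?_⟩
  have := h E hE hl
  convert this using 1
  refine Finset.sum_congr rfl fun i hi => ?_
  have hm := hE.1 i (by simpa using hi)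
  rw [e _ hm.1, e _ hm.2]

/-- Product rule for merely integrable derivatives: the product minus the integral of its expected
derivative is absolutely continuous with derivative zero almost everywhere, hence constant. -/
theorem integral_mul_primitives {f g : ℝ → ℂ} (hf : IntervalIntegrable f volume 0 1)
    (hg : IntervalIntegrable g volume 0 1) (a b : ℂ) :
    IsPrim (fun s => (a + ∫ t in (0 : ℝ)..s, f t) * (b + ∫ t in (0 : ℝ)..s, g t))
      (fun s => f s * (b + ∫ t in (0 : ℝ)..s, g t) + (a + ∫ t in (0 : ℝ)..s, f t) * g s) := by
  have c : ∀ z : ℂ, AbsolutelyContinuousOnInterval (fun _ : ℝ => z) 0 1 := fun z =>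
    (LipschitzWith.const z).lipschitzOnWith.absolutelyContinuousOnInterval
  have hF := (c a).fun_add (absolutelyContinuousOnInterval_integral hf)
  have hG := (c b).fun_add (absolutelyContinuousOnInterval_integral hg)
  have hi : IntervalIntegrable (fun s => f s * (b + ∫ t in (0 : ℝ)..s, g t)
      + (a + ∫ t in (0 : ℝ)..s, f t) * g s) volume 0 1 :=
    (hf.mul_continuousOn hG.continuousOn).add (hg.continuousOn_mul hF.continuousOn)
  have hD := (hF.fun_smul hG).fun_sub (absolutelyContinuousOnInterval_integral hi)
  refine ⟨hi, fun s hs => ?_⟩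
  obtain ⟨C, hC⟩ := hD.const_of_ae_hasDerivAt_zero (by
    filter_upwards [hf.ae_hasDerivAt_integral, hg.ae_hasDerivAt_integral, hi.ae_hasDerivAt_integral]
      with x h1 h2 h3 hx
    have d := (((h1 hx 0 (by simp)).const_add a).mul ((h2 hx 0 (by simp)).const_add b)).sub
      (h3 hx 0 (by simp))
    rw [sub_self] at d
    exact d)
  rw [uIcc_of_le zero_le_one] at hC
  have e1 := hC s hs
  have e0 := hC 0 (by simp)
  simp only [intervalIntegral.integral_same, add_zero, sub_zero, smul_eq_mul] at e0 e1 ⊢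
  rw [e0]
  linear_combination e1

theorem IsPrim.congr_left {U U' V : ℝ → ℂ} (h : IsPrim U V) (hU : ∀ s ∈ Icc (0 : ℝ) 1, U' s = U s) :
    IsPrim U' V :=
  ⟨h.1, fun s hs => by rw [hU s hs, hU 0 (by simp), h.2 s hs]⟩

theorem intervalIntegral_congr_Ioo {V V' : ℝ → ℂ}
    (hV : V =ᵐ[volume.restrict (Ioo (0 : ℝ) 1)] V') {s : ℝ} (hs : s ∈ Icc (0 : ℝ) 1) :
    ∫ t in (0 : ℝ)..s, V t = ∫ t in (0 : ℝ)..s, V' t := by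
  rw [intervalIntegral.integral_of_le hs.1, intervalIntegral.integral_of_le hs.1,
    integral_Ioc_eq_integral_Ioo, integral_Ioc_eq_integral_Ioo]
  exact integral_congr_ae (ae_mono (Measure.restrict_mono (Ioo_subset_Ioo_right hs.2) le_rfl) hV)

theorem intervalIntegrable_iff_Ioo {V : ℝ → ℂ} :
    IntervalIntegrable V volume 0 1 ↔ Integrable V (volume.restrict (Ioo (0 : ℝ) 1)) := by
  rw [intervalIntegrable_iff_integrableOn_Ioo_of_le zero_le_one]
  rfl

theorem IsPrim.congr_right {U V V' : ℝ → ℂ} (h : IsPrim U V)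
    (hV : V =ᵐ[volume.restrict (Ioo (0 : ℝ) 1)] V') : IsPrim U V' :=
  ⟨intervalIntegrable_iff_Ioo.2 ((intervalIntegrable_iff_Ioo.1 h.1).congr hV), fun s hs => by
    rw [h.2 s hs, intervalIntegral_congr_Ioo hV hs]⟩

theorem IsPrim.mul {U V U' V' : ℝ → ℂ} (h : IsPrim U V) (h' : IsPrim U' V') :
    IsPrim (fun s => U s * U' s) (fun s => V s * U' s + U s * V' s) := by
  refine ((integral_mul_primitives h.1 h'.1 (U 0) (U' 0)).congr_left fun s hs => ?_).congr_right ?_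
  · rw [← h.2 s hs, ← h'.2 s hs]
  · filter_upwards [ae_restrict_mem measurableSet_Ioo] with s hs
    rw [← h.2 s (Ioo_subset_Icc_self hs), ← h'.2 s (Ioo_subset_Icc_self hs)]

theorem IsPrim.add {U V U' V' : ℝ → ℂ} (h : IsPrim U V) (h' : IsPrim U' V') :
    IsPrim (fun s => U s + U' s) (fun s => V s + V' s) := by
  refine ⟨h.1.add h'.1, fun s hs => ?_⟩
  have i : ∀ {V : ℝ → ℂ}, IntervalIntegrable V volume 0 1 → IntervalIntegrable V volume 0 s :=
    fun hV => hV.mono_set (uIcc_subset_uIcc_left (by rwa [uIcc_of_le zero_le_one]))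
  rw [intervalIntegral.integral_add (i h.1) (i h'.1), h.2 s hs, h'.2 s hs]
  ring

theorem IsPrim.const_mul {U V : ℝ → ℂ} (h : IsPrim U V) (c : ℂ) :
    IsPrim (fun s => c * U s) (fun s => c * V s) := by
  refine ⟨h.1.const_mul c, fun s hs => ?_⟩
  rw [intervalIntegral.integral_const_mul, h.2 s hs]
  ring

theorem IsPrim.sum {ι : Type*} [Fintype ι] {U V : ι → ℝ → ℂ} (h : ∀ i, IsPrim (U i) (V i)) :
    IsPrim (fun s => ∑ i, U i s) (fun s => ∑ i, V i s) := by
  have hi : ∀ i, IntervalIntegrable (V i) volume 0 1 := fun i => (h i).1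
  refine ⟨?_, fun s hs => ?_⟩
  · rw [intervalIntegrable_iff_Ioo]
    exact integrable_finsetSum _ fun i _ => intervalIntegrable_iff_Ioo.1 (hi i)
  · rw [intervalIntegral.integral_finsetSum fun i _ => (hi i).mono_set
      (uIcc_subset_uIcc_left (by rwa [uIcc_of_le zero_le_one])), ← Finset.sum_add_distrib]
    exact Finset.sum_congr rfl fun i _ => (h i).2 s hs

theorem isPrim_of_hasDerivAt {U V : ℝ → ℂ} (h : ∀ s, HasDerivAt U (V s) s) (hV : Continuous V) :
    IsPrim U V :=
  ⟨hV.intervalIntegrable 0 1, fun s _ => by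
    rw [intervalIntegral.integral_eq_sub_of_hasDerivAt (fun x _ => h x) (hV.intervalIntegrable _ _)]
    ring⟩

theorem isPrim_integral {V : ℝ → ℂ} (hV : IntervalIntegrable V volume 0 1) (c : ℂ) :
    IsPrim (fun s => c + ∫ t in (0 : ℝ)..s, V t) V :=
  ⟨hV, fun s _ => by simp⟩

theorem IsPrim.continuousOn {U V : ℝ → ℂ} (h : IsPrim U V) : ContinuousOn U (Icc 0 1) := by
  have := (absolutelyContinuousOnInterval_integral h.1).continuousOn
  rw [uIcc_of_le zero_le_one] at this
  exact (continuousOn_const.add this).congr fun s hs => h.2 s hs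

theorem intervalIntegrable_L2 (v : L2) : IntervalIntegrable v volume 0 1 :=
  intervalIntegrable_iff_Ioo.2 ((Lp.memLp v).integrable (by norm_num))

theorem IsPrim.integral_deriv_smul {U V : ℝ → ℂ} (h : IsPrim U V) {θ : ℝ → ℝ}
    (hθ : ContDiff ℝ ∞ θ) (hs : tsupport θ ⊆ Ioo 0 1) :
    ∫ s in Ioo (0 : ℝ) 1, deriv θ s • U s = -∫ s in Ioo (0 : ℝ) 1, θ s • V s := by
  have z0 : θ 0 = 0 := image_eq_zero_of_notMem_tsupport fun h => (hs h).1.false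
  have z1 : θ 1 = 0 := image_eq_zero_of_notMem_tsupport fun h => (hs h).2.false
  have hd : ∀ s, HasDerivAt (fun s => (θ s : ℂ)) ((deriv θ s : ℝ) : ℂ) s := fun s =>
    ((hθ.differentiable (by simp)) s).hasDerivAt.ofReal_comp
  have hc : Continuous (deriv θ) := hθ.continuous_deriv (by simp)
  have hP := isPrim_of_hasDerivAt hd (Complex.continuous_ofReal.comp hc)
  have hm := (hP.mul h).2 1 (by simp)
  have hU : ContinuousOn U (uIcc 0 1) := by rw [uIcc_of_le zero_le_one]; exact h.continuousOn
  rw [z0, z1, intervalIntegral.integral_add] at hm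
  · simp only [Complex.ofReal_zero, zero_mul, zero_add] at hm
    rw [intervalIntegral.integral_of_le zero_le_one, intervalIntegral.integral_of_le zero_le_one,
      integral_Ioc_eq_integral_Ioo, integral_Ioc_eq_integral_Ioo] at hm
    simp only [Complex.real_smul]
    exact eq_neg_of_add_eq_zero_left hm.symm
  · exact hP.1.mul_continuousOn hU
  · exact h.1.continuousOn_mul (Complex.continuous_ofReal.comp hθ.continuous).continuousOn

theorem hasWeakDeriv_of_isPrim {u v : L2} {U : ℝ → ℂ}
    (hu : u =ᵐ[volume.restrict (Ioo (0 : ℝ) 1)] U) (h : IsPrim U v) : HasWeakDeriv u v := by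
  intro θ h1 _ h3
  rw [← h.integral_deriv_smul h1 h3]
  refine integral_congr_ae ?_
  filter_upwards [hu] with s hs
  rw [hs]

/-- A test function with vanishing integral is the derivative of a test function. -/
theorem exists_test_primitive {ρ : ℝ → ℝ} (h1 : ContDiff ℝ ∞ ρ) (h2 : HasCompactSupport ρ)
    (h3 : tsupport ρ ⊆ Ioo 0 1) (h4 : ∫ t in (0 : ℝ)..1, ρ t = 0) :
    ∃ Θ : ℝ → ℝ, ContDiff ℝ ∞ Θ ∧ HasCompactSupport Θ ∧ tsupport Θ ⊆ Ioo 0 1 ∧ deriv Θ = ρ := by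
  have hρ : Continuous ρ := h1.continuous
  set Θ : ℝ → ℝ := fun s => ∫ t in (0 : ℝ)..s, ρ t with hΘ
  have hd : ∀ s, HasDerivAt Θ (ρ s) s := fun s =>
    intervalIntegral.integral_hasDerivAt_right (hρ.intervalIntegrable _ _)
      (hρ.stronglyMeasurableAtFilter _ _) hρ.continuousAt
  have hder : deriv Θ = ρ := funext fun s => (hd s).deriv
  -- The support keeps a positive distance from the end points. The primitive vanishes to the left
  -- of `a`, and to the right of `b` because the total integral is zero.
  obtain ⟨a, b, ha, hb, hab⟩ : ∃ a b : ℝ, 0 < a ∧ b < 1 ∧ tsupport ρ ⊆ Icc a b := by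
    rcases (tsupport ρ).eq_empty_or_nonempty with he | hne
    · exact ⟨1 / 2, 1 / 2, by norm_num, by norm_num, by simp [he]⟩
    · obtain ⟨a, ha, hal⟩ := h2.isCompact.exists_isLeast hne
      obtain ⟨b, hb, hbl⟩ := h2.isCompact.exists_isGreatest hne
      exact ⟨a, b, (h3 ha).1, (h3 hb).2, fun t ht => ⟨hal ht, hbl ht⟩⟩
  have hz : ∀ t, t ∉ Icc a b → ρ t = 0 := fun t ht =>
    image_eq_zero_of_notMem_tsupport fun h => ht (hab h)
  have hsub : tsupport Θ ⊆ Icc a b := by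
    refine closure_minimal (fun s hs => ?_) isClosed_Icc
    by_contra hn
    refine hs ?_
    rw [mem_Icc, not_and_or, not_le, not_le] at hn
    rcases hn with hn | hn
    · have : ∀ t ∈ uIcc 0 s, ρ t = 0 := fun t ht => hz t fun h => by
        have := (mem_uIcc.1 ht)
        rcases this with h' | h' <;> linarith [h.1, h'.1, h'.2]
      show ∫ t in (0 : ℝ)..s, ρ t = 0
      rw [intervalIntegral.integral_congr this]
      simp
    · have : ∀ t ∈ uIoc s 1, ρ t = 0 := fun t ht => hz t fun h => by
        rcases mem_uIoc.1 ht with h' | h' <;> linarith [h.2, h'.1, h'.2]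
      have e := intervalIntegral.integral_add_adjacent_intervals (hρ.intervalIntegrable (μ := volume) 0 s)
        (hρ.intervalIntegrable (μ := volume) s 1)
      have e0 : ∫ t in s..1, ρ t = 0 := by
        refine intervalIntegral.integral_zero_ae (Eventually.of_forall this)
      rw [e0, add_zero, h4] at e
      exact e
  refine ⟨Θ, ?_, HasCompactSupport.of_support_subset_isCompact isCompact_Icc
    ((subset_tsupport _).trans hsub), hsub.trans fun t ht => ⟨ha.trans_le ht.1, ht.2.trans_lt hb⟩,
    hder⟩
  rw [contDiff_infty_iff_deriv, hder]
  exact ⟨fun s => (hd s).differentiableAt, h1⟩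

theorem exists_unit_test :
    ∃ ψ : ℝ → ℝ, ContDiff ℝ ∞ ψ ∧ HasCompactSupport ψ ∧ tsupport ψ ⊆ Ioo 0 1 ∧
      ∫ t in (0 : ℝ)..1, ψ t = 1 := by
  let B : ContDiffBump (1 / 2 : ℝ) := ⟨1 / 8, 1 / 4, by norm_num, by norm_num⟩
  have hs : tsupport (B.normed volume) ⊆ Ioo 0 1 := by
    rw [B.tsupport_normed_eq]
    intro t ht
    rw [Metric.mem_closedBall, Real.dist_eq, abs_le] at ht
    constructor <;> norm_num [B] at ht ⊢ <;> linarith [ht.1, ht.2]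
  refine ⟨B.normed volume, B.contDiff_normed, B.hasCompactSupport_normed, hs, ?_⟩
  rw [intervalIntegral.integral_of_le zero_le_one, setIntegral_eq_integral_of_forall_compl_eq_zero,
    B.integral_normed]
  intro t ht
  exact image_eq_zero_of_notMem_tsupport fun h => ht (Ioo_subset_Ioc_self (hs h))

theorem integrable_smul_test {w : ℝ → ℂ} (hw : IntegrableOn w (Ioo (0 : ℝ) 1)) {θ : ℝ → ℝ}
    (h1 : ContDiff ℝ ∞ θ) (h2 : HasCompactSupport θ) :
    IntegrableOn (fun s => θ s • w s) (Ioo (0 : ℝ) 1) := by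
  obtain ⟨C, hC⟩ := h1.continuous.bounded_above_of_compact_support h2
  exact hw.bdd_smul C h1.continuous.aestronglyMeasurable (Eventually.of_forall hC)

/-- The lemma of du Bois-Reymond. -/
theorem ae_const_of_weakDeriv_zero {w : ℝ → ℂ} (hw : IntegrableOn w (Ioo (0 : ℝ) 1))
    (h : ∀ θ : ℝ → ℝ, ContDiff ℝ ∞ θ → HasCompactSupport θ → tsupport θ ⊆ Ioo 0 1 →
      ∫ s in Ioo (0 : ℝ) 1, deriv θ s • w s = 0) :
    ∃ c : ℂ, w =ᵐ[volume.restrict (Ioo (0 : ℝ) 1)] fun _ => c := by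
  obtain ⟨ψ, p1, p2, p3, p4⟩ := exists_unit_test
  set c : ℂ := ∫ s in Ioo (0 : ℝ) 1, ψ s • w s with hc
  refine ⟨c, ?_⟩
  have key := isOpen_Ioo.ae_eq_zero_of_integral_contDiff_smul_eq_zero (U := Ioo (0 : ℝ) 1)
    (μ := volume) (f := fun s => w s - c)
    ((hw.sub (integrableOn_const (by simp))).locallyIntegrableOn) (by
      intro θ h1 h2 h3
      -- Subtracting `d` times the unit test function leaves mean zero, so the difference is the
      -- derivative of an admissible test function.
      set d : ℝ := ∫ t in (0 : ℝ)..1, θ t with hd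
      have r1 : ContDiff ℝ ∞ (θ - d • ψ) := h1.sub (p1.const_smul d)
      have r2 : HasCompactSupport (θ - d • ψ) := h2.sub (p2.smul_left (f := fun _ => d))
      have r3 : tsupport (θ - d • ψ) ⊆ Ioo 0 1 :=
        (tsupport_sub _ _).trans (union_subset h3 ((tsupport_smul_subset_right (fun _ => d) ψ).trans p3))
      have r4 : ∫ t in (0 : ℝ)..1, (θ - d • ψ) t = 0 := by
        simp only [Pi.sub_apply, Pi.smul_apply, smul_eq_mul]
        rw [intervalIntegral.integral_sub (h1.continuous.intervalIntegrable _ _)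
          ((p1.continuous.const_mul d).intervalIntegrable _ _),
          intervalIntegral.integral_const_mul, p4, ← hd]
        ring
      obtain ⟨Θ, t1, t2, t3, t4⟩ := exists_test_primitive r1 r2 r3 r4
      have e := h Θ t1 t2 t3
      rw [t4] at e
      simp only [Pi.sub_apply, Pi.smul_apply, smul_eq_mul, sub_smul, mul_smul] at e
      rw [integral_sub (integrable_smul_test hw h1 h2)
        (by exact (integrable_smul_test hw p1 p2).smul d), integral_smul, ← hc] at e
      have hz : ∀ s, s ∉ Ioo (0 : ℝ) 1 → θ s • (w s - c) = 0 := by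
        intro s hs
        rw [image_eq_zero_of_notMem_tsupport (fun h => hs (h3 h)), zero_smul]
      rw [← setIntegral_eq_integral_of_forall_compl_eq_zero hz]
      simp only [smul_sub]
      rw [integral_sub (integrable_smul_test hw h1 h2)
        (integrable_smul_test (integrableOn_const (by simp)) h1 h2)]
      have e2 : ∫ s in Ioo (0 : ℝ) 1, θ s • c = d • c := by
        rw [integral_smul_const, hd, intervalIntegral.integral_of_le zero_le_one,
          integral_Ioc_eq_integral_Ioo]
      rw [e2]
      exact e)
  refine (ae_restrict_iff' measurableSet_Ioo).2 ?_
  filter_upwards [key] with s hs hm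
  exact sub_eq_zero.1 (hs hm)

/-- A function with a weak derivative has a continuous representative, which is a primitive of the
weak derivative. -/
theorem HasWeakDeriv.exists_isPrim {u v : L2} (h : HasWeakDeriv u v) :
    ∃ U : ℝ → ℂ, u =ᵐ[volume.restrict (Ioo (0 : ℝ) 1)] U ∧ IsPrim U v := by
  have hP := isPrim_integral (intervalIntegrable_L2 v) 0
  set P : ℝ → ℂ := fun s => 0 + ∫ t in (0 : ℝ)..s, v t with hPdef
  have iu : IntegrableOn u (Ioo (0 : ℝ) 1) := (Lp.memLp u).integrable (by norm_num)
  have iP : IntegrableOn P (Ioo (0 : ℝ) 1) :=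
    (hP.continuousOn.integrableOn_compact isCompact_Icc).mono_set Ioo_subset_Icc_self
  obtain ⟨c, hc⟩ := ae_const_of_weakDeriv_zero (w := fun s => u s - P s) (iu.sub iP) (by
    intro θ h1 h2 h3
    have hd : ContDiff ℝ ∞ (deriv θ) := (contDiff_infty_iff_deriv.1 h1).2
    simp only [smul_sub]
    rw [integral_sub (integrable_smul_test iu hd h2.deriv) (integrable_smul_test iP hd h2.deriv),
      h θ h1 h2 h3, hP.integral_deriv_smul h1 h3, sub_self])
  refine ⟨fun s => c + ∫ t in (0 : ℝ)..s, v t, ?_, isPrim_integral (intervalIntegrable_L2 v) c⟩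
  filter_upwards [hc] with s hs
  rw [← hs, hPdef]
  ring

theorem pointVal_eq_of_ae {u : L2} {U : ℝ → ℂ} (hu : u =ᵐ[volume.restrict (Ioo (0 : ℝ) 1)] U)
    (hU : ContinuousOn U (Icc 0 1)) {a : ℝ} (ha : a ∈ Icc (0 : ℝ) 1) : pointVal u a = U a :=
  HasPointValue.pointVal_eq ha ⟨U, hU, hu, rfl⟩

theorem memLp_of_continuousOn {U : ℝ → ℂ} (hU : ContinuousOn U (Icc 0 1)) :
    MemLp U 2 (volume.restrict (Ioo (0 : ℝ) 1)) := by
  obtain ⟨C, hC⟩ := isCompact_Icc.exists_bound_of_continuousOn hU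
  refine MemLp.of_bound ((hU.mono Ioo_subset_Icc_self).aestronglyMeasurable measurableSet_Ioo) C ?_
  filter_upwards [ae_restrict_mem measurableSet_Ioo] with s hs
  exact hC s (Ioo_subset_Icc_self hs)

theorem memH_succ {m : ℕ} {u : L2} :
    MemH (m + 1) u ↔ HasWeakDeriv u (weakDeriv u) ∧ MemH m (weakDeriv u) := by
  constructor
  · rintro ⟨v, h, hm⟩
    rw [h.weakDeriv_eq]
    exact ⟨h, hm⟩
  · exact fun h => ⟨_, h⟩

theorem wd_succ (j : ℕ) (u : L2) : wd (j + 1) u = weakDeriv (wd j u) :=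
  Function.iterate_succ_apply' _ _ _

theorem MemH.hasWeakDeriv_wd {m : ℕ} {u : L2} (h : MemH m u) {j : ℕ} (hj : j < m) :
    HasWeakDeriv (wd j u) (wd (j + 1) u) := by
  induction m generalizing u j with
  | zero => omega
  | succ m ih =>
    obtain ⟨h1, h2⟩ := memH_succ.1 h
    cases j with
    | zero => exact h1
    | succ j => exact ih h2 (by omega)

theorem memH_of_chain {m : ℕ} {u : ℕ → L2} (h : ∀ j < m, HasWeakDeriv (u j) (u (j + 1))) :
    MemH m (u 0) ∧ ∀ j ≤ m, wd j (u 0) = u j := by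
  have hw : ∀ j ≤ m, wd j (u 0) = u j := by
    intro j
    induction j with
    | zero => exact fun _ => rfl
    | succ j ih => exact fun hj => by rw [wd_succ, ih (by omega), (h j (by omega)).weakDeriv_eq]
  refine ⟨?_, hw⟩
  clear hw
  induction m generalizing u with
  | zero => trivial
  | succ m ih => exact ⟨u 1, h 0 (by omega), ih (u := fun j => u (j + 1)) fun j hj => h (j + 1) (by omega)⟩

/-! ### Vertex and end conditions of the network -/

/-- All vertex and end conditions, acting on the initial jets on the three edges. -/
def vertexMap (p : Params) (lam : ℂ) : (Fin 3 → Fin 4 → ℂ) →ₗ[ℂ] (Fin 3 → Fin 4 → ℂ) where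
  toFun c k := ![∑ r, propag p lam 1 0 r * c k r, ∑ r, propag p lam 1 2 r * c k r,
    c k 2 - (p.α + lam * p.κ) * c k 1,
    -- The hub imposes one force balance and two continuity conditions. They share the fourth slot,
    -- the edge `0` carrying the balance, so that domain and codomain have the same dimension.
    if k = 0 then ∑ j, (c j 3 - (p.γ - p.η ^ 2) * c j 1 + lam * p.β * p.η * c j 0)
      else c k 0 - c 0 0]
  map_add' c d := by
    funext k i
    fin_cases i
    · simp [mul_add, Finset.sum_add_distrib]
    · simp [mul_add, Finset.sum_add_distrib]
    · simp; ring
    · by_cases hk : k = 0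
      · simp [hk, Fin.sum_univ_three]; ring
      · simp [hk]; ring
  map_smul' a c := by
    funext k i
    fin_cases i
    · simp [Finset.mul_sum, mul_left_comm]
    · simp [Finset.mul_sum, mul_left_comm]
    · simp; ring
    · by_cases hk : k = 0
      · simp [hk, Fin.sum_univ_three]; ring
      · simp [hk]; ring

theorem vertexMap_eq_iff {p : Params} {lam : ℂ} {c d : Fin 3 → Fin 4 → ℂ} :
    vertexMap p lam c = d ↔ (∀ k, ∑ r, propag p lam 1 0 r * c k r = d k 0) ∧
      (∀ k, ∑ r, propag p lam 1 2 r * c k r = d k 1) ∧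
      (∀ k, c k 2 - (p.α + lam * p.κ) * c k 1 = d k 2) ∧
      ∑ j, (c j 3 - (p.γ - p.η ^ 2) * c j 1 + lam * p.β * p.η * c j 0) = d 0 3 ∧
      c 1 0 - c 0 0 = d 1 3 ∧ c 2 0 - c 0 0 = d 2 3 := by
  constructor
  · intro h
    have e := fun k i => congrFun (congrFun h k) i
    simp only [vertexMap, LinearMap.coe_mk, AddHom.coe_mk] at e
    refine ⟨fun k => e k 0, fun k => e k 1, fun k => e k 2, ?_, ?_, ?_⟩
    · simpa using e 0 3
    · simpa using e 1 3
    · simpa using e 2 3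
  · rintro ⟨h0, h1, h2, h3, h4, h5⟩
    funext k i
    simp only [vertexMap, LinearMap.coe_mk, AddHom.coe_mk]
    fin_cases i
    · exact h0 k
    · exact h1 k
    · exact h2 k
    · fin_cases k
      · simpa using h3
      · simpa using h4
      · simpa using h5

theorem bcMat_mulVec_eq_zero_iff {p : Params} {lam : ℂ} {l c : Fin 4 → ℂ} :
    (bcMat p lam l).mulVec c = 0 ↔ ∑ r, propag p lam 1 0 r * c r = 0 ∧
      ∑ r, propag p lam 1 2 r * c r = 0 ∧ c 2 - (p.α + lam * p.κ) * c 1 = 0 ∧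
      ∑ r, l r * c r = 0 := by
  have e2 : ∑ r, (![0, -(p.α + lam * p.κ), 1, 0] : Fin 4 → ℂ) r * c r
      = c 2 - (p.α + lam * p.κ) * c 1 := by
    simp [Fin.sum_univ_four]; ring
  rw [← e2]
  constructor
  · intro h
    exact ⟨congrFun h 0, congrFun h 1, congrFun h 2, congrFun h 3⟩
  · rintro ⟨h0, h1, h2, h3⟩
    funext i
    fin_cases i
    exacts [h0, h1, h2, h3]

/-- The difference of two edges vanishes at the hub and solves the pinned problem, so all edges
agree; the force balance is then three times the force condition on a single edge. -/
theorem vertexMap_injective {p : Params} {lam : ℂ}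
    (h1 : (bcMat p lam (forceRow p lam)).det ≠ 0) (h2 : (bcMat p lam pinRow).det ≠ 0) :
    Function.Injective (vertexMap p lam) := by
  rw [injective_iff_map_eq_zero]
  intro c hc
  obtain ⟨e0, e1, e2, e3, e4, e5⟩ := vertexMap_eq_iff.1 hc
  simp only [Pi.zero_apply] at e0 e1 e2 e3 e4 e5
  have hpin : ∀ k, c k - c 0 = 0 := by
    intro k
    refine Matrix.eq_zero_of_mulVec_eq_zero h2 (bcMat_mulVec_eq_zero_iff.2 ⟨?_, ?_, ?_, ?_⟩)
    · simp [mul_sub, e0]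
    · simp [mul_sub, e1]
    · have a := e2 k
      have b := e2 0
      simp only [Pi.sub_apply]
      linear_combination a - b
    · have : c k 0 - c 0 0 = 0 := by
        fin_cases k
        exacts [sub_self _, e4, e5]
      simpa [pinRow, Fin.sum_univ_four] using this
  have hall : ∀ k, c k = c 0 := fun k => sub_eq_zero.1 (hpin k)
  have h0 : c 0 = 0 := by
    refine Matrix.eq_zero_of_mulVec_eq_zero h1
      (bcMat_mulVec_eq_zero_iff.2 ⟨e0 0, e1 0, e2 0, ?_⟩)
    simp only [Fin.sum_univ_three, hall 1, hall 2] at e3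
    simp [forceRow, Fin.sum_univ_four]
    linear_combination e3 / 3
  funext k
  rw [hall k, h0]
  rfl

/-- A mode of the force problem is placed identically on all edges. A pinned mode is placed with
opposite signs on two edges, so that its forces cancel at the hub. -/
theorem vertexMap_not_injective {p : Params} {lam : ℂ}
    (h : (bcMat p lam (forceRow p lam)).det = 0 ∨ (bcMat p lam pinRow).det = 0) :
    ∃ c, c ≠ 0 ∧ vertexMap p lam c = 0 := by
  rcases h with h | h
  · obtain ⟨c, hc, h0⟩ := exists_solution_of_det_eq_zero h
    obtain ⟨e0, e1, e2, e3⟩ := bcMat_mulVec_eq_zero_iff.1 h0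
    refine ⟨fun _ => c, fun h => hc (congrFun h 0), vertexMap_eq_iff.2
      ⟨fun _ => e0, fun _ => e1, fun _ => e2, ?_, by simp, by simp⟩⟩
    simp [forceRow, Fin.sum_univ_four] at e3
    simp
    linear_combination 3 * e3
  · obtain ⟨c, hc, h0⟩ := exists_solution_of_det_eq_zero h
    obtain ⟨e0, e1, e2, e3⟩ := bcMat_mulVec_eq_zero_iff.1 h0
    simp [pinRow, Fin.sum_univ_four] at e3
    refine ⟨![c, -c, 0], fun h => hc (congrFun h 0), vertexMap_eq_iff.2 ⟨?_, ?_, ?_, ?_, ?_, ?_⟩⟩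
    · intro k; fin_cases k <;> simp [e0]
    · intro k; fin_cases k <;> simp [e1]
    · intro k; fin_cases k
      · simpa using e2
      · simp; linear_combination -e2
      · simp
    · simp [Fin.sum_univ_three]; ring
    · simp [e3]
    · simp [e3]

/-! ### The inhomogeneous equation -/

/-- Duhamel's formula: the jet with initial value `c` of the solution with right-hand side `F`. -/
def duhamel (p : Params) (lam : ℂ) (c : Fin 4 → ℂ) (F : ℝ → ℂ) (i : Fin 4) (s : ℝ) : ℂ :=
  ∑ r, propag p lam s i r * (c r + ∫ t in (0 : ℝ)..s, propag p lam (-t) r 3 * F t)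

/-- The right-hand side of the first-order system. -/
def sysRhs (p : Params) (lam : ℂ) (F : ℝ → ℂ) (Y : Fin 4 → ℝ → ℂ) (i : Fin 4) (s : ℝ) : ℂ :=
  ∑ j, companion p lam i j * Y j s + if i = 3 then F s else 0

theorem isPrim_propag (p : Params) (lam : ℂ) (i r : Fin 4) :
    IsPrim (fun s => propag p lam s i r) (fun s => ∑ j, companion p lam i j * propag p lam s j r) :=
  isPrim_of_hasDerivAt (hasDerivAt_propag p lam i r)
    (continuous_finsetSum _ fun j _ => continuous_const.mul (continuous_propag p lam j r))

theorem isPrim_propag_neg (p : Params) (lam : ℂ) (i r : Fin 4) :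
    IsPrim (fun s => propag p lam (-s) i r)
      (fun s => -∑ j, propag p lam (-s) i j * companion p lam j r) :=
  isPrim_of_hasDerivAt (hasDerivAt_propag_neg p lam i r)
    (continuous_finsetSum _ fun j _ => (continuous_propag_neg p lam i j).mul continuous_const).neg

theorem intervalIntegrable_kernel (p : Params) (lam : ℂ) {F : ℝ → ℂ}
    (hF : IntervalIntegrable F volume 0 1) (r : Fin 4) :
    IntervalIntegrable (fun t => propag p lam (-t) r 3 * F t) volume 0 1 :=
  hF.continuousOn_mul (continuous_propag_neg p lam r 3).continuousOn

/-- Variation of constants: when the derivative falls on the integral, `exp(sA) exp(-sA) = 1` leaves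
`F` in the last component only. -/
theorem isPrim_duhamel (p : Params) (lam : ℂ) (c : Fin 4 → ℂ) {F : ℝ → ℂ}
    (hF : IntervalIntegrable F volume 0 1) (i : Fin 4) :
    IsPrim (duhamel p lam c F i) (sysRhs p lam F (duhamel p lam c F) i) := by
  have h := IsPrim.sum fun r => (isPrim_propag p lam i r).mul
    (isPrim_integral (intervalIntegrable_kernel p lam hF r) (c r))
  refine h.congr_right (Eventually.of_forall fun s => ?_)
  simp only
  rw [Finset.sum_add_distrib]
  unfold sysRhs duhamel
  congr 1
  · simp only [Finset.mul_sum, Finset.sum_mul]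
    rw [Finset.sum_comm]
    simp [mul_assoc]
  · have := congrFun (congrFun (propag_mul_propag_neg p lam s) i) 3
    rw [Matrix.mul_apply] at this
    simp only [← mul_assoc]
    rw [← Finset.sum_mul, this, Matrix.one_apply]
    split_ifs <;> simp

/-- The integrating factor `exp(-sA)` removes the homogeneous part of the system, and what remains
is integrated. -/
theorem eq_duhamel {p : Params} {lam : ℂ} {F : ℝ → ℂ} {Y : Fin 4 → ℝ → ℂ}
    (hY : ∀ i, IsPrim (Y i) (sysRhs p lam F Y i)) (i : Fin 4) {s : ℝ}
    (hs : s ∈ Icc (0 : ℝ) 1) : Y i s = duhamel p lam (fun r => Y r 0) F i s := by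
  have hW : ∀ i, IsPrim (fun s => ∑ r, propag p lam (-s) i r * Y r s)
      (fun s => propag p lam (-s) i 3 * F s) := by
    intro i
    have h := IsPrim.sum fun r => (isPrim_propag_neg p lam i r).mul (hY r)
    convert h using 1
    funext s
    rw [Finset.sum_add_distrib]
    simp only [sysRhs, mul_add, neg_mul, Finset.sum_neg_distrib, Finset.sum_mul, Finset.mul_sum,
      Finset.sum_add_distrib]
    rw [Finset.sum_comm (f := fun r j => propag p lam (-s) i j * companion p lam j r * Y r s)]
    simp [mul_assoc]
  have e : (propag p lam (-s)).mulVec (fun r => Y r s)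
      = fun i => Y i 0 + ∫ t in (0 : ℝ)..s, propag p lam (-t) i 3 * F t := by
    funext i
    have := (hW i).2 s hs
    simp only [neg_zero, propag_zero, Matrix.one_apply, ite_mul, one_mul, zero_mul,
      Finset.sum_ite_eq, Finset.mem_univ, if_true] at this
    exact this
  have e2 := congrArg (propag p lam s).mulVec e
  rw [Matrix.mulVec_mulVec, propag_mul_propag_neg, Matrix.one_mulVec] at e2
  exact congrFun e2 i

/-! ### Linear combinations in Sobolev spaces -/

theorem HasWeakDeriv.smul_sub {u v u' v' : L2} (h : HasWeakDeriv u v) (h' : HasWeakDeriv u' v')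
    (c : ℂ) : HasWeakDeriv (c • u - u') (c • v - v') := by
  obtain ⟨U, hU, hP⟩ := h.exists_isPrim
  obtain ⟨U', hU', hP'⟩ := h'.exists_isPrim
  refine hasWeakDeriv_of_isPrim (U := fun s => c * U s + (-1) * U' s) ?_
    (((hP.const_mul c).add (hP'.const_mul (-1))).congr_right ?_)
  · filter_upwards [Lp.coeFn_sub (c • u) u', Lp.coeFn_smul c u, hU, hU'] with s h1 h2 h3 h4
    rw [h1, Pi.sub_apply, h2, Pi.smul_apply, h3, h4, smul_eq_mul]; ring
  · filter_upwards [Lp.coeFn_sub (c • v) v', Lp.coeFn_smul c v] with s h1 h2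
    rw [h1, Pi.sub_apply, h2, Pi.smul_apply, smul_eq_mul]; ring

theorem HasWeakDeriv.pointVal_smul_sub {u v u' v' : L2} (h : HasWeakDeriv u v)
    (h' : HasWeakDeriv u' v') (c : ℂ) {a : ℝ} (ha : a ∈ Icc (0 : ℝ) 1) :
    pointVal (c • u - u') a = c * pointVal u a - pointVal u' a := by
  obtain ⟨U, hU, hP⟩ := h.exists_isPrim
  obtain ⟨U', hU', hP'⟩ := h'.exists_isPrim
  rw [pointVal_eq_of_ae hU hP.continuousOn ha, pointVal_eq_of_ae hU' hP'.continuousOn ha,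
    pointVal_eq_of_ae (U := fun s => c * U s - U' s) ?_
      ((continuousOn_const.mul hP.continuousOn).sub hP'.continuousOn) ha]
  filter_upwards [Lp.coeFn_sub (c • u) u', Lp.coeFn_smul c u, hU, hU'] with s h1 h2 h3 h4
  rw [h1, Pi.sub_apply, h2, Pi.smul_apply, h3, h4, smul_eq_mul]

theorem MemH.mono {m n : ℕ} (h : n ≤ m) {u : L2} (hu : MemH m u) : MemH n u := by
  induction n generalizing m u with
  | zero => trivial
  | succ n ih =>
    obtain ⟨m, rfl⟩ : ∃ k, m = k + 1 := ⟨m - 1, by omega⟩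
    obtain ⟨v, hv, hm⟩ := hu
    exact ⟨v, hv, ih (by omega) hm⟩

theorem MemH.smul_sub {u u' : L2} {m : ℕ} (h : MemH m u) (h' : MemH m u') (c : ℂ) :
    MemH m (c • u - u') ∧ ∀ j ≤ m, wd j (c • u - u') = c • wd j u - wd j u' :=
  memH_of_chain (u := fun j => c • wd j u - wd j u') fun _ hj =>
    (h.hasWeakDeriv_wd hj).smul_sub (h'.hasWeakDeriv_wd hj) c

theorem MemH.hasWeakDeriv {m : ℕ} {u : L2} (h : MemH (m + 1) u) : HasWeakDeriv u (wd 1 u) :=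
  h.hasWeakDeriv_wd (j := 0) (by omega)

theorem MemHStar.smul_sub {u u' : L2} {m : ℕ} (h : MemHStar (m + 1) u) (h' : MemHStar (m + 1) u')
    (c : ℂ) : MemHStar (m + 1) (c • u - u') := by
  refine ⟨(h.1.smul_sub h'.1 c).1, ?_⟩
  rw [(h.1.hasWeakDeriv).pointVal_smul_sub
    (h'.1.hasWeakDeriv) c (by simp)]
  rw [h.2, h'.2]; simp

/-! ### The resolvent equation as a linear system for initial jets -/

theorem opT_apply (p : Params) (x : Triple) (k : Fin 3) : opT p x k = ((x k).2,
    -wd 4 (x k).1 + ((p.γ - p.η ^ 2 : ℝ) : ℂ) • wd 2 (x k).1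
      + -((2 * p.β * p.η : ℝ) : ℂ) • wd 1 (x k).2) := by
  simp [opT, opA, opB]

theorem resolvent_eq_iff {p : Params} {lam : ℂ} {x y : Triple} :
    lam • x - opT p x = y ↔ ∀ k, (x k).2 = lam • (x k).1 - (y k).1 ∧
      lam • (x k).2 + wd 4 (x k).1 - ((p.γ - p.η ^ 2 : ℝ) : ℂ) • wd 2 (x k).1
        + ((2 * p.β * p.η : ℝ) : ℂ) • wd 1 (x k).2 = (y k).2 := by
  rw [funext_iff]
  refine forall_congr' fun k => ?_
  rw [Pi.sub_apply, Pi.smul_apply, opT_apply, Prod.ext_iff]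
  simp only [Prod.fst_sub, Prod.snd_sub, Prod.smul_fst, Prod.smul_snd]
  constructor
  · rintro ⟨h1, h2⟩
    refine ⟨by rw [← h1]; abel, ?_⟩
    rw [← h2]; simp only [neg_smul]; abel
  · rintro ⟨h1, h2⟩
    refine ⟨by rw [h1]; abel, ?_⟩
    rw [← h2]; simp only [neg_smul]; abel

theorem mapsTo_stateSpace {p : Params} {lam : ℂ} {x : Triple} (hx : x ∈ domT p) :
    lam • x - opT p x ∈ stateSpace := by
  obtain ⟨⟨h1, h2⟩, h3, h4, -⟩ := hx
  have e := resolvent_eq_iff.1 (rfl : lam • x - opT p x = lam • x - opT p x)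
  have e' : ∀ k, ((lam • x - opT p x) k).1 = lam • (x k).1 - (x k).2 := fun k => by
    rw [(e k).1]; abel
  have pv : ∀ k, pointVal (lam • (x k).1 - (x k).2) 0 = lam * pointVal (x k).1 0
      - pointVal (x k).2 0 := fun k =>
    ((h1 k).1.hasWeakDeriv).pointVal_smul_sub
      ((h3 k).2.1.hasWeakDeriv) lam (by simp)
  refine ⟨fun k => ?_, fun j k => ?_⟩
  · rw [e']
    exact (h1 k).smul_sub (h3 k).2 lam
  · rw [e', e', pv, pv, h2 j k, h4 j k]

/-- The forcing term of the reduced fourth-order equation. -/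
def forcing (p : Params) (lam : ℂ) (f g : L2) : L2 :=
  g + lam • f + ((2 * p.β * p.η : ℝ) : ℂ) • wd 1 f

/-- The data of the vertex and end conditions for the initial jets. -/
def vertexData (p : Params) (lam : ℂ) (y : Triple) (k : Fin 3) : Fin 4 → ℂ :=
  ![-duhamel p lam 0 (forcing p lam (y k).1 (y k).2) 0 1,
    -duhamel p lam 0 (forcing p lam (y k).1 (y k).2) 2 1,
    -- Substituting `v = λw - f` in the vertex conditions moves `-κ f'(0)` and, in the force
    -- balance, `βη f(0)` to the right-hand side.
    -p.κ * pointVal (wd 1 (y k).1) 0,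
    if k = 0 then ∑ j, p.β * p.η * pointVal (y j).1 0 else 0]

theorem duhamel_eq_add (p : Params) (lam : ℂ) (c : Fin 4 → ℂ) (F : ℝ → ℂ) (i : Fin 4) (s : ℝ) :
    duhamel p lam c F i s = ∑ r, propag p lam s i r * c r + duhamel p lam 0 F i s := by
  simp [duhamel, mul_add, Finset.sum_add_distrib]

theorem duhamel_zero (p : Params) (lam : ℂ) (c : Fin 4 → ℂ) (F : ℝ → ℂ) (i : Fin 4) :
    duhamel p lam c F i 0 = c i := by
  simp [duhamel, propag_zero, Matrix.one_apply]

theorem reduced_eq_iff {p : Params} {lam : ℂ} {w v f g : L2} (hw : MemH 2 w) (hf : MemH 2 f)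
    (hv : v = lam • w - f) :
    lam • v + wd 4 w - ((p.γ - p.η ^ 2 : ℝ) : ℂ) • wd 2 w + ((2 * p.β * p.η : ℝ) : ℂ) • wd 1 v = g ↔
      wd 4 w = (-lam ^ 2) • w + (-(2 * lam * p.β * p.η)) • wd 1 w + (p.γ - p.η ^ 2 : ℂ) • wd 2 w
        + forcing p lam f g := by
  rw [hv, (hw.smul_sub hf lam).2 1 (by omega), forcing, ← sub_eq_zero,
    ← sub_eq_zero (a := wd 4 w)]
  push_cast
  refine Eq.congr_left ?_ |>.trans Iff.rfl
  module

/-- The continuous representatives of the weak derivatives of `w_k` form a solution of the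
first-order system, so they are given by Duhamel's formula. Reading off the boundary values in that
formula converts membership in the domain into the linear system. -/
theorem initial_jet_of_resolvent_eq {p : Params} {lam : ℂ} {x y : Triple} (hy : y ∈ stateSpace)
    (hx : x ∈ domT p) (h : lam • x - opT p x = y) :
    ∃ c, vertexMap p lam c = vertexData p lam y ∧
      (∀ (k : Fin 3) (j : Fin 4), wd j (x k).1 =ᵐ[volume.restrict (Ioo (0 : ℝ) 1)]
        duhamel p lam (c k) (forcing p lam (y k).1 (y k).2) j) ∧
      ∀ k, pointVal (wd 1 (x k).1) 0 = c k 1 := by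
  rw [resolvent_eq_iff] at h
  obtain ⟨⟨h1, h2⟩, h3, h4, h5, h6, h7⟩ := hx
  have key : ∀ k, ∃ ck : Fin 4 → ℂ, (∀ (j : Fin 4), wd j (x k).1
      =ᵐ[volume.restrict (Ioo (0 : ℝ) 1)] duhamel p lam ck (forcing p lam (y k).1 (y k).2) j) := by
    intro k
    have hw := (h3 k).1
    have ex : ∀ j : Fin 4, ∃ U : ℝ → ℂ, wd j (x k).1 =ᵐ[volume.restrict (Ioo (0 : ℝ) 1)] U ∧
        IsPrim U (wd (j + 1) (x k).1) := fun j => (hw.hasWeakDeriv_wd j.2).exists_isPrim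
    choose U hU hP using ex
    have e4 := (reduced_eq_iff (hw.mono (by omega)) (hy.1 k).1 (h k).1).1 (h k).2
    have hsys : ∀ i, IsPrim (U i) (sysRhs p lam (forcing p lam (y k).1 (y k).2) U i) := by
      intro i
      refine (hP i).congr_right ?_
      fin_cases i
      · filter_upwards [hU 1] with s hs
        simp [sysRhs, companion, Fin.sum_univ_four]
        exact hs
      · filter_upwards [hU 2] with s hs
        simp [sysRhs, companion, Fin.sum_univ_four]
        exact hs
      · filter_upwards [hU 3] with s hs
        simp [sysRhs, companion, Fin.sum_univ_four]
        exact hs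
      · show wd 4 (x k).1 =ᵐ[_] _
        rw [e4]
        set F := forcing p lam (y k).1 (y k).2
        set w0 := (x k).1
        filter_upwards [hU 0, hU 1, hU 2,
          Lp.coeFn_add ((-lam ^ 2) • w0 + (-(2 * lam * p.β * p.η)) • wd 1 w0
            + (p.γ - p.η ^ 2 : ℂ) • wd 2 w0) F,
          Lp.coeFn_add ((-lam ^ 2) • w0 + (-(2 * lam * p.β * p.η)) • wd 1 w0)
            ((p.γ - p.η ^ 2 : ℂ) • wd 2 w0),
          Lp.coeFn_add ((-lam ^ 2) • w0) ((-(2 * lam * p.β * p.η)) • wd 1 w0),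
          Lp.coeFn_smul (-lam ^ 2) w0, Lp.coeFn_smul (-(2 * lam * p.β * p.η : ℂ)) (wd 1 w0),
          Lp.coeFn_smul (p.γ - p.η ^ 2 : ℂ) (wd 2 w0)] with s a0 a1 a2 b1 b2 b3 b4 b5 b6
        have a0 : w0 s = U 0 s := a0
        have a1 : wd 1 w0 s = U 1 s := a1
        have a2 : wd 2 w0 s = U 2 s := a2
        rw [b1, Pi.add_apply, b2, Pi.add_apply, b3, Pi.add_apply, b4, b5, b6, Pi.smul_apply,
          Pi.smul_apply, Pi.smul_apply, a0, a1, a2]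
        simp [sysRhs, companion, Fin.sum_univ_four]
    refine ⟨fun r => U r 0, fun j => (hU j).trans ?_⟩
    filter_upwards [ae_restrict_mem measurableSet_Ioo] with s hs
    exact eq_duhamel hsys j (Ioo_subset_Icc_self hs)
  choose c hc using key
  have pv : ∀ (k : Fin 3) (j : Fin 4) (a : ℝ), a ∈ Icc (0 : ℝ) 1 → pointVal (wd j (x k).1) a
      = duhamel p lam (c k) (forcing p lam (y k).1 (y k).2) j a := fun k j a ha =>
    pointVal_eq_of_ae (hc k j) (isPrim_duhamel p lam (c k) (intervalIntegrable_L2 _) j).continuousOn ha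
  have pv0 : ∀ (k : Fin 3) (j : Fin 4), pointVal (wd j (x k).1) 0 = c k j := fun k j => by
    rw [pv k j 0 (by simp), duhamel_zero]
  have pw : ∀ k, pointVal (x k).1 0 = c k 0 := fun k => pv0 k 0
  have pv1 : ∀ k, pointVal (wd 1 (x k).1) 0 = c k 1 := fun k => pv0 k 1
  have pv2 : ∀ k, pointVal (wd 2 (x k).1) 0 = c k 2 := fun k => pv0 k 2
  have pv3 : ∀ k, pointVal (wd 3 (x k).1) 0 = c k 3 := fun k => pv0 k 3
  have vv : ∀ k, pointVal (x k).2 0 = lam * c k 0 - pointVal (y k).1 0 := fun k => by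
    rw [(h k).1, ← pw k]
    exact ((h1 k).1.hasWeakDeriv).pointVal_smul_sub
      ((hy.1 k).1.hasWeakDeriv) lam (by simp)
  have vv1 : ∀ k, pointVal (wd 1 (x k).2) 0 = lam * c k 1 - pointVal (wd 1 (y k).1) 0 := fun k => by
    rw [(h k).1, ← pv1 k, ((h1 k).1.smul_sub (hy.1 k).1 lam).2 1 (by omega)]
    exact ((h1 k).1.hasWeakDeriv_wd (j := 1) (by omega)).pointVal_smul_sub
      ((hy.1 k).1.hasWeakDeriv_wd (j := 1) (by omega)) lam (by simp)
  refine ⟨c, vertexMap_eq_iff.2 ⟨fun k => ?_, fun k => ?_, fun k => ?_, ?_, ?_, ?_⟩, hc, pv1⟩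
  · have := (h1 k).2
    rw [show pointVal (x k).1 1 = _ from pv k 0 1 (by simp), duhamel_eq_add] at this
    simp only [vertexData, Matrix.cons_val]
    linear_combination this
  · have := h5 k
    rw [show pointVal (wd 2 (x k).1) 1 = _ from pv k 2 1 (by simp), duhamel_eq_add] at this
    simp only [vertexData, Matrix.cons_val]
    linear_combination this
  · have := h6 k
    rw [pv2, pv1, vv1] at this
    simp only [vertexData, Matrix.cons_val]
    linear_combination this
  · simp only [pv1, pv3, vv, Fin.sum_univ_three] at h7
    simp only [vertexData, Matrix.cons_val, Fin.sum_univ_three, if_true]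
    linear_combination h7
  · have := h2 1 0
    rw [pw, pw] at this
    simp [vertexData, this]
  · have := h2 2 0
    rw [pw, pw] at this
    simp [vertexData, this]

/-- Converse of the reduction: Duhamel's formula with a suitable jet is a chain of primitives, so it
defines an element of `H⁴`, and `v` is then defined by the first component of the equation. -/
theorem exists_resolvent_eq {p : Params} {lam : ℂ} {y : Triple} (hy : y ∈ stateSpace)
    {c : Fin 3 → Fin 4 → ℂ} (hc : vertexMap p lam c = vertexData p lam y) :
    ∃ x ∈ domT p, lam • x - opT p x = y ∧ ∀ k, (x k).1 =ᵐ[volume.restrict (Ioo (0 : ℝ) 1)]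
        duhamel p lam (c k) (forcing p lam (y k).1 (y k).2) 0 := by
  set F : Fin 3 → L2 := fun k => forcing p lam (y k).1 (y k).2 with hF
  have hP := fun k i => isPrim_duhamel p lam (c k) (intervalIntegrable_L2 (F k)) i
  have hM := fun k i => memLp_of_continuousOn (hP k i).continuousOn
  set W : Fin 3 → Fin 4 → L2 := fun k i => (hM k i).toLp with hW
  have hWae : ∀ k i, W k i =ᵐ[volume.restrict (Ioo (0 : ℝ) 1)] duhamel p lam (c k) (F k) i :=
    fun k i => (hM k i).coeFn_toLp
  set W4 : Fin 3 → L2 := fun k => (-lam ^ 2) • W k 0 + (-(2 * lam * p.β * p.η)) • W k 1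
    + (p.γ - p.η ^ 2 : ℂ) • W k 2 + F k with hW4
  have d0 : ∀ k, HasWeakDeriv (W k 0) (W k 1) := fun k => hasWeakDeriv_of_isPrim (hWae k 0)
    ((hP k 0).congr_right (by
      filter_upwards [hWae k 1] with s hs
      rw [hs]; simp [sysRhs, companion, Fin.sum_univ_four]))
  have d1 : ∀ k, HasWeakDeriv (W k 1) (W k 2) := fun k => hasWeakDeriv_of_isPrim (hWae k 1)
    ((hP k 1).congr_right (by
      filter_upwards [hWae k 2] with s hs
      rw [hs]; simp [sysRhs, companion, Fin.sum_univ_four]))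
  have d2 : ∀ k, HasWeakDeriv (W k 2) (W k 3) := fun k => hasWeakDeriv_of_isPrim (hWae k 2)
    ((hP k 2).congr_right (by
      filter_upwards [hWae k 3] with s hs
      rw [hs]; simp [sysRhs, companion, Fin.sum_univ_four]))
  have d3 : ∀ k, HasWeakDeriv (W k 3) (W4 k) := fun k => hasWeakDeriv_of_isPrim (hWae k 3)
    ((hP k 3).congr_right (by
      filter_upwards [hWae k 0, hWae k 1, hWae k 2,
        Lp.coeFn_add ((-lam ^ 2) • W k 0 + (-(2 * lam * p.β * p.η)) • W k 1
          + (p.γ - p.η ^ 2 : ℂ) • W k 2) (F k),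
        Lp.coeFn_add ((-lam ^ 2) • W k 0 + (-(2 * lam * p.β * p.η)) • W k 1)
          ((p.γ - p.η ^ 2 : ℂ) • W k 2),
        Lp.coeFn_add ((-lam ^ 2) • W k 0) ((-(2 * lam * p.β * p.η)) • W k 1),
        Lp.coeFn_smul (-lam ^ 2) (W k 0), Lp.coeFn_smul (-(2 * lam * p.β * p.η : ℂ)) (W k 1),
        Lp.coeFn_smul (p.γ - p.η ^ 2 : ℂ) (W k 2)] with s a0 a1 a2 b1 b2 b3 b4 b5 b6
      rw [b1, Pi.add_apply, b2, Pi.add_apply, b3, Pi.add_apply, b4, b5, b6, Pi.smul_apply,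
        Pi.smul_apply, Pi.smul_apply, a0, a1, a2]
      simp [sysRhs, companion, Fin.sum_univ_four]))
  have hch : ∀ k, MemH 4 (W k 0) ∧ ∀ j ≤ 4, wd j (W k 0)
      = ((fun j => match j with | 0 => W k 0 | 1 => W k 1 | 2 => W k 2 | 3 => W k 3 | _ => W4 k) :
        ℕ → L2) j := fun k =>
    memH_of_chain (u := fun j => match j with
      | 0 => W k 0 | 1 => W k 1 | 2 => W k 2 | 3 => W k 3 | _ => W4 k) fun j hj => by
        interval_cases j
        exacts [d0 k, d1 k, d2 k, d3 k]
  have w1 : ∀ k, wd 1 (W k 0) = W k 1 := fun k => (hch k).2 1 (by norm_num)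
  have w2 : ∀ k, wd 2 (W k 0) = W k 2 := fun k => (hch k).2 2 (by norm_num)
  have w3 : ∀ k, wd 3 (W k 0) = W k 3 := fun k => (hch k).2 3 (by norm_num)
  have w4 : ∀ k, wd 4 (W k 0) = W4 k := fun k => (hch k).2 4 (by norm_num)
  have pv : ∀ (k : Fin 3) (j : Fin 4) (a : ℝ), a ∈ Icc (0 : ℝ) 1 → pointVal (W k j) a
      = duhamel p lam (c k) (F k) j a := fun k j a ha =>
    pointVal_eq_of_ae (hWae k j) (hP k j).continuousOn ha
  have pv0 : ∀ (k : Fin 3) (j : Fin 4), pointVal (W k j) 0 = c k j := fun k j => by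
    rw [pv k j 0 (by simp), duhamel_zero]
  obtain ⟨e0, e1, e2, e3, e4, e5⟩ := vertexMap_eq_iff.1 hc
  have hc0 : ∀ k, c k 0 = c 0 0 := by
    simp [vertexData] at e4 e5
    intro k
    fin_cases k
    exacts [rfl, sub_eq_zero.1 e4, sub_eq_zero.1 e5]
  have hw2 : ∀ k, MemHStar 2 (W k 0) := fun k => by
    refine ⟨(hch k).1.mono (by norm_num), ?_⟩
    rw [pv k 0 1 (by simp), duhamel_eq_add, e0 k]
    simp [vertexData, hF]
  have vv : ∀ k, pointVal (lam • W k 0 - (y k).1) 0 = lam * c k 0 - pointVal (y k).1 0 := fun k => by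
    rw [(d0 k).pointVal_smul_sub ((hy.1 k).1.hasWeakDeriv) lam (by simp), pv0]
  have vv1 : ∀ k, pointVal (wd 1 (lam • W k 0 - (y k).1)) 0
      = lam * c k 1 - pointVal (wd 1 (y k).1) 0 := fun k => by
    rw [((hw2 k).1.smul_sub (hy.1 k).1 lam).2 1 (by omega), w1]
    rw [(d1 k).pointVal_smul_sub ((hy.1 k).1.hasWeakDeriv_wd (j := 1) (by omega)) lam (by simp), pv0]
  refine ⟨fun k => (W k 0, lam • W k 0 - (y k).1), ⟨⟨hw2, fun j k => ?_⟩, fun k => ⟨(hch k).1,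
    (hw2 k).smul_sub (hy.1 k) lam⟩, fun j k => ?_, fun k => ?_, fun k => ?_, ?_⟩, ?_, fun k => hWae k 0⟩
  · show pointVal (W j 0) 0 = pointVal (W k 0) 0
    rw [pv0, pv0, hc0 j, hc0 k]
  · show pointVal (lam • W j 0 - (y j).1) 0 = pointVal (lam • W k 0 - (y k).1) 0
    rw [vv, vv, hc0 j, hc0 k, hy.2 j k]
  · show pointVal (wd 2 (W k 0)) 1 = 0
    rw [w2, pv k 2 1 (by simp), duhamel_eq_add, e1 k]
    simp [vertexData, hF]
  · show pointVal (wd 2 (W k 0)) 0 - p.α * pointVal (wd 1 (W k 0)) 0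
      - p.κ * pointVal (wd 1 (lam • W k 0 - (y k).1)) 0 = 0
    rw [w2, w1, pv0, pv0, vv1]
    have := e2 k
    simp only [vertexData, Matrix.cons_val] at this
    linear_combination this
  · simp only [vertexData, Matrix.cons_val, Fin.sum_univ_three, if_true] at e3
    simp only [w1, w3, pv0, vv, Fin.sum_univ_three]
    linear_combination e3
  · rw [resolvent_eq_iff]
    refine fun k => ⟨rfl, ?_⟩
    refine (reduced_eq_iff (hw2 k).1 (hy.1 k).1 rfl).2 ?_
    rw [w4, w1, w2]

/-! ### Norm estimates -/

theorem volume_unit : (volume.restrict (Ioo (0 : ℝ) 1)) univ = 1 := by simp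

/-- The unit interval has measure one, so the `L¹` norm is at most the `L²` norm. -/
theorem integral_norm_le_norm (v : L2) : ∫ s in Ioo (0 : ℝ) 1, ‖v s‖ ≤ ‖v‖ := by
  have hp : IsProbabilityMeasure (volume.restrict (Ioo (0 : ℝ) 1)) := ⟨volume_unit⟩
  have hm := Lp.memLp v
  rw [integral_norm_eq_lintegral_enorm hm.1, ← eLpNorm_one_eq_lintegral_enorm, Lp.norm_def]
  exact ENNReal.toReal_mono hm.2.ne (eLpNorm_le_eLpNorm_of_exponent_le (by norm_num) hm.1)

theorem norm_le_of_ae_le {v : L2} {R : ℝ} (hR : 0 ≤ R)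
    (h : ∀ᵐ s ∂(volume.restrict (Ioo (0 : ℝ) 1)), ‖v s‖ ≤ R) : ‖v‖ ≤ R := by
  have := Lp.norm_le_of_ae_bound hR h
  simpa [measureUnivNNReal] using this

theorem norm_intervalIntegral_le {V : ℝ → ℂ} (hV : IntervalIntegrable V volume 0 1) {s t : ℝ}
    (hs : s ∈ Icc (0 : ℝ) 1) (ht : t ∈ Icc (0 : ℝ) 1) :
    ‖∫ x in s..t, V x‖ ≤ ∫ x in Ioo (0 : ℝ) 1, ‖V x‖ := by
  refine (intervalIntegral.norm_integral_le_integral_norm_uIoc).trans ?_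
  rw [← integral_Ioc_eq_integral_Ioo]
  refine setIntegral_mono_set hV.1.norm (Eventually.of_forall fun x => norm_nonneg _)
    (Eventually.of_forall ?_)
  exact Ioc_subset_Ioc (le_min hs.1 ht.1) (max_le hs.2 ht.2)

theorem IsPrim.norm_sub_le {U : ℝ → ℂ} {v : L2} (h : IsPrim U v) {s t : ℝ}
    (hs : s ∈ Icc (0 : ℝ) 1) (ht : t ∈ Icc (0 : ℝ) 1) : ‖U t - U s‖ ≤ ‖v‖ := by
  have i : ∀ {s : ℝ}, s ∈ Icc (0 : ℝ) 1 → IntervalIntegrable v volume 0 s :=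
    fun hs => h.1.mono_set (uIcc_subset_uIcc_left (by rwa [uIcc_of_le zero_le_one]))
  rw [h.2 s hs, h.2 t ht, add_sub_add_left_eq_sub,
    intervalIntegral.integral_interval_sub_left (i ht) (i hs)]
  exact (norm_intervalIntegral_le h.1 hs ht).trans (integral_norm_le_norm v)

theorem integral_mul_conj_self (u : L2) :
    ∫ s in Ioo (0 : ℝ) 1, u s * conj (u s) = ((‖u‖ ^ 2 : ℝ) : ℂ) := by
  have h := L2.inner_def (𝕜 := ℂ) u u
  rw [inner_self_eq_norm_sq_to_K] at h
  push_cast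
  refine Eq.trans ?_ h.symm
  rfl

theorem energyInner_self (p : Params) (x : Triple) :
    energyInner p x x = ((∑ k, (‖wd 2 (x k).1‖ ^ 2 + (p.γ - p.η ^ 2) * ‖wd 1 (x k).1‖ ^ 2
      + p.α * ‖pointVal (wd 1 (x k).1) 0‖ ^ 2) + ∑ k, ‖(x k).2‖ ^ 2 : ℝ) : ℂ) := by
  simp only [energyInner, integral_mul_conj_self]
  simp only [Complex.mul_conj, Complex.normSq_eq_norm_sq]
  push_cast
  rfl

theorem energyNorm_bounds {p : Params} (hp : p.Admissible) (x : Triple) (k : Fin 3) :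
    ‖wd 2 (x k).1‖ ≤ energyNorm p x ∧
      Real.sqrt (p.γ - p.η ^ 2) * ‖wd 1 (x k).1‖ ≤ energyNorm p x ∧ ‖(x k).2‖ ≤ energyNorm p x := by
  have hg : 0 < p.γ - p.η ^ 2 := sub_pos.2 hp.η_sq_lt
  have hα := hp.α_nonneg
  rw [energyNorm, energyInner_self, Complex.ofReal_re]
  have h1 : ‖wd 2 (x k).1‖ ^ 2 + (p.γ - p.η ^ 2) * ‖wd 1 (x k).1‖ ^ 2
      + p.α * ‖pointVal (wd 1 (x k).1) 0‖ ^ 2 ≤ ∑ k, (‖wd 2 (x k).1‖ ^ 2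
        + (p.γ - p.η ^ 2) * ‖wd 1 (x k).1‖ ^ 2 + p.α * ‖pointVal (wd 1 (x k).1) 0‖ ^ 2) :=
    Finset.single_le_sum (f := fun k => ‖wd 2 (x k).1‖ ^ 2
        + (p.γ - p.η ^ 2) * ‖wd 1 (x k).1‖ ^ 2 + p.α * ‖pointVal (wd 1 (x k).1) 0‖ ^ 2)
      (fun i _ => by positivity) (Finset.mem_univ k)
  have h2 : ‖(x k).2‖ ^ 2 ≤ ∑ k, ‖(x k).2‖ ^ 2 :=
    Finset.single_le_sum (f := fun k => ‖(x k).2‖ ^ 2) (fun i _ => by positivity) (Finset.mem_univ k)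
  have a1 : 0 ≤ ‖wd 2 (x k).1‖ ^ 2 := by positivity
  have a2 : 0 ≤ (p.γ - p.η ^ 2) * ‖wd 1 (x k).1‖ ^ 2 := by positivity
  have a3 : 0 ≤ p.α * ‖pointVal (wd 1 (x k).1) 0‖ ^ 2 := by positivity
  have a4 : 0 ≤ ‖(x k).2‖ ^ 2 := by positivity
  refine ⟨Real.le_sqrt_of_sq_le ?_, Real.le_sqrt_of_sq_le ?_, Real.le_sqrt_of_sq_le ?_⟩
  · linarith
  · rw [mul_pow, Real.sq_sqrt hg.le]; linarith
  · linarith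

/-- The constant counts three edges, each contributing `R²` with weights `1`, `γ - η²`, `α` and `1`.
-/
theorem energyNorm_le {p : Params} (hp : p.Admissible) {x : Triple} {R : ℝ} (hR : 0 ≤ R)
    (h : ∀ k, ‖wd 2 (x k).1‖ ≤ R ∧ ‖wd 1 (x k).1‖ ≤ R ∧ ‖pointVal (wd 1 (x k).1) 0‖ ≤ R ∧
      ‖(x k).2‖ ≤ R) :
    energyNorm p x ≤ Real.sqrt (3 * (2 + (p.γ - p.η ^ 2) + p.α)) * R := by
  have hg : 0 < p.γ - p.η ^ 2 := sub_pos.2 hp.η_sq_lt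
  have hα := hp.α_nonneg
  rw [energyNorm, energyInner_self, Complex.ofReal_re, ← Real.sqrt_sq hR,
    ← Real.sqrt_mul (by positivity)]
  refine Real.sqrt_le_sqrt ?_
  rw [← Finset.sum_add_distrib]
  have : ∀ k ∈ (Finset.univ : Finset (Fin 3)), ‖wd 2 (x k).1‖ ^ 2
      + (p.γ - p.η ^ 2) * ‖wd 1 (x k).1‖ ^ 2
      + p.α * ‖pointVal (wd 1 (x k).1) 0‖ ^ 2 + ‖(x k).2‖ ^ 2
      ≤ R ^ 2 + (p.γ - p.η ^ 2) * R ^ 2 + p.α * R ^ 2 + R ^ 2 := by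
    intro k _
    obtain ⟨h1, h2, h3, h4⟩ := h k
    gcongr
  refine (Finset.sum_le_sum this).trans (le_of_eq ?_)
  simp
  ring

/-- Poincaré estimates. Since `w(1) = 0`, the values of `w` are controlled by `w'`. For `w'`, which
has no boundary condition, `|w'(0)|` is compared with the mean of `|w'|` at the cost of `‖w''‖`. -/
theorem stateSpace_bounds {y : Triple} (hy : y ∈ stateSpace) (k : Fin 3) :
    ‖(y k).1‖ ≤ ‖wd 1 (y k).1‖ ∧ ‖pointVal (y k).1 0‖ ≤ ‖wd 1 (y k).1‖ ∧
      ‖pointVal (wd 1 (y k).1) 0‖ ≤ ‖wd 1 (y k).1‖ + ‖wd 2 (y k).1‖ := by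
  obtain ⟨hm, h1⟩ := hy.1 k
  obtain ⟨U, hU, hP⟩ := hm.hasWeakDeriv.exists_isPrim
  obtain ⟨V, hV, hQ⟩ := (hm.hasWeakDeriv_wd (j := 1) (by omega)).exists_isPrim
  have U1 : U 1 = 0 := by rw [← pointVal_eq_of_ae hU hP.continuousOn (by simp), h1]
  have bU : ∀ s ∈ Icc (0 : ℝ) 1, ‖U s‖ ≤ ‖wd 1 (y k).1‖ := fun s hs => by
    have := hP.norm_sub_le (s := 1) (t := s) (by simp) hs
    rwa [U1, sub_zero] at this
  refine ⟨norm_le_of_ae_le (norm_nonneg _) ?_, ?_, ?_⟩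
  · filter_upwards [hU, ae_restrict_mem measurableSet_Ioo] with s hs hm
    rw [hs]
    exact bU s (Ioo_subset_Icc_self hm)
  · rw [pointVal_eq_of_ae hU hP.continuousOn (by simp)]
    exact bU 0 (by simp)
  · rw [pointVal_eq_of_ae hV hQ.continuousOn (by simp)]
    have hi : Integrable (fun s => ‖wd 1 (y k).1 s‖) (volume.restrict (Ioo (0 : ℝ) 1)) :=
      ((Lp.memLp (wd 1 (y k).1)).integrable (by norm_num)).norm
    have hle : ∫ s in Ioo (0 : ℝ) 1, (‖V 0‖ - ‖wd 2 (y k).1‖)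
        ≤ ∫ s in Ioo (0 : ℝ) 1, ‖wd 1 (y k).1 s‖ := by
      refine integral_mono_ae (integrable_const _) hi ?_
      filter_upwards [hV, ae_restrict_mem measurableSet_Ioo] with s hs hm
      have := hQ.norm_sub_le (t := 0) (s := s) (Ioo_subset_Icc_self hm) (by simp)
      have h2 := norm_sub_norm_le (V 0) (V s)
      simp only [hs]
      linarith
    rw [integral_const, measureReal_def, volume_unit] at hle
    simp only [ENNReal.toReal_one, one_smul] at hle
    have := integral_norm_le_norm (wd 1 (y k).1)
    linarith

/-- The strict inequality `γ > η²` makes the energy norm control `w'`, and through `w(1) = 0`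
everything else in the data. -/
theorem exists_data_bound {p : Params} (hp : p.Admissible) (lam : ℂ) :
    ∃ C : ℝ, 0 ≤ C ∧ ∀ y ∈ stateSpace, ∀ k, ‖forcing p lam (y k).1 (y k).2‖ ≤ C * energyNorm p y ∧
      ‖(y k).1‖ ≤ C * energyNorm p y ∧ ‖pointVal (wd 1 (y k).1) 0‖ ≤ C * energyNorm p y ∧
      ‖pointVal (y k).1 0‖ ≤ C * energyNorm p y := by
  have hg : 0 < p.γ - p.η ^ 2 := sub_pos.2 hp.η_sq_lt
  set D : ℝ := (Real.sqrt (p.γ - p.η ^ 2))⁻¹ with hD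
  set B : ℝ := ‖((2 * p.β * p.η : ℝ) : ℂ)‖ with hB
  have hD0 : 0 ≤ D := by positivity
  refine ⟨1 + ‖lam‖ * D + B * D + D, by positivity, fun y hy k => ?_⟩
  obtain ⟨a1, a2, a3⟩ := energyNorm_bounds hp y k
  obtain ⟨b1, b2, b3⟩ := stateSpace_bounds hy k
  have hN : 0 ≤ energyNorm p y := Real.sqrt_nonneg _
  set N := energyNorm p y
  have a2' : ‖wd 1 (y k).1‖ ≤ D * N := by
    rw [hD, ← div_eq_inv_mul, le_div_iff₀ (Real.sqrt_pos.2 hg), mul_comm]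
    exact a2
  have q1 : 0 ≤ ‖lam‖ * D * N := by positivity
  have q2 : 0 ≤ B * D * N := by positivity
  have q3 : 0 ≤ D * N := by positivity
  have e : (1 + ‖lam‖ * D + B * D + D) * N = N + ‖lam‖ * D * N + B * D * N + D * N := by ring
  rw [e]
  refine ⟨?_, by linarith, by linarith, by linarith⟩
  calc ‖forcing p lam (y k).1 (y k).2‖
      ≤ ‖(y k).2‖ + ‖lam • (y k).1‖ + ‖((2 * p.β * p.η : ℝ) : ℂ) • wd 1 (y k).1‖ :=
        norm_add₃_le
    _ ≤ N + ‖lam‖ * (D * N) + B * (D * N) := by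
        rw [norm_smul, norm_smul]
        gcongr
        exact b1.trans a2'
    _ ≤ _ := by linarith

theorem exists_duhamel_bound (p : Params) (lam : ℂ) :
    ∃ C : ℝ, 0 ≤ C ∧ ∀ (F : L2) (c : Fin 4 → ℂ) (R : ℝ), 0 ≤ R → ‖F‖ ≤ R → (∀ r, ‖c r‖ ≤ R) →
      ∀ i, ∀ s ∈ Icc (0 : ℝ) 1, ‖duhamel p lam c F i s‖ ≤ C * R := by
  -- Duhamel's formula involves both `exp(sA)` and `exp(-tA)`, hence the interval `[-1, 1]`.
  have hb : ∀ i r, ∃ P : ℝ, ∀ s ∈ Icc (-1 : ℝ) 1, ‖propag p lam s i r‖ ≤ P := fun i r =>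
    isCompact_Icc.exists_bound_of_continuousOn (continuous_propag p lam i r).continuousOn
  choose Q hQ using hb
  set P : ℝ := ∑ i, ∑ r, Q i r with hP
  have hQ0 : ∀ i r, 0 ≤ Q i r := fun i r =>
    (norm_nonneg _).trans (hQ i r 0 (by simp))
  have hPb : ∀ i r, ∀ s ∈ Icc (-1 : ℝ) 1, ‖propag p lam s i r‖ ≤ P := fun i r s hs =>
    (hQ i r s hs).trans ((Finset.single_le_sum (f := fun r => Q i r) (fun r _ => hQ0 i r)
      (Finset.mem_univ r)).trans (Finset.single_le_sum (f := fun i => ∑ r, Q i r)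
        (fun i _ => Finset.sum_nonneg fun r _ => hQ0 i r) (Finset.mem_univ i)))
  have hP0 : 0 ≤ P := Finset.sum_nonneg fun i _ => Finset.sum_nonneg fun r _ => hQ0 i r
  refine ⟨4 * (P * (1 + P)), by positivity, fun F c R hR hF hc i s hs => ?_⟩
  have hint : ∀ r, ‖∫ t in (0 : ℝ)..s, propag p lam (-t) r 3 * F t‖ ≤ P * R := by
    intro r
    refine (norm_intervalIntegral_le (intervalIntegrable_kernel p lam (intervalIntegrable_L2 F) r)
      (by simp) hs).trans ?_
    have hi : Integrable (fun s => ‖F s‖) (volume.restrict (Ioo (0 : ℝ) 1)) :=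
      ((Lp.memLp F).integrable (by norm_num)).norm
    calc ∫ t in Ioo (0 : ℝ) 1, ‖propag p lam (-t) r 3 * F t‖
        ≤ ∫ t in Ioo (0 : ℝ) 1, P * ‖F t‖ := by
          refine integral_mono_ae (intervalIntegrable_iff_Ioo.1 (intervalIntegrable_kernel p lam
            (intervalIntegrable_L2 F) r)).norm (hi.const_mul P) ?_
          filter_upwards [ae_restrict_mem measurableSet_Ioo] with t ht
          rw [norm_mul]
          exact mul_le_mul_of_nonneg_right (hPb r 3 (-t) ⟨by linarith [ht.2], by linarith [ht.1]⟩)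
            (norm_nonneg _)
      _ = P * ∫ t in Ioo (0 : ℝ) 1, ‖F t‖ := integral_const_mul _ _
      _ ≤ P * R := by gcongr; exact (integral_norm_le_norm F).trans hF
  calc ‖duhamel p lam c F i s‖ ≤ ∑ r : Fin 4, P * (R + P * R) := by
        refine norm_sum_le_of_le _ fun r _ => ?_
        rw [norm_mul]
        gcongr
        · exact hPb i r s ⟨by linarith [hs.1], hs.2⟩
        · exact (norm_add_le _ _).trans (add_le_add (hc r) (hint r))
    _ = 4 * (P * (1 + P)) * R := by simp; ring

/-! ### The spectrum and the boundary matrices -/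

theorem resolvent_bound {p : Params} (hp : p.Admissible) {lam : ℂ}
    (hinj : Function.Injective (vertexMap p lam)) :
    ∃ C : ℝ, ∀ x ∈ domT p, energyNorm p x ≤ C * energyNorm p (lam • x - opT p x) := by
  obtain ⟨C1, hC1, h1⟩ := exists_data_bound hp lam
  obtain ⟨C2, hC2, h2⟩ := exists_duhamel_bound p lam
  -- An injective linear map between finite-dimensional spaces is bounded below; this controls the
  -- initial jets by the data.
  obtain ⟨K, -, hK⟩ := (vertexMap p lam).exists_antilipschitzWith
    (LinearMap.ker_eq_bot.2 hinj)
  set b : ℝ := ‖(p.β * p.η : ℂ)‖ with hb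
  set C3 : ℝ := C2 * C1 + ‖(p.κ : ℂ)‖ * C1 + 3 * (b * C1) with hC3
  have hC30 : 0 ≤ C3 := by positivity
  set C4 : ℝ := C1 + K * C3 with hC4
  have hC40 : 0 ≤ C4 := by positivity
  set C5 : ℝ := C2 * C4 + C4 + (‖lam‖ * (C2 * C4) + C1) with hC5
  have hC50 : 0 ≤ C5 := by positivity
  refine ⟨Real.sqrt (3 * (2 + (p.γ - p.η ^ 2) + p.α)) * C5, fun x hx => ?_⟩
  set y := lam • x - opT p x with hy
  have hys : y ∈ stateSpace := mapsTo_stateSpace hx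
  set N := energyNorm p y with hN
  have hN0 : 0 ≤ N := Real.sqrt_nonneg _
  obtain ⟨c, hc, hcY, hc1⟩ := initial_jet_of_resolvent_eq hys hx hy.symm
  have hdata : ‖vertexData p lam y‖ ≤ C3 * N := by
    refine (pi_norm_le_iff_of_nonneg (by positivity)).2 fun k =>
      (pi_norm_le_iff_of_nonneg (by positivity)).2 fun i => ?_
    obtain ⟨f1, f2, f3, f4⟩ := h1 y hys k
    have d := h2 _ 0 (C1 * N) (by positivity) f1 (fun r => by simp; positivity)
    have q1 : 0 ≤ C2 * C1 * N := by positivity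
    have q2 : 0 ≤ ‖(p.κ : ℂ)‖ * C1 * N := by positivity
    have q3 : 0 ≤ 3 * (b * C1) * N := by positivity
    have e : C3 * N = C2 * C1 * N + ‖(p.κ : ℂ)‖ * C1 * N + 3 * (b * C1) * N := by rw [hC3]; ring
    rw [e]
    fin_cases i
    · have := d 0 1 (by simp)
      simp only [vertexData, Fin.zero_eta, Matrix.cons_val_zero, norm_neg]
      linarith
    · have := d 2 1 (by simp)
      simp only [vertexData, Fin.mk_one, Matrix.cons_val_one, Matrix.cons_val_zero, norm_neg]
      linarith
    · have : ‖(p.κ : ℂ)‖ * ‖pointVal (wd 1 (y k).1) 0‖ ≤ ‖(p.κ : ℂ)‖ * (C1 * N) := by gcongr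
      simp only [vertexData, Fin.reduceFinMk, Matrix.cons_val, norm_mul, norm_neg]
      linarith
    · simp only [vertexData, Fin.reduceFinMk, Matrix.cons_val]
      split_ifs
      · have : ‖∑ j, (p.β * p.η * pointVal (y j).1 0 : ℂ)‖ ≤ ∑ _j : Fin 3, b * (C1 * N) := by
          refine norm_sum_le_of_le _ fun j _ => ?_
          rw [norm_mul]
          gcongr
          exact (h1 y hys j).2.2.2
        simp only [Finset.sum_const, Finset.card_univ, Fintype.card_fin, nsmul_eq_mul,
          Nat.cast_ofNat] at this
        linarith
      · rw [norm_zero]; linarith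
  have hcn : ‖c‖ ≤ K * (C3 * N) := by
    have := hK.le_mul_dist c 0
    rw [map_zero, dist_zero_right, dist_zero_right, hc] at this
    exact this.trans (by gcongr)
  have hcr : ∀ k r, ‖c k r‖ ≤ C4 * N := fun k r => by
    refine ((norm_le_pi_norm (c k) r).trans (norm_le_pi_norm c k)).trans (hcn.trans ?_)
    rw [hC4]
    nlinarith [mul_nonneg hC1 hN0]
  have hYb : ∀ (k : Fin 3) (j : Fin 4), ‖wd j (x k).1‖ ≤ C2 * (C4 * N) := by
    intro k j
    refine norm_le_of_ae_le (by positivity) ?_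
    filter_upwards [hcY k j, ae_restrict_mem measurableSet_Ioo] with s hs hm
    rw [hs]
    refine h2 _ (c k) (C4 * N) (by positivity) ((h1 y hys k).1.trans ?_) (hcr k) j s
      (Ioo_subset_Icc_self hm)
    rw [hC4]
    have : 0 ≤ K * C3 * N := by positivity
    linarith
  have t1 : 0 ≤ C2 * C4 * N := by positivity
  have t2 : 0 ≤ C4 * N := by positivity
  have t3 : 0 ≤ ‖lam‖ * (C2 * C4) * N := by positivity
  have t4 : 0 ≤ C1 * N := by positivity
  have e5 : C5 * N = C2 * C4 * N + C4 * N + (‖lam‖ * (C2 * C4) * N + C1 * N) := by rw [hC5]; ring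
  rw [mul_assoc]
  refine energyNorm_le hp (by positivity) fun k => ⟨?_, ?_, ?_, ?_⟩
  · have : ‖wd 2 (x k).1‖ ≤ C2 * (C4 * N) := hYb k 2
    linarith
  · have : ‖wd 1 (x k).1‖ ≤ C2 * (C4 * N) := hYb k 1
    linarith
  · rw [hc1]
    have := hcr k 1
    linarith
  · rw [((resolvent_eq_iff.1 hy.symm) k).1]
    have h0 : ‖(x k).1‖ ≤ C2 * (C4 * N) := hYb k 0
    have hf := (h1 y hys k).2.1
    have : ‖lam • (x k).1 - (y k).1‖ ≤ ‖lam‖ * (C2 * (C4 * N)) + C1 * N := by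
      refine (norm_sub_le _ _).trans (add_le_add ?_ hf)
      rw [norm_smul]
      gcongr
    linarith

/-- Injectivity of a linear endomorphism in finite dimension gives surjectivity, hence existence.
Uniqueness holds because the initial jets determine the state. -/
theorem mem_resolventT {p : Params} (hp : p.Admissible) {lam : ℂ}
    (hinj : Function.Injective (vertexMap p lam)) : lam ∈ resolventT p := by
  refine ⟨fun y hy => ?_, resolvent_bound hp hinj⟩
  obtain ⟨c, hc⟩ := (LinearMap.injective_iff_surjective.1 hinj) (vertexData p lam y)
  obtain ⟨x, hx, hxy, -⟩ := exists_resolvent_eq hy hc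
  refine ⟨x, ⟨hx, hxy⟩, fun x' ⟨hx', hxy'⟩ => ?_⟩
  obtain ⟨d, hd, hdY, -⟩ := initial_jet_of_resolvent_eq hy hx hxy
  obtain ⟨d', hd', hdY', -⟩ := initial_jet_of_resolvent_eq hy hx' hxy'
  have hdd : d' = d := hinj (hd'.trans hd.symm)
  subst hdd
  funext k
  have hw : (x' k).1 = (x k).1 := Lp.ext ((hdY' k 0).trans (hdY k 0).symm)
  refine Prod.ext hw ?_
  rw [((resolvent_eq_iff.1 hxy') k).1, ((resolvent_eq_iff.1 hxy) k).1, hw]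

/-! ### The zero triple, eigenvectors and the spectrum -/

theorem hasWeakDeriv_zero : HasWeakDeriv 0 0 := by
  have h := hasWeakDeriv_of_isPrim (u := 0) (v := 0) (U := fun _ => 0) (Lp.coeFn_zero _ _ _)
    ((isPrim_of_hasDerivAt (V := fun _ => 0) (fun s => hasDerivAt_const s (0 : ℂ))
      continuous_const).congr_right (Lp.coeFn_zero _ _ _).symm)
  exact h

theorem memH_zero (m : ℕ) : MemH m 0 ∧ ∀ j, wd j (0 : L2) = 0 := by
  have h := fun m => memH_of_chain (m := m) (u := fun _ => (0 : L2)) fun _ _ => hasWeakDeriv_zero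
  exact ⟨(h m).1, fun j => (h j).2 j le_rfl⟩

theorem pointVal_zero {a : ℝ} (ha : a ∈ Icc (0 : ℝ) 1) : pointVal 0 a = 0 :=
  pointVal_eq_of_ae (U := fun _ => 0) (Lp.coeFn_zero _ _ _) continuousOn_const ha

theorem zero_mem_stateSpace : (0 : Triple) ∈ stateSpace :=
  ⟨fun _ => ⟨(memH_zero 2).1, pointVal_zero (by simp)⟩, fun _ _ => rfl⟩

theorem zero_mem_domT (p : Params) : (0 : Triple) ∈ domT p := by
  have w := (memH_zero 0).2
  have z0 := pointVal_zero (a := 0) (by simp)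
  have z1 := pointVal_zero (a := 1) (by simp)
  refine ⟨zero_mem_stateSpace, fun _ => ⟨(memH_zero 4).1, (memH_zero 2).1, z1⟩, fun _ _ => rfl,
    fun k => ?_, fun k => ?_, ?_⟩
  · simp [w, z1]
  · simp [w, z0]
  · simp [w, z0]

theorem opT_zero (p : Params) : opT p 0 = 0 := by
  have w := (memH_zero 0).2
  funext k
  rw [opT_apply]
  simp [w]

/-- The existence result for the resolvent equation is applied with zero right-hand side. A nonzero
jet on some edge makes the resulting state nonzero, because a solution that vanishes on the interval
vanishes altogether. -/
theorem isEigenvalueT_of_vertexMap {p : Params} {lam : ℂ} {c : Fin 3 → Fin 4 → ℂ} (hc : c ≠ 0)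
    (h : vertexMap p lam c = 0) : IsEigenvalueT p lam := by
  have w := (memH_zero 0).2
  have hF : forcing p lam 0 0 = 0 := by simp [forcing, w]
  -- The representative of the zero class of `L2` is zero only almost everywhere, so the integral
  -- has to be rewritten up to null sets.
  have hz : ∀ (d : Fin 4 → ℂ) (i : Fin 4), ∀ s ∈ Icc (0 : ℝ) 1,
      duhamel p lam d (0 : L2) i s = ∑ r, propag p lam s i r * d r := by
    intro d i s hs
    unfold duhamel
    refine Finset.sum_congr rfl fun r _ => ?_
    rw [intervalIntegral_congr_Ioo (V' := fun _ => 0) ?_ hs]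
    · simp
    · filter_upwards [Lp.coeFn_zero ℂ 2 (volume.restrict (Ioo (0 : ℝ) 1))] with t ht
      rw [ht]; simp
  have hdata : vertexData p lam 0 = 0 := by
    funext k i
    have z0 := pointVal_zero (a := 0) (by simp)
    have e : ∀ i, duhamel p lam 0 (0 : L2) i 1 = 0 := fun i => by rw [hz 0 i 1 (by simp)]; simp
    fin_cases i
    · show -duhamel p lam 0 (forcing p lam 0 0) 0 1 = 0
      rw [hF, e, neg_zero]
    · show -duhamel p lam 0 (forcing p lam 0 0) 2 1 = 0
      rw [hF, e, neg_zero]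
    · simp [vertexData, w, z0]
    · simp [vertexData, z0]
  obtain ⟨x, hx, hxy, hxY⟩ := exists_resolvent_eq zero_mem_stateSpace (h.trans hdata.symm)
  refine ⟨x, hx, fun h0 => ?_, (sub_eq_zero.1 hxy).symm⟩
  refine hc (funext fun k => ?_)
  by_contra hk
  refine solOf_ne_zero (p := p) (lam := lam) hk ((solOf_spec p lam (c k)).1.eq_zero_of_eqOn ?_)
  have hae : (fun _ : ℝ => (0 : ℂ)) =ᵐ[volume.restrict (Ioo (0 : ℝ) 1)] solOf p lam (c k) := by
    have := hxY k
    rw [h0] at this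
    filter_upwards [this, Lp.coeFn_zero ℂ 2 (volume.restrict (Ioo (0 : ℝ) 1)),
      ae_restrict_mem measurableSet_Ioo] with s h1 h2 h3
    have h1 : (0 : L2) s = _ := h1
    rw [h2] at h1
    simp only [Pi.zero_apply, Prod.fst_zero, Prod.snd_zero, hF] at h1
    rw [hz _ _ s (Ioo_subset_Icc_self h3)] at h1
    exact h1
  have := Measure.eqOn_open_of_ae_eq hae isOpen_Ioo continuousOn_const
    (solOf_spec p lam (c k)).1.1.continuous.continuousOn
  exact fun s hs => (this hs).symm

theorem IsEigenvalueT.mem_spectrumT {p : Params} {lam : ℂ} (h : IsEigenvalueT p lam) :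
    lam ∈ spectrumT p := by
  obtain ⟨x, hx, hx0, hxe⟩ := h
  intro hr
  obtain ⟨z, -, hz⟩ := hr.1 0 zero_mem_stateSpace
  have h1 := hz x ⟨hx, by rw [hxe, sub_self]⟩
  have h2 := hz 0 ⟨zero_mem_domT p, by rw [opT_zero]; simp⟩
  exact hx0 (h1.trans h2.symm)

theorem det_eq_zero_of_mem_spectrumT {p : Params} (hp : p.Admissible) {lam : ℂ}
    (h : lam ∈ spectrumT p) :
    (bcMat p lam (forceRow p lam)).det = 0 ∨ (bcMat p lam pinRow).det = 0 := by
  by_contra hn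
  rw [not_or] at hn
  exact h (mem_resolventT hp (vertexMap_injective hn.1 hn.2))

theorem isEigenvalueT_of_det {p : Params} {lam : ℂ}
    (h : (bcMat p lam (forceRow p lam)).det = 0 ∨ (bcMat p lam pinRow).det = 0) :
    IsEigenvalueT p lam := by
  obtain ⟨c, hc, h0⟩ := vertexMap_not_injective h
  exact isEigenvalueT_of_vertexMap hc h0

/-! ### The characteristic functions are entire and real -/

attribute [local instance] Matrix.linftyOpNormedRing Matrix.linftyOpNormedAlgebra in
-- The matrix exponential is analytic and the companion matrix is polynomial in `lam`.
theorem differentiable_propag (p : Params) (i r : Fin 4) :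
    Differentiable ℂ fun lam => propag p lam 1 i r := by
  have hc : Differentiable ℂ fun lam => (1 : ℝ) • companion p lam := by
    simp only [one_smul]
    refine differentiable_pi.2 fun i => differentiable_pi.2 fun j => ?_
    fin_cases i <;> fin_cases j <;> (simp [companion]; try fun_prop)
  have he : Differentiable ℂ fun lam => propag p lam 1 := fun lam =>
    (NormedSpace.exp_analytic (𝕂 := ℂ) ((1 : ℝ) • companion p lam)).differentiableAt.comp lam (hc lam)
  exact fun lam => differentiableAt_pi.1 (differentiableAt_pi.1 (he lam) i) r

theorem differentiable_det_bcMat (p : Params) {l : ℂ → Fin 4 → ℂ}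
    (hl : ∀ i, Differentiable ℂ fun lam => l lam i) :
    Differentiable ℂ fun lam => (bcMat p lam (l lam)).det := by
  have h0 := differentiable_propag p 0
  have h2 := differentiable_propag p 2
  have he : ∀ i j, Differentiable ℂ fun lam => bcMat p lam (l lam) i j := by
    intro i j
    fin_cases i
    · exact h0 j
    · exact h2 j
    · fin_cases j <;> (simp [bcMat]; try fun_prop)
    · exact hl j
  simp only [Matrix.det_apply]
  refine Differentiable.fun_sum fun σ _ => ?_
  refine Differentiable.const_smul ?_ _
  exact Differentiable.fun_finsetProd fun i _ => he _ _

theorem differentiable_forceRow (p : Params) (i : Fin 4) :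
    Differentiable ℂ fun lam => forceRow p lam i := by
  fin_cases i <;> (simp [forceRow]; try fun_prop)

/-- Infinitely many zeros in a compact disc would accumulate, and the identity theorem would give `f
= 0`. -/
theorem finite_zeros {f : ℂ → ℂ} (hf : Differentiable ℂ f) (h0 : f 0 ≠ 0) (R : ℝ) :
    ({z | f z = 0} ∩ Metric.closedBall 0 R).Finite := by
  by_contra hinf
  obtain ⟨z, -, hz⟩ := Set.Infinite.exists_accPt_of_subset_isCompact hinf
    (isCompact_closedBall (0 : ℂ) R) inter_subset_right
  have hfr : ∃ᶠ w in 𝓝[≠] z, f w = 0 :=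
    (accPt_iff_frequently_nhdsNE.1 hz).mono fun w hw => hw.1
  have := AnalyticOnNhd.eqOn_zero_of_preconnected_of_frequently_eq_zero
    (hf.differentiableOn.analyticOnNhd isOpen_univ) isPreconnected_univ (mem_univ z) hfr
  exact h0 (this (mem_univ 0))

/-- The coefficients are real polynomials in `lam`. Entrywise conjugation is the transpose of the
conjugate transpose, and both operations pass through the exponential. -/
theorem propag_conj (p : Params) (lam : ℂ) (s : ℝ) :
    propag p (conj lam) s = (propag p lam s).map (starRingEnd ℂ) := by
  have h : s • companion p (conj lam) = ((s • companion p lam).conjTranspose).transpose := by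
    ext i j
    fin_cases i <;> fin_cases j <;> simp [companion]
  unfold propag
  rw [h, Matrix.exp_transpose, Matrix.exp_conjTranspose]
  rfl

theorem det_bcMat_conj {p : Params} {lam : ℂ} {l l' : Fin 4 → ℂ} (h : ∀ i, l' i = conj (l i)) :
    (bcMat p (conj lam) l').det = conj (bcMat p lam l).det := by
  rw [RingHom.map_det]
  congr 1
  ext i j
  fin_cases i
  · simp [bcMat, propag_conj]
  · simp [bcMat, propag_conj]
  · fin_cases j <;> simp [bcMat]
  · simp [bcMat, h]

theorem forceRow_conj (p : Params) (lam : ℂ) (i : Fin 4) :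
    forceRow p (conj lam) i = conj (forceRow p lam i) := by
  fin_cases i <;> simp [forceRow]

theorem pinRow_conj (i : Fin 4) : pinRow i = conj (pinRow i) := by
  fin_cases i <;> simp [pinRow]

/-! ### Solving the asymptotic characteristic equation -/

/-- A neighbourhood of infinity in a sector containing the image of the second quadrant under the
substitution `λ = i μ²`. -/
def sectorAt (M : ℝ) : Set ℂ := {μ | M < μ.re ∧ -2 < μ.im ∧ μ.im < 2 * μ.re}

theorem isOpen_sectorAt (M : ℝ) : IsOpen (sectorAt M) :=
  (isOpen_lt continuous_const Complex.continuous_re).inter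
    ((isOpen_lt continuous_const Complex.continuous_im).inter
      (isOpen_lt Complex.continuous_im (continuous_const.mul Complex.continuous_re)))

theorem sectorAt_mono {M M' : ℝ} (h : M ≤ M') : sectorAt M' ⊆ sectorAt M :=
  fun _ hμ => ⟨h.trans_lt hμ.1, hμ.2⟩

/-- Passing to the logarithm in the characteristic equation. -/
theorem exists_log_branch {M C : ℝ} {h : ℂ} {H : ℂ → ℂ} (hH : DifferentiableOn ℂ H (sectorAt M))
    (hb : ∀ μ ∈ sectorAt M, ‖H μ - 1 - h / μ‖ ≤ C / ‖μ‖ ^ 2) :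
    ∃ (M' C' : ℝ) (L : ℂ → ℂ), M ≤ M' ∧ 1 ≤ M' ∧ 0 ≤ C' ∧ DifferentiableOn ℂ L (sectorAt M') ∧
      ∀ μ ∈ sectorAt M', Complex.exp (L μ) = H μ ∧ ‖L μ‖ ≤ 1 / 4 ∧ ‖L μ - h / μ‖ ≤ C' / ‖μ‖ ^ 2 := by
  set A : ℝ := ‖h‖ + |C| with hA
  have hA0 : 0 ≤ A := by positivity
  -- This makes `A / ‖μ‖ ≤ 1/8`, so `H` stays near `1`, the principal logarithm is analytic, and its
  -- norm is at most `1/4`.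
  set M' : ℝ := |M| + 8 * A + 4 with hM'
  have hMM : M ≤ M' := by have := le_abs_self M; linarith
  have hMA : 8 * A + 4 ≤ M' := by have := abs_nonneg M; linarith
  have est : ∀ μ ∈ sectorAt M', 8 * A + 4 ≤ ‖μ‖ ∧ ‖H μ - 1‖ ≤ A / ‖μ‖ := by
    intro μ hμ
    have h1 : 8 * A + 4 ≤ ‖μ‖ := hMA.trans (hμ.1.le.trans (Complex.re_le_norm μ))
    have hpos : 0 < ‖μ‖ := by linarith
    refine ⟨h1, ?_⟩
    calc ‖H μ - 1‖ = ‖(H μ - 1 - h / μ) + h / μ‖ := by ring_nf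
      _ ≤ C / ‖μ‖ ^ 2 + ‖h‖ / ‖μ‖ := (norm_add_le _ _).trans
          (add_le_add (hb μ (sectorAt_mono hMM hμ)) (norm_div _ _).le)
      _ ≤ |C| / ‖μ‖ + ‖h‖ / ‖μ‖ := by
          gcongr
          · exact le_abs_self C
          · nlinarith
      _ = A / ‖μ‖ := by rw [hA]; ring
  have half : ∀ μ ∈ sectorAt M', ‖H μ - 1‖ ≤ 1 / 8 := by
    intro μ hμ
    obtain ⟨h1, h2⟩ := est μ hμ
    refine h2.trans ?_
    rw [div_le_iff₀ (by linarith)]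
    linarith
  refine ⟨M', |C| + A ^ 2, fun μ => Complex.log (H μ), hMM, by linarith, by positivity, ?_, ?_⟩
  · refine (hH.mono (sectorAt_mono hMM)).clog fun μ hμ => ?_
    have := Complex.mem_slitPlane_of_norm_lt_one (z := H μ - 1) (by linarith [half μ hμ])
    rwa [add_sub_cancel] at this
  · intro μ hμ
    obtain ⟨h1, h2⟩ := est μ hμ
    have h3 := half μ hμ
    have hpos : 0 < ‖μ‖ := by linarith
    have hne : H μ ≠ 0 := by
      intro h0
      rw [h0] at h3
      norm_num at h3
    have l1 := Complex.norm_log_one_add_half_le_self (z := H μ - 1) (by linarith)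
    have l2 := Complex.norm_log_one_add_sub_self_le (z := H μ - 1) (by linarith)
    rw [add_sub_cancel] at l1 l2
    refine ⟨Complex.exp_log hne, by linarith, ?_⟩
    have l3 : ‖Complex.log (H μ) - (H μ - 1)‖ ≤ ‖H μ - 1‖ ^ 2 := by
      refine l2.trans ?_
      have : (1 - ‖H μ - 1‖)⁻¹ ≤ 2 := by
        rw [inv_le_comm₀ (by linarith) (by norm_num)]
        linarith
      nlinarith [sq_nonneg ‖H μ - 1‖]
    calc ‖Complex.log (H μ) - h / μ‖
        = ‖(Complex.log (H μ) - (H μ - 1)) + (H μ - 1 - h / μ)‖ := by ring_nf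
      _ ≤ ‖H μ - 1‖ ^ 2 + C / ‖μ‖ ^ 2 := (norm_add_le _ _).trans
          (add_le_add l3 (hb μ (sectorAt_mono hMM hμ)))
      _ ≤ (A / ‖μ‖) ^ 2 + |C| / ‖μ‖ ^ 2 := by
          gcongr
          exact le_abs_self C
      _ = (|C| + A ^ 2) / ‖μ‖ ^ 2 := by rw [div_pow]; ring

section FixedPoint

variable {M : ℝ} {L : ℂ → ℂ}

theorem closedBall_subset_sectorAt {t r : ℝ} (hM : 1 ≤ M) (hr2 : r < 2)
    (ht : M + r < t) :
    Metric.closedBall (t : ℂ) r ⊆ sectorAt M := by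
  intro μ hμ
  rw [mem_closedBall_iff_norm] at hμ
  have h1 := (Complex.abs_re_le_norm _).trans hμ
  have h2 := (Complex.abs_im_le_norm _).trans hμ
  simp only [Complex.sub_re, Complex.ofReal_re, Complex.sub_im, Complex.ofReal_im, sub_zero] at h1 h2
  rw [abs_le] at h1 h2
  refine ⟨by linarith, by linarith, by linarith⟩

/-- Cauchy's estimate on discs of radius `1/2` bounds the derivative by `(1/4) / (1/2) = 1/2`; these
discs stay within distance `3/2` of `t`, hence in the sector. -/
theorem lipschitz_of_bounded (hM : 1 ≤ M) (hL : DifferentiableOn ℂ L (sectorAt M))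
    (hb : ∀ μ ∈ sectorAt M, ‖L μ‖ ≤ 1 / 4) {t : ℝ} (ht : M + 3 / 2 < t) {μ ν : ℂ}
    (hμ : μ ∈ Metric.closedBall (t : ℂ) 1) (hν : ν ∈ Metric.closedBall (t : ℂ) 1) :
    ‖L μ - L ν‖ ≤ 1 / 2 * ‖μ - ν‖ := by
  have hsub : Metric.closedBall (t : ℂ) (3 / 2) ⊆ sectorAt M :=
    closedBall_subset_sectorAt hM (by norm_num) (by linarith)
  have hin : ∀ z ∈ Metric.closedBall (t : ℂ) 1, Metric.closedBall z (1 / 2) ⊆ sectorAt M := by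
    intro z hz
    refine (Metric.closedBall_subset_closedBall' ?_).trans hsub
    rw [Metric.mem_closedBall] at hz
    linarith
  refine (convex_closedBall (t : ℂ) 1).norm_image_sub_le_of_norm_deriv_le (𝕜 := ℂ) (fun z hz => ?_)
    (fun z hz => ?_) hν hμ
  · exact hL.differentiableAt ((isOpen_sectorAt M).mem_nhds (hin z hz (by simp)))
  · have := Complex.norm_deriv_le_of_forall_mem_sphere_norm_le (c := z) (R := 1 / 2) (C := 1 / 4)
      (by norm_num) ((hL.mono (hin z hz)).diffContOnCl_ball Subset.rfl)
      (fun w hw => hb w (hin z hz (Metric.sphere_subset_closedBall hw)))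
    linarith

/-- Division by `2i` leaves a map that stays within `1/8` of `t` and halves the Lipschitz constant
of `L`, so Banach's theorem applies on the unit disc about `t`. -/
theorem exists_fixed_point (hM : 1 ≤ M) (hL : DifferentiableOn ℂ L (sectorAt M))
    (hb : ∀ μ ∈ sectorAt M, ‖L μ‖ ≤ 1 / 4) {t : ℝ} (ht : M + 3 / 2 < t) :
    ∃ μ ∈ Metric.closedBall (t : ℂ) 1, μ = t + L μ / (2 * Complex.I) := by
  set T : ℂ → ℂ := fun μ => t + L μ / (2 * Complex.I) with hT
  have hsub : Metric.closedBall (t : ℂ) 1 ⊆ sectorAt M :=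
    closedBall_subset_sectorAt hM (by norm_num) (by linarith)
  have hmaps : MapsTo T (Metric.closedBall (t : ℂ) 1) (Metric.closedBall (t : ℂ) 1) := by
    intro μ hμ
    have := hb μ (hsub hμ)
    rw [mem_closedBall_iff_norm]
    simp only [hT, add_sub_cancel_left, norm_div, norm_mul, Complex.norm_ofNat, Complex.norm_I]
    linarith
  have hcon : ContractingWith (1 / 2) (hmaps.restrict T _ _) := by
    refine ⟨by rw [← NNReal.coe_lt_coe]; norm_num, LipschitzWith.of_dist_le_mul fun μ ν => ?_⟩
    have := lipschitz_of_bounded hM hL hb ht μ.2 ν.2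
    rw [Subtype.dist_eq, Subtype.dist_eq, dist_eq_norm, dist_eq_norm]
    simp only [MapsTo.val_restrict_apply, hT, add_sub_add_left_eq_sub, ← sub_div, norm_div, norm_mul,
      Complex.norm_ofNat, Complex.norm_I]
    have h0 := norm_nonneg ((μ : ℂ) - ν)
    push_cast
    linarith
  obtain ⟨μ, hμ, hfix, -⟩ := hcon.exists_fixedPoint' Metric.isClosed_closedBall.isComplete hmaps
    (x := (t : ℂ)) (by simp) (edist_ne_top _ _)
  exact ⟨μ, hμ, hfix.symm⟩

theorem fixed_point_unique (hM : 1 ≤ M) (hL : DifferentiableOn ℂ L (sectorAt M))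
    (hb : ∀ μ ∈ sectorAt M, ‖L μ‖ ≤ 1 / 4) {t : ℝ} (ht : M + 3 / 2 < t) {μ ν : ℂ}
    (hμ : μ ∈ Metric.closedBall (t : ℂ) 1) (hν : ν ∈ Metric.closedBall (t : ℂ) 1)
    (eμ : μ = t + L μ / (2 * Complex.I)) (eν : ν = t + L ν / (2 * Complex.I)) : μ = ν := by
  have h1 := lipschitz_of_bounded hM hL hb ht hμ hν
  have h2 : ‖μ - ν‖ = ‖L μ - L ν‖ / 2 := by
    conv_lhs => rw [eμ, eν]
    rw [add_sub_add_left_eq_sub, ← sub_div, norm_div]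
    simp
  have h3 : ‖μ - ν‖ ≤ 0 := by linarith [norm_nonneg (μ - ν)]
  exact sub_eq_zero.1 (norm_le_zero_iff.1 h3)

end FixedPoint

/-- The spectral parameter of a zero in the open upper part of the second quadrant. -/
theorem exists_sqrt_sector {lam : ℂ} (hre : lam.re < 0) (him : 0 ≤ lam.im) {R : ℝ} (hR : 0 ≤ R)
    (hlam : 2 * R ^ 2 < ‖lam‖) :
    ∃ μ ∈ sectorAt R, Complex.I * μ ^ 2 = lam := by
  obtain ⟨μ, hμ⟩ : ∃ μ : ℂ, μ ^ 2 = -Complex.I * lam :=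
    IsAlgClosed.exists_pow_nat_eq _ (by norm_num)
  -- Of the two square roots the one with nonnegative real part is taken. The real part of `μ²` is
  -- `Im λ ≥ 0` and its imaginary part is `-Re λ > 0`, whence `0 < Im μ ≤ Re μ` and `‖λ‖ ≤ 2 (Re
  -- μ)²`.
  wlog hpos : 0 ≤ μ.re generalizing μ with H
  · exact H (-μ) (by rw [neg_sq, hμ]) (by simp only [Complex.neg_re]; linarith [not_le.1 hpos])
  have e1 := congrArg Complex.re hμ
  have e2 := congrArg Complex.im hμ
  simp [pow_two] at e1 e2
  have hI : Complex.I * μ ^ 2 = lam := by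
    rw [hμ, ← mul_assoc, mul_neg, Complex.I_mul_I]; simp
  have hrepos : 0 < μ.re := by
    rcases hpos.eq_or_lt with h | h
    · rw [← h] at e2; linarith
    · exact h
  have himpos : 0 < μ.im := by
    by_contra hn
    nlinarith [mul_nonneg hrepos.le (neg_nonneg.2 (not_lt.1 hn))]
  have hle : μ.im ≤ μ.re := by
    by_contra hn
    nlinarith
  refine ⟨μ, ⟨?_, by linarith, by linarith⟩, hI⟩
  have hn : ‖lam‖ = μ.re ^ 2 + μ.im ^ 2 := by
    rw [← hI, norm_mul, Complex.norm_I, one_mul, norm_pow, Complex.sq_norm, Complex.normSq_apply]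
    ring
  by_contra hn'
  rw [not_lt] at hn'
  nlinarith

/-- Zeros of a function of `λ = i μ²` that are governed by `exp (2 i μ) = exp (2 i δ π) H(μ)` with
`H(μ) = 1 + (a + i om) / μ + O(μ⁻²)`. -/
theorem hasBranchAsymptotics_of_sector (p : Params) {Z : Set ℂ} {a δ : ℝ}
    (hconj : ∀ lam ∈ Z, conj lam ∈ Z) (hfin : ∀ R : ℝ, (Z ∩ Metric.closedBall 0 R).Finite)
    (hneg : ∀ lam ∈ Z, lam.re < 0) {M C : ℝ} {H : ℂ → ℂ} (hH : DifferentiableOn ℂ H (sectorAt M))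
    (hb : ∀ μ ∈ sectorAt M, ‖H μ - 1
      - (a + Complex.I * ((p.β ^ 2 * p.η ^ 2 / 2 + p.γ - p.η ^ 2) / 2 : ℝ)) / μ‖ ≤ C / ‖μ‖ ^ 2)
    (hZ : ∀ μ ∈ sectorAt M, Complex.I * μ ^ 2 ∈ Z ↔
      Complex.exp (2 * Complex.I * μ) = Complex.exp (2 * Complex.I * (δ * Real.pi)) * H μ) :
    HasBranchAsymptotics p Z a δ := by
  set om : ℝ := (p.β ^ 2 * p.η ^ 2 / 2 + p.γ - p.η ^ 2) / 2 with hom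
  set h : ℂ := a + Complex.I * om with hh
  obtain ⟨M', C', L, hMM, hM1, hC', hL, hLp⟩ := exists_log_branch hH hb
  have hLb : ∀ μ ∈ sectorAt M', ‖L μ‖ ≤ 1 / 4 := fun μ hμ => (hLp μ hμ).2.1
  set τ : ℤ → ℝ := fun n => (n + δ) * Real.pi with hτ
  have hτinj : Function.Injective τ := fun m n hmn => by
    have := mul_right_cancel₀ Real.pi_ne_zero hmn
    exact_mod_cast add_right_cancel this
  have hτmono : Monotone τ := fun m n hmn => by
    have : (m : ℝ) ≤ n := by exact_mod_cast hmn
    simp only [hτ]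
    have := Real.pi_pos
    gcongr
  -- Comparing exponents modulo `2πi` turns membership in `Z` into a fixed-point equation labelled
  -- by an integer `n`.
  have hfix : ∀ μ ∈ sectorAt M', Complex.I * μ ^ 2 ∈ Z ↔
      ∃ n : ℤ, μ = τ n + L μ / (2 * Complex.I) := by
    intro μ hμ
    rw [hZ μ (sectorAt_mono hMM hμ), ← (hLp μ hμ).1, ← Complex.exp_add,
      Complex.exp_eq_exp_iff_exists_int]
    refine exists_congr fun n => ?_
    have hI : (2 * Complex.I : ℂ) ≠ 0 := by simp
    simp only [hτ]
    push_cast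
    constructor
    · intro e
      refine mul_left_cancel₀ hI ?_
      rw [e, mul_add (2 * Complex.I) _ (L μ / _), mul_div_cancel₀ _ hI]
      ring
    · intro e
      have : 2 * Complex.I * μ = 2 * Complex.I * ((n + δ) * Real.pi + L μ / (2 * Complex.I)) :=
        congrArg (fun z => 2 * Complex.I * z) e
      rw [this, mul_add (2 * Complex.I) _ (L μ / _), mul_div_cancel₀ _ hI]
      ring
  obtain ⟨n₀, hn₀pos, hn₀⟩ : ∃ n₀ : ℕ, 0 < n₀ ∧ M' + 2 < τ n₀ := by
    obtain ⟨n, hn⟩ := exists_nat_gt ((M' + 2) / Real.pi - δ)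
    refine ⟨n + 1, Nat.succ_pos n, ?_⟩
    have := Real.pi_pos
    simp only [hτ]
    push_cast
    have h1 : (M' + 2) / Real.pi < n + δ := by linarith
    rw [div_lt_iff₀ this] at h1
    nlinarith
  have hτge : ∀ m : ℕ, n₀ ≤ m → M' + 2 < τ m := fun m hm =>
    hn₀.trans_le (hτmono (by exact_mod_cast hm))
  have hex : ∀ m : ℕ, ∃ μ : ℂ, n₀ ≤ m → μ ∈ Metric.closedBall (τ m : ℂ) 1 ∧
      μ = τ m + L μ / (2 * Complex.I) := by
    intro m
    by_cases hm : n₀ ≤ m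
    · obtain ⟨μ, h1, h2⟩ := exists_fixed_point hM1 hL hLb (t := τ m) (by linarith [hτge m hm])
      exact ⟨μ, fun _ => ⟨h1, h2⟩⟩
    · exact ⟨0, fun h => absurd h hm⟩
  choose μ hμ using hex
  have hsec : ∀ m : ℕ, n₀ ≤ m → μ m ∈ sectorAt M' := fun m hm =>
    closedBall_subset_sectorAt (r := 1) hM1 (by norm_num) (by linarith [hτge m hm]) (hμ m hm).1
  have hbox : ∀ m : ℕ, n₀ ≤ m → τ m - 1 ≤ (μ m).re ∧ |(μ m).im| ≤ 1 := fun m hm => by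
    have h0 := (hμ m hm).1
    rw [mem_closedBall_iff_norm] at h0
    have h1 := (Complex.abs_re_le_norm _).trans h0
    have h2 := (Complex.abs_im_le_norm _).trans h0
    simp only [Complex.sub_re, Complex.ofReal_re, Complex.sub_im, Complex.ofReal_im, sub_zero]
      at h1 h2
    exact ⟨by linarith [(abs_le.1 h1).1], h2⟩
  set Λ : ℕ → ℂ := fun m => Complex.I * μ m ^ 2 with hΛ
  have hΛim : ∀ m, n₀ ≤ m → τ m - 2 < (Λ m).im := fun m hm => by
    obtain ⟨h1, h2⟩ := hbox m hm
    have h3 := hτge m hm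
    have h4 : (μ m).im ^ 2 ≤ 1 := by rw [← sq_abs]; nlinarith [abs_nonneg (μ m).im]
    have : (Λ m).im = (μ m).re ^ 2 - (μ m).im ^ 2 := by simp [hΛ, pow_two]
    rw [this]
    nlinarith
  have hΛpos : ∀ m, n₀ ≤ m → 0 < (Λ m).im := fun m hm => by
    linarith [hΛim m hm, hτge m hm]
  have hΛZ : ∀ m, n₀ ≤ m → Λ m ∈ Z := fun m hm =>
    (hfix _ (hsec m hm)).2 ⟨m, (hμ m hm).2⟩
  have hΛinj : ∀ m n, n₀ ≤ m → n₀ ≤ n → Λ m = Λ n → m = n := by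
    intro m n hm hn hmn
    have hsq : μ m ^ 2 = μ n ^ 2 := mul_left_cancel₀ Complex.I_ne_zero hmn
    have heq : μ m = μ n := by
      rcases sq_eq_sq_iff_eq_or_eq_neg.1 hsq with h' | h'
      · exact h'
      · have h1 := (hbox m hm).1
        have h2 := (hbox n hn).1
        rw [h', Complex.neg_re] at h1
        linarith [hτge m hm, hτge n hn]
    have e1 := (hμ m hm).2
    have e2 := (hμ n hn).2
    rw [← heq] at e2
    have : (τ m : ℂ) = τ n := add_right_cancel (e1.symm.trans e2)
    exact_mod_cast hτinj (by exact_mod_cast this : τ m = τ n)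
  -- The value `0` for small `|n|` is irrelevant to the branch, but being real it keeps the
  -- conjugation symmetry valid for every integer.
  set lam : ℤ → ℂ := fun n => if n.natAbs < n₀ then 0 else if 0 < n then Λ n.natAbs
    else conj (Λ n.natAbs) with hlam
  have hlp : ∀ m : ℕ, n₀ ≤ m → lam m = Λ m := fun m hm => by
    have h1 : (0 : ℤ) < m := by omega
    simp [hlam, not_lt.2 hm]
    intro h; omega
  have hln : ∀ m : ℕ, n₀ ≤ m → lam (-m) = conj (Λ m) := fun m hm => by
    simp [hlam, not_lt.2 hm]
  have hcases : ∀ n : ℤ, (n₀ : ℤ) ≤ |n| → ∃ m : ℕ, n₀ ≤ m ∧ ((n = m ∧ lam n = Λ m) ∨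
      (n = -m ∧ lam n = conj (Λ m))) := by
    intro n hn
    rw [Int.abs_eq_natAbs] at hn
    refine ⟨n.natAbs, by omega, ?_⟩
    rcases le_total 0 n with h' | h'
    · left
      have e : n = n.natAbs := by omega
      exact ⟨e, by conv_lhs => rw [e]
                   exact hlp _ (by omega)⟩
    · right
      have e : n = -n.natAbs := by omega
      exact ⟨e, by conv_lhs => rw [e]
                   exact hln _ (by omega)⟩
  have hmem : ∀ m : ℕ, n₀ ≤ m → Λ m ∈ lam '' {n | (n₀ : ℤ) ≤ |n|} ∧
      conj (Λ m) ∈ lam '' {n | (n₀ : ℤ) ≤ |n|} := fun m hm =>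
    ⟨⟨m, by simpa using hm, hlp m hm⟩, ⟨-m, by simpa using hm, hln m hm⟩⟩
  have hasym : ∀ m : ℕ, n₀ ≤ m → ‖Λ m - (a + Complex.I * freq p (τ m))‖
      ≤ (2 * ‖h‖ + 4 * C' + (2 * ‖h‖ + 4 * C')) * (τ m)⁻¹ := by
    intro m hm
    set t := τ m with ht
    set z := μ m with hz
    set w := L z with hw
    have hts := hτge m hm
    have ht3 : 3 < t := by linarith
    have hzt : t / 2 ≤ ‖z‖ := by
      have := (hbox m hm).1.trans (Complex.re_le_norm _)
      linarith
    have hz0 : z ≠ 0 := by rw [← norm_pos_iff]; linarith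
    have ez : z = t + w / (2 * Complex.I) := (hμ m hm).2
    obtain ⟨-, b1, b2⟩ := hLp z (hsec m hm)
    have hfreq : (freq p t : ℂ) = t ^ 2 + om := by simp [freq, hom]
    -- Squaring `z = t + w/(2i)` gives `i z² = i t² + t w - i w²/4`. As `w = h/z + O(z⁻²)`, the
    -- product `t w` tends to `h = a + i om`; the second-order bound on `L` is what makes the
    -- remainder `O(1/t)`.
    have key : Λ m - (a + Complex.I * freq p t)
        = t * (w - h / z) - h * (w / (2 * Complex.I)) / z - Complex.I * w ^ 2 / 4 := by
      have e1 : (t : ℂ) / z = 1 - (w / (2 * Complex.I)) / z := by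
        field_simp
        rw [eq_sub_iff_add_eq]
        conv_rhs => rw [ez]
        field_simp
      have e2 : Λ m = Complex.I * t ^ 2 + t * w - Complex.I * w ^ 2 / 4 := by
        simp only [hΛ, ← hz]
        rw [ez, add_sq, div_pow, mul_pow, Complex.I_sq]
        field_simp
        linear_combination (t * w * 4 : ℂ) * Complex.I_sq - (t * w * 4 : ℂ) * Complex.I_sq
      have e3 : (t : ℂ) * (h / z) = h - h * (w / (2 * Complex.I)) / z := by
        rw [mul_div_assoc', mul_comm, mul_div_assoc, e1]; ring
      rw [e2, hfreq, mul_sub, e3, hh]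
      ring
    have hw1 : ‖w‖ ≤ 2 * ‖h‖ / t + 4 * C' / t ^ 2 := by
      calc ‖w‖ = ‖h / z + (w - h / z)‖ := by ring_nf
        _ ≤ ‖h‖ / ‖z‖ + C' / ‖z‖ ^ 2 := (norm_add_le _ _).trans
            (add_le_add (norm_div _ _).le b2)
        _ ≤ ‖h‖ / (t / 2) + C' / (t / 2) ^ 2 := by gcongr
        _ = _ := by field_simp; ring
    have ht1 : 4 * C' / t ^ 2 ≤ 4 * C' / t := by
      gcongr
      nlinarith
    have n1 : ‖(t : ℂ) * (w - h / z)‖ ≤ 4 * C' / t := by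
      rw [norm_mul, Complex.norm_real, Real.norm_of_nonneg (by linarith)]
      calc t * ‖w - h / z‖ ≤ t * (C' / (t / 2) ^ 2) := by
            gcongr
            exact b2.trans (by gcongr)
        _ = 4 * C' / t := by field_simp; ring
    have n2 : ‖h * (w / (2 * Complex.I)) / z‖ ≤ 2 * ‖h‖ / t := by
      rw [norm_div, norm_mul, norm_div, norm_mul, Complex.norm_ofNat, Complex.norm_I]
      calc ‖h‖ * (‖w‖ / (2 * 1)) / ‖z‖ ≤ ‖h‖ * 1 / (t / 2) := by
            gcongr
            linarith
        _ = 2 * ‖h‖ / t := by field_simp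
    have n3 : ‖Complex.I * w ^ 2 / 4‖ ≤ 2 * ‖h‖ / t + 4 * C' / t := by
      rw [norm_div, norm_mul, norm_pow, Complex.norm_I, Complex.norm_ofNat]
      nlinarith [norm_nonneg w]
    rw [key]
    calc _ ≤ 4 * C' / t + 2 * ‖h‖ / t + (2 * ‖h‖ / t + 4 * C' / t) :=
          (norm_sub_le _ _).trans (add_le_add ((norm_sub_le _ _).trans (add_le_add n1 n2)) n3)
      _ = _ := by ring
  have hO : (fun n : ℕ => lam n - (a + Complex.I * freq p ((n + δ) * Real.pi)))
      =O[atTop] (fun n : ℕ => ((n + δ) * Real.pi)⁻¹) := by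
    refine IsBigO.of_bound (2 * ‖h‖ + 4 * C' + (2 * ‖h‖ + 4 * C')) ?_
    filter_upwards [eventually_ge_atTop n₀] with m hm
    have e : τ m = (m + δ) * Real.pi := by simp [hτ]
    have hpos : 0 ≤ (τ m)⁻¹ := by
      have := hτge m hm
      rw [inv_nonneg]; linarith
    rw [hlp m hm, ← e, Real.norm_of_nonneg hpos]
    exact hasym m hm
  have hconjlam : ∀ n, lam (-n) = conj (lam n) := by
    intro n
    simp only [hlam, Int.natAbs_neg]
    split_ifs with h1 h2 h3 h3
    · simp
    · omega
    · simp
    · rfl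
    · omega
  refine ⟨lam, n₀, hn₀pos, hconjlam, ?_, ?_, ?_, ?_, hO, ?_⟩
  · intro n hn n' hn' e
    obtain ⟨m, hm, h1⟩ := hcases n hn
    obtain ⟨m', hm', h2⟩ := hcases n' hn'
    have p1 := hΛpos m hm
    have p2 := hΛpos m' hm'
    rcases h1 with ⟨rfl, e1⟩ | ⟨rfl, e1⟩ <;> rcases h2 with ⟨rfl, e2⟩ | ⟨rfl, e2⟩ <;>
      rw [e1, e2] at e
    · rw [hΛinj m m' hm hm' e]
    · have := congrArg Complex.im e
      rw [Complex.conj_im] at this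
      linarith
    · have := congrArg Complex.im e
      rw [Complex.conj_im] at this
      linarith
    · rw [hΛinj m m' hm hm' ((starRingEnd ℂ).injective e)]
  · rintro _ ⟨n, hn, rfl⟩
    obtain ⟨m, hm, ⟨-, e⟩ | ⟨-, e⟩⟩ := hcases n hn
    · rw [e]; exact hΛZ m hm
    · rw [e]; exact hconj _ (hΛZ m hm)
  -- A zero with norm above `2R²`, conjugated if necessary, has a square root of real part above
  -- `R`. Its centre `τ n` lies within `1`, which forces `n > n₀`; uniqueness of the fixed point
  -- identifies it with a member of the branch.
  · set R : ℝ := τ n₀ + 1 with hR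
    refine (hfin (2 * R ^ 2)).subset fun z hz => ⟨hz.1, ?_⟩
    rw [mem_closedBall_zero_iff]
    by_contra hn
    rw [not_le] at hn
    have main : ∀ z ∈ Z, 2 * R ^ 2 < ‖z‖ → 0 ≤ z.im → ∃ m, n₀ ≤ m ∧ z = Λ m := by
      intro z hz hzR him
      obtain ⟨ν, hν, hνz⟩ := exists_sqrt_sector (hneg z hz) him (R := R) (by linarith) hzR
      have hν' : ν ∈ sectorAt M' := sectorAt_mono (by linarith) hν
      obtain ⟨n, en⟩ := (hfix ν hν').1 (by rw [hνz]; exact hz)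
      have hball : ‖ν - τ n‖ ≤ 1 := by
        rw [sub_eq_of_eq_add' en, norm_div, norm_mul, Complex.norm_ofNat, Complex.norm_I]
        linarith [hLb ν hν']
      have hre := (Complex.abs_re_le_norm _).trans hball
      simp only [Complex.sub_re, Complex.ofReal_re] at hre
      have hlt : τ n₀ < τ n := by linarith [hν.1, (abs_le.1 hre).2]
      have hn0 : (n₀ : ℤ) < n := by
        by_contra hcon
        exact absurd (hτmono (not_lt.1 hcon)) (not_le.2 hlt)
      obtain ⟨m, rfl⟩ : ∃ m : ℕ, n = m := ⟨n.toNat, by omega⟩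
      have hm : n₀ ≤ m := by omega
      refine ⟨m, hm, ?_⟩
      rw [← hνz]
      simp only [hΛ]
      rw [fixed_point_unique hM1 hL hLb (t := τ m) (by linarith [hτge m hm])
        (mem_closedBall_iff_norm.2 hball) (hμ m hm).1 en (hμ m hm).2]
    rcases le_total 0 z.im with him | him
    · obtain ⟨m, hm, rfl⟩ := main z hz.1 hn him
      exact hz.2 (hmem m hm).1
    · obtain ⟨m, hm, e⟩ := main (conj z) (hconj z hz.1) (by rwa [Complex.norm_conj])
        (by rw [Complex.conj_im]; linarith)
      have e' : z = conj (Λ m) := by rw [← e, Complex.conj_conj]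
      rw [e'] at hz
      exact hz.2 (hmem m hm).2
  · have h1 : Tendsto (fun m : ℕ => τ m - 2) atTop atTop := by
      refine tendsto_atTop_add_const_right _ _ ?_
      simp only [hτ]
      refine Tendsto.atTop_mul_const Real.pi_pos (tendsto_atTop_add_const_right _ _ ?_)
      simpa using tendsto_natCast_atTop_atTop (R := ℝ)
    refine tendsto_atTop_mono' _ ?_ h1
    filter_upwards [eventually_ge_atTop n₀] with m hm
    rw [hlp m hm]
    exact (hΛim m hm).le
  · refine IsBigO.trans (IsBigO.of_bound 1 ?_) hO
    filter_upwards with m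
    rw [hconjlam, one_mul, ← Complex.norm_conj (lam m - _)]
    simp [sub_eq_add_neg]

/-! ### Roots of the characteristic polynomial -/

/-- An analytic implicit function theorem for scalar equations. -/
theorem exists_analyticAt_implicit {F : ℂ × ℂ → ℂ} {u₀ d : ℂ} (hF : ContDiff ℂ ω F)
    (h0 : F (0, u₀) = 0) (hd : HasDerivAt (fun u => F (0, u)) d u₀) (hd0 : d ≠ 0) :
    ∃ u : ℂ → ℂ, AnalyticAt ℂ u 0 ∧ u 0 = u₀ ∧ ∀ᶠ ε in 𝓝 0, F (ε, u ε) = 0 := by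
  have cdf : ContDiffAt ℂ ω F (0, u₀) := hF.contDiffAt
  have hdiff : DifferentiableAt ℂ F (0, u₀) := cdf.differentiableAt (by simp)
  have e : fderiv ℂ F (0, u₀) ∘L .inr ℂ ℂ ℂ
      = (ContinuousLinearEquiv.unitsEquivAut ℂ (Units.mk0 d hd0) : ℂ →L[ℂ] ℂ) := by
    ext
    have h1 : HasDerivAt (fun u : ℂ => ((0 : ℂ), u)) (0, 1) u₀ :=
      (hasDerivAt_const _ _).prodMk (hasDerivAt_id _)
    have := (hdiff.hasFDerivAt.comp_hasDerivAt u₀ h1).unique hd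
    simpa using this
  have if₂ : (fderiv ℂ F (0, u₀) ∘L .inr ℂ ℂ ℂ).IsInvertible := ⟨_, e.symm⟩
  refine ⟨cdf.implicitFunction (by simp) if₂, ?_, cdf.implicitFunction_apply_self _ if₂, ?_⟩
  · exact (cdf.contDiffAt_implicitFunction (by simp) if₂).analyticAt
  · have := cdf.eventually_apply_implicitFunction (by simp) if₂
    rw [h0] at this
    exact this

/-- The characteristic polynomial in the scaled variables `ε = μ⁻¹`, `z = r ε`, where
`λ = i μ²`. -/
def rootPoly (p : Params) (ε z : ℂ) : ℂ :=
  z ^ 4 - 1 + 2 * Complex.I * p.β * p.η * z * ε - (p.γ - p.η ^ 2) * z ^ 2 * ε ^ 2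

/-- The branch of roots starting at the fourth root of unity `z₀`, to second order. -/
theorem exists_root_branch (p : Params) {z₀ : ℂ} (hz : z₀ ^ 4 = 1) :
    ∃ u : ℂ → ℂ, AnalyticAt ℂ u 0 ∧
      4 * z₀ ^ 3 * u 0 = (p.γ - p.η ^ 2) * z₀ ^ 2 + p.β ^ 2 * p.η ^ 2 * z₀ ^ 2 / 2 ∧
      ∀ᶠ ε in 𝓝 0, rootPoly p ε
        (z₀ - Complex.I * p.β * p.η / 2 * z₀ ^ 2 * ε + u ε * ε ^ 2) = 0 := by
  -- With `z = z₀ + w ε`, the terms of order `0` and `1` in `ε` cancel because `z₀⁴ = 1`. Division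
  -- by `ε²` leaves `F`, which at `ε = 0` is affine in `u` with slope `4 z₀³ ≠ 0`.
  have hz0 : z₀ ≠ 0 := by rintro rfl; norm_num at hz
  set w : ℂ × ℂ → ℂ := fun q => - Complex.I * p.β * p.η / 2 * z₀ ^ 2 + q.2 * q.1 with hw
  set F : ℂ × ℂ → ℂ := fun q => 4 * z₀ ^ 3 * q.2 + 6 * z₀ ^ 2 * w q ^ 2
    + 2 * Complex.I * p.β * p.η * w q - (p.γ - p.η ^ 2) * (z₀ + w q * q.1) ^ 2
    + 4 * z₀ * q.1 * w q ^ 3 + q.1 ^ 2 * w q ^ 4 with hF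
  have hwc : ContDiff ℂ ω w := by fun_prop
  have hFc : ContDiff ℂ ω F := by fun_prop
  set u₀ : ℂ := ((p.γ - p.η ^ 2) * z₀ ^ 2 + p.β ^ 2 * p.η ^ 2 * z₀ ^ 2 / 2) / (4 * z₀ ^ 3)
    with hu₀
  have h3 : 4 * z₀ ^ 3 ≠ 0 := by simp [hz0]
  have hv : 4 * z₀ ^ 3 * u₀ = (p.γ - p.η ^ 2) * z₀ ^ 2 + p.β ^ 2 * p.η ^ 2 * z₀ ^ 2 / 2 :=
    mul_div_cancel₀ _ h3
  obtain ⟨u, hu, hu0, hev⟩ := exists_analyticAt_implicit hFc (u₀ := u₀) (d := 4 * z₀ ^ 3)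
    (by
      simp only [hF, hw]
      linear_combination hv + (6 * z₀ ^ 2 / 4 * p.β ^ 2 * p.η ^ 2 * z₀ ^ 4
        - p.β ^ 2 * p.η ^ 2 * z₀ ^ 2) * Complex.I_sq
        - 6 / 4 * p.β ^ 2 * p.η ^ 2 * z₀ ^ 2 * hz)
    (by
      have : (fun u => F (0, u)) = fun u => 4 * z₀ ^ 3 * u + F (0, 0) := by
        funext u; simp [hF, hw]; ring
      rw [this]
      simpa using ((hasDerivAt_id u₀).const_mul (4 * z₀ ^ 3)).add_const (F (0, 0))) h3
  refine ⟨u, hu, by rw [hu0, hv], ?_⟩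
  filter_upwards [hev] with ε hε
  simp only [hF, hw] at hε
  simp only [rootPoly]
  linear_combination ε ^ 2 * hε + (1 - 2 * Complex.I * p.β * p.η * z₀ * ε) * hz

/-- Second order Taylor estimate. -/
theorem exists_taylor_bound {A : ℂ → ℂ} {h : ℂ} (hA : AnalyticAt ℂ A 0)
    (h1 : HasDerivAt A h 0) :
    ∃ C, ∀ᶠ ε in 𝓝 0, ‖A ε - A 0 - h * ε‖ ≤ C * ‖ε‖ ^ 2 := by
  obtain ⟨F, hF, hev⟩ := hA.exists_eventuallyEq_sum_add_pow_mul 2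
  refine ⟨‖F 0‖ + 1, ?_⟩
  have hb : ∀ᶠ ε in 𝓝 0, ‖F ε‖ < ‖F 0‖ + 1 :=
    hF.continuousAt.norm.eventually_lt continuousAt_const (by linarith)
  filter_upwards [hev, hb] with ε h2 h3
  rw [h2]
  simp only [Finset.sum_range_succ, Finset.sum_range_zero, iteratedDeriv_zero, iteratedDeriv_one,
    h1.deriv, smul_eq_mul]
  have : (0 + ε ^ 0 / ↑(Nat.factorial 0) * A 0 + ε ^ 1 / ↑(Nat.factorial 1) * h + ε ^ 2 * F ε)
      - A 0 - h * ε = F ε * ε ^ 2 := by simp; ring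
  rw [this, norm_mul, norm_pow]
  gcongr

/-! ### Characteristic determinants of exponentials -/

/-- Exponentials of roots of the characteristic polynomial are solutions. -/
theorem isSolution_exp {p : Params} {lam r : ℂ}
    (hr : r ^ 4 - (p.γ - p.η ^ 2) * r ^ 2 + 2 * lam * p.β * p.η * r = -lam ^ 2) :
    IsSolution p lam (fun s => Complex.exp (r * s)) ∧
      ∀ j : Fin 4, iteratedDeriv j (fun s : ℝ => Complex.exp (r * s))
        = fun s : ℝ => r ^ (j : ℕ) * Complex.exp (r * s) := by
  have hd : ∀ s : ℝ, HasDerivAt (fun s : ℝ => Complex.exp (r * s)) (r * Complex.exp (r * s)) s := by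
    intro s
    have h1 : HasDerivAt (fun s : ℝ => r * (s : ℂ)) (r * 1) s :=
      (Complex.ofRealCLM.hasDerivAt (x := s)).const_mul r
    convert h1.cexp using 1
    ring
  have key := isSolution_of_chain (p := p) (lam := lam)
    (y := fun j s => r ^ (j : ℕ) * Complex.exp (r * s))
    (fun s => by simpa using hd s)
    (fun s => by simpa [pow_two, mul_assoc] using (hd s).const_mul r)
    (fun s => ((hd s).const_mul (r ^ 2)).congr_deriv (by
      show _ = r ^ 3 * _
      ring))
    (fun s => ((hd s).const_mul (r ^ 3)).congr_deriv (by
      show _ = -lam ^ 2 * (r ^ 0 * _) - 2 * lam * p.β * p.η * (r ^ 1 * _)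
        + (p.γ - p.η ^ 2) * (r ^ 2 * _)
      linear_combination Complex.exp (r * s) * hr))
  simpa using key

/-- The characteristic determinant of exponentials, with last row given by `l`. -/
def expMat (p : Params) (lam : ℂ) (l r : Fin 4 → ℂ) : Matrix (Fin 4) (Fin 4) ℂ :=
  Matrix.of ![fun j => Complex.exp (r j), fun j => r j ^ 2 * Complex.exp (r j),
    fun j => r j ^ 2 - (p.α + lam * p.κ) * r j, l]

/-- The initial jets of exponentials form a Vandermonde matrix. -/
theorem det_jetMat_exp_ne_zero {p : Params} {lam : ℂ} {r : Fin 4 → ℂ}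
    (hr : ∀ j, r j ^ 4 - (p.γ - p.η ^ 2) * r j ^ 2 + 2 * lam * p.β * p.η * r j = -lam ^ 2)
    (hinj : Function.Injective r) :
    (jetMat fun j s => Complex.exp (r j * s)).det ≠ 0 := by
  have : (jetMat fun j s => Complex.exp (r j * s)) = (Matrix.vandermonde r).transpose := by
    ext i j
    simp only [jetMat, Matrix.of_apply, (isSolution_exp (hr j)).2 i]
    simp [Matrix.vandermonde]
  rw [this, Matrix.det_transpose]
  exact Matrix.det_vandermonde_ne_zero_iff.2 hinj

theorem det_bcMat_force_eq_zero_iff {p : Params} {lam : ℂ} {r : Fin 4 → ℂ}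
    (hr : ∀ j, r j ^ 4 - (p.γ - p.η ^ 2) * r j ^ 2 + 2 * lam * p.β * p.η * r j = -lam ^ 2)
    (hinj : Function.Injective r) :
    (bcMat p lam (forceRow p lam)).det = 0 ↔
      (expMat p lam (fun j => r j ^ 3 - (p.γ - p.η ^ 2) * r j + lam * p.β * p.η) r).det = 0 := by
  have h := Delta1_eq (fun j => (isSolution_exp (hr j)).1)
  have e : Delta1 p lam (fun j s => Complex.exp (r j * s))
      = (expMat p lam (fun j => r j ^ 3 - (p.γ - p.η ^ 2) * r j + lam * p.β * p.η) r).det := by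
    rw [Delta1, expMat]
    have i1 := fun j => (isSolution_exp (hr j)).2 1
    have i2 := fun j => (isSolution_exp (hr j)).2 2
    have i3 := fun j => (isSolution_exp (hr j)).2 3
    simp only [Fin.val_one, Fin.val_two, show ((3 : Fin 4) : ℕ) = 3 from rfl] at i1 i2 i3
    simp [momentForm, forceForm, i1, i2, i3]
  rw [← e, h, mul_eq_zero, or_iff_left (det_jetMat_exp_ne_zero hr hinj)]

theorem det_bcMat_pin_eq_zero_iff {p : Params} {lam : ℂ} {r : Fin 4 → ℂ}
    (hr : ∀ j, r j ^ 4 - (p.γ - p.η ^ 2) * r j ^ 2 + 2 * lam * p.β * p.η * r j = -lam ^ 2)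
    (hinj : Function.Injective r) :
    (bcMat p lam pinRow).det = 0 ↔ (expMat p lam 1 r).det = 0 := by
  have h := Delta2_eq (fun j => (isSolution_exp (hr j)).1)
  have e : Delta2 p lam (fun j s => Complex.exp (r j * s)) = (expMat p lam 1 r).det := by
    rw [Delta2, expMat]
    have i1 := fun j => (isSolution_exp (hr j)).2 1
    have i2 := fun j => (isSolution_exp (hr j)).2 2
    simp only [Fin.val_one, Fin.val_two] at i1 i2
    simp [momentForm, i1, i2]
    rfl
  rw [← e, h, mul_eq_zero, or_iff_left (det_jetMat_exp_ne_zero hr hinj)]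

/-- Laplace expansion of `det (expMat p lam l r)` along its first two rows. -/
theorem det_two_rows (e r m l : Fin 4 → ℂ) :
    (Matrix.of ![e, fun j => r j ^ 2 * e j, m, l]).det =
      e 1 * e 2 * (r 2 ^ 2 - r 1 ^ 2) * (m 0 * l 3 - m 3 * l 0)
      - e 0 * e 2 * (r 2 ^ 2 - r 0 ^ 2) * (m 1 * l 3 - m 3 * l 1)
      + (e 0 * e 1 * (r 1 ^ 2 - r 0 ^ 2) * (m 2 * l 3 - m 3 * l 2)
        + e 0 * e 3 * (r 3 ^ 2 - r 0 ^ 2) * (m 1 * l 2 - m 2 * l 1)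
        - e 1 * e 3 * (r 3 ^ 2 - r 1 ^ 2) * (m 0 * l 2 - m 2 * l 0)
        + e 2 * e 3 * (r 3 ^ 2 - r 2 ^ 2) * (m 0 * l 1 - m 1 * l 0)) := by
  simp [Matrix.det_succ_row_zero, Fin.sum_univ_succ, Fin.succAbove]
  ring

/-! ### Dominant and exponentially small terms in the sector -/

theorem norm_le_of_mem_sectorAt {M : ℝ} (hM : 1 ≤ M) {μ : ℂ} (hμ : μ ∈ sectorAt M) :
    ‖μ‖ ≤ 3 * μ.re := by
  obtain ⟨h1, h2, h3⟩ := hμ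
  refine (Complex.norm_le_abs_re_add_abs_im μ).trans ?_
  have : |μ.im| ≤ 2 * μ.re := abs_le.2 ⟨by linarith, by linarith⟩
  rw [abs_of_pos (by linarith)]
  linarith

/-- The inversion `ε = μ⁻¹` takes the far part of the sector into any punctured neighbourhood of
zero. -/
theorem exists_sectorAt_of_eventually {q : ℂ → Prop} (hq : ∀ᶠ ε in 𝓝[≠] 0, q ε) :
    ∃ M, 1 ≤ M ∧ ∀ μ ∈ sectorAt M, q μ⁻¹ := by
  rw [eventually_nhdsWithin_iff, Metric.eventually_nhds_iff] at hq
  obtain ⟨r, hr, h⟩ := hq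
  refine ⟨max 1 r⁻¹, le_max_left _ _, fun μ hμ => ?_⟩
  have h1 : max 1 r⁻¹ < ‖μ‖ := hμ.1.trans_le (Complex.re_le_norm μ)
  have h2 : 0 < ‖μ‖ := by linarith [le_max_left 1 r⁻¹]
  refine h ?_ (inv_ne_zero (norm_pos_iff.1 h2))
  rw [dist_zero_right, norm_inv]
  exact inv_lt_of_inv_lt₀ hr ((le_max_right _ _).trans_lt h1)

/-- From `exp x ≥ x²/2` and `‖μ‖ ≤ 3 Re μ`; the constant is `2 · 3²`. -/
theorem exp_neg_re_le {M : ℝ} (hM : 1 ≤ M) {μ : ℂ} (hμ : μ ∈ sectorAt M) :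
    Real.exp (-μ.re) ≤ 18 / ‖μ‖ ^ 2 := by
  have h1 := hμ.1
  have h2 : 0 < ‖μ‖ := by linarith [Complex.re_le_norm μ]
  have h3 := norm_le_of_mem_sectorAt hM hμ
  have h4 := Real.quadratic_le_exp_of_nonneg (x := μ.re) (by linarith)
  rw [Real.exp_neg, inv_eq_one_div, div_le_div_iff₀ (Real.exp_pos _) (by positivity)]
  nlinarith

/-- The four summands of the characteristic determinant that are exponentially small in a
sector. -/
def smallTerms (z m l : Fin 4 → ℂ) (e : Fin 4 → ℂ) : ℂ :=
  e 1 * (e 2)⁻¹ * ((z 1 ^ 2 - z 0 ^ 2) * (m 2 * l 3 - m 3 * l 2))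
  + e 3 * (e 2)⁻¹ * ((z 3 ^ 2 - z 0 ^ 2) * (m 1 * l 2 - m 2 * l 1))
  - e 1 * (e 0)⁻¹ * e 3 * (e 2)⁻¹ * ((z 3 ^ 2 - z 1 ^ 2) * (m 0 * l 2 - m 2 * l 0))
  + e 3 * (e 0)⁻¹ * ((z 3 ^ 2 - z 2 ^ 2) * (m 0 * l 1 - m 1 * l 0))

/-- Division by `e 0 * e 2`, the product that does not decay relative to the others: in the
application `e 0` is close to `exp(-iμ)` and `e 2` to `exp μ`, up to bounded factors. -/
theorem det_eq_zero_iff_smallTerms {z m l e : Fin 4 → ℂ} (h0 : e 0 ≠ 0) (h2 : e 2 ≠ 0) :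
    (Matrix.of ![e, fun j => z j ^ 2 * e j, m, l]).det = 0 ↔
      e 1 * (e 0)⁻¹ * ((z 2 ^ 2 - z 1 ^ 2) * (m 0 * l 3 - m 3 * l 0)) =
        (z 2 ^ 2 - z 0 ^ 2) * (m 1 * l 3 - m 3 * l 1) - smallTerms z m l e := by
  rw [det_two_rows, ← sub_eq_zero (b := (z 2 ^ 2 - z 0 ^ 2) * (m 1 * l 3 - m 3 * l 1) - _)]
  rw [← mul_eq_zero_iff_left (mul_ne_zero h0 h2) (b := e 1 * _ * _ - _)]
  refine Eq.congr_left ?_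
  rw [smallTerms]
  field_simp
  ring

/-- Every summand contains `(e 2)⁻¹` or `e 3`, each of which supplies the small factor `x`; the
remaining factors are bounded by `W`. -/
theorem norm_smallTerms_le {z m l e : Fin 4 → ℂ} {B W x : ℝ} (hW : 1 ≤ W) (hx : x ≤ 1)
    (hB : ∀ i j k n, ‖(z i ^ 2 - z j ^ 2) * (m k * l n - m n * l k)‖ ≤ B)
    (h0 : ‖(e 0)⁻¹‖ ≤ W) (h1 : ‖e 1‖ ≤ W) (h2 : ‖(e 2)⁻¹‖ ≤ W * x) (h3 : ‖e 3‖ ≤ W * x) :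
    ‖smallTerms z m l e‖ ≤ 4 * W ^ 4 * B * x := by
  have hx0 : 0 ≤ x := by
    have := (norm_nonneg _).trans h3
    by_contra hneg
    nlinarith
  have h2' : ‖(e 2)⁻¹‖ ≤ W := h2.trans (by nlinarith)
  have h3' : ‖e 3‖ ≤ W := h3.trans (by nlinarith)
  have hB0 : 0 ≤ B := (norm_nonneg _).trans (hB 0 0 0 0)
  have hW2 : W ^ 2 ≤ W ^ 4 := pow_le_pow_right₀ hW (by norm_num)
  have b1 : ‖e 1 * (e 2)⁻¹‖ ≤ W ^ 4 * x := by
    rw [norm_mul]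
    calc _ ≤ W * (W * x) := by gcongr
      _ = W ^ 2 * x := by ring
      _ ≤ _ := by gcongr
  have b2 : ‖e 3 * (e 2)⁻¹‖ ≤ W ^ 4 * x := by
    rw [norm_mul]
    calc _ ≤ W * (W * x) := by gcongr
      _ = W ^ 2 * x := by ring
      _ ≤ _ := by gcongr
  have b3 : ‖e 1 * (e 0)⁻¹ * e 3 * (e 2)⁻¹‖ ≤ W ^ 4 * x := by
    rw [norm_mul, norm_mul, norm_mul]
    calc _ ≤ W * W * W * (W * x) := by gcongr
      _ = _ := by ring
  have b4 : ‖e 3 * (e 0)⁻¹‖ ≤ W ^ 4 * x := by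
    rw [norm_mul]
    calc _ ≤ W * x * W := by gcongr
      _ = W ^ 2 * x := by ring
      _ ≤ _ := by gcongr
  have hm : ∀ {s t : ℂ}, ‖s‖ ≤ W ^ 4 * x → ‖t‖ ≤ B → ‖s * t‖ ≤ W ^ 4 * x * B := by
    intro s t hs ht
    rw [norm_mul]
    gcongr
  rw [smallTerms]
  calc _ ≤ W ^ 4 * x * B + W ^ 4 * x * B + W ^ 4 * x * B + W ^ 4 * x * B :=
        (norm_add_le _ _).trans (add_le_add ((norm_sub_le _ _).trans (add_le_add
          ((norm_add_le _ _).trans (add_le_add (hm b1 (hB _ _ _ _)) (hm b2 (hB _ _ _ _))))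
          (hm b3 (hB _ _ _ _)))) (hm b4 (hB _ _ _ _)))
    _ = _ := by ring

theorem eventually_norm_le_of_analyticAt {f : ℂ → ℂ} (hf : AnalyticAt ℂ f 0) :
    ∀ᶠ ε in 𝓝 0, ‖f ε‖ ≤ ‖f 0‖ + 1 :=
  (hf.continuousAt.norm.eventually_lt continuousAt_const (by linarith)).mono fun _ h => h.le

set_option maxHeartbeats 1000000 in
/-- In a sector, the vanishing of a characteristic determinant is a perturbation of the equation
`exp (2 i μ) = G`. -/
theorem exists_sector_equation {z m l u : Fin 4 → ℂ → ℂ} {c : Fin 4 → ℂ} {G h : ℂ}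
    (hm : ∀ j, AnalyticAt ℂ (m j) 0) (hl : ∀ j, AnalyticAt ℂ (l j) 0)
    (hu : ∀ j, AnalyticAt ℂ (u j) 0)
    (hz : ∀ j ε, z j ε = (![-Complex.I, Complex.I, 1, -1] : Fin 4 → ℂ) j + c j * ε + u j ε * ε ^ 2)
    (hc : c 0 = c 1) {P Q : ℂ → ℂ}
    (hP : ∀ ε, P ε = (z 2 ε ^ 2 - z 0 ε ^ 2) * (m 1 ε * l 3 ε - m 3 ε * l 1 ε))
    (hQ : ∀ ε, Q ε = (z 2 ε ^ 2 - z 1 ε ^ 2) * (m 0 ε * l 3 ε - m 3 ε * l 0 ε))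
    (hQ0 : Q 0 ≠ 0) (hG : G ≠ 0) (hPQ : P 0 = G * Q 0)
    (hder : HasDerivAt (fun ε => P ε / (G * Q ε) * Complex.exp (-(ε * (u 1 ε - u 0 ε)))) h 0)
    {D : ℂ → Prop}
    (hD : ∀ᶠ ε in 𝓝[≠] 0, D ε⁻¹ ↔
      (Matrix.of ![fun j => Complex.exp (z j ε * ε⁻¹),
        fun j => z j ε ^ 2 * Complex.exp (z j ε * ε⁻¹), fun j => m j ε, fun j => l j ε]).det = 0) :
    ∃ (M C : ℝ) (H : ℂ → ℂ), DifferentiableOn ℂ H (sectorAt M) ∧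
      (∀ μ ∈ sectorAt M, ‖H μ - 1 - h / μ‖ ≤ C / ‖μ‖ ^ 2) ∧
      ∀ μ ∈ sectorAt M, D μ ↔ Complex.exp (2 * Complex.I * μ) = G * H μ := by
  have hza : ∀ j, AnalyticAt ℂ (z j) 0 := fun j => by
    have := hu j
    rw [funext (hz j)]
    fun_prop
  have hPa : AnalyticAt ℂ P 0 := by
    have := hza 2; have := hza 0; have := hm 1; have := hm 3; have := hl 1; have := hl 3
    rw [funext hP]; fun_prop
  have hQa : AnalyticAt ℂ Q 0 := by
    have := hza 2; have := hza 1; have := hm 0; have := hm 3; have := hl 0; have := hl 3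
    rw [funext hQ]; fun_prop
  -- Multiplication by `N` normalises the equation: `P N` equals `1` at `ε = 0` and has derivative
  -- `h` there.
  set N : ℂ → ℂ := fun ε => Complex.exp (-(ε * (u 1 ε - u 0 ε))) / (G * Q ε) with hN
  have hGQ : G * Q 0 ≠ 0 := mul_ne_zero hG hQ0
  have hNa : AnalyticAt ℂ N 0 := by
    have := hu 0; have := hu 1
    refine AnalyticAt.div (by fun_prop) (by fun_prop) hGQ
  have hAa : AnalyticAt ℂ (fun ε => P ε * N ε) 0 := hPa.mul hNa
  have hder' : HasDerivAt (fun ε => P ε * N ε) h 0 := by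
    convert hder using 2 with ε
    simp only [hN]; ring
  have hA0 : P 0 * N 0 = 1 := by
    simp only [hN, hPQ]
    simp
    field_simp
  obtain ⟨C₁, hC₁⟩ := exists_taylor_bound hAa hder'
  rw [hA0] at hC₁
  set T : Fin 4 → Fin 4 → Fin 4 → Fin 4 → ℂ → ℂ := fun i j k n ε =>
    (z i ε ^ 2 - z j ε ^ 2) * (m k ε * l n ε - m n ε * l k ε) with hT
  have hTa : ∀ i j k n, AnalyticAt ℂ (T i j k n) 0 := fun i j k n => by
    have := hza i; have := hza j; have := hm k; have := hm n; have := hl k; have := hl n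
    simp only [hT]; fun_prop
  set B : ℝ := ∑ i, ∑ j, ∑ k, ∑ n, (‖T i j k n 0‖ + 1) with hB
  have hTb : ∀ᶠ ε in 𝓝 0, ∀ i j k n, ‖T i j k n ε‖ ≤ B := by
    simp only [eventually_all]
    intro i j k n
    filter_upwards [eventually_norm_le_of_analyticAt (hTa i j k n)] with ε hε
    refine hε.trans ?_
    have hp : ∀ i j k n, 0 ≤ ‖T i j k n 0‖ + 1 := fun _ _ _ _ => by positivity
    calc _ ≤ ∑ n, (‖T i j k n 0‖ + 1) :=
          Finset.single_le_sum (f := fun n => ‖T i j k n 0‖ + 1) (fun _ _ => hp _ _ _ _)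
            (Finset.mem_univ n)
      _ ≤ ∑ k, ∑ n, (‖T i j k n 0‖ + 1) :=
          Finset.single_le_sum (f := fun k => ∑ n, (‖T i j k n 0‖ + 1))
            (fun _ _ => Finset.sum_nonneg fun _ _ => hp _ _ _ _) (Finset.mem_univ k)
      _ ≤ ∑ j, ∑ k, ∑ n, (‖T i j k n 0‖ + 1) :=
          Finset.single_le_sum (f := fun j => ∑ k, ∑ n, (‖T i j k n 0‖ + 1))
            (fun _ _ => Finset.sum_nonneg fun _ _ => Finset.sum_nonneg fun _ _ => hp _ _ _ _)
            (Finset.mem_univ j)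
      _ ≤ B :=
          Finset.single_le_sum (f := fun i => ∑ j, ∑ k, ∑ n, (‖T i j k n 0‖ + 1))
            (fun _ _ => Finset.sum_nonneg fun _ _ => Finset.sum_nonneg fun _ _ =>
              Finset.sum_nonneg fun _ _ => hp _ _ _ _) (Finset.mem_univ i)
  -- With this bounded correction the exponent `z_j / ε` is `ζ_j μ + v_j`.
  set v : Fin 4 → ℂ → ℂ := fun j ε => c j + u j ε * ε with hv
  have hva : ∀ j, AnalyticAt ℂ (v j) 0 := fun j => by
    have := hu j
    simp only [hv]; fun_prop
  set K : ℝ := ∑ j, (‖v j 0‖ + 1) with hK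
  have hvb : ∀ᶠ ε in 𝓝 0, ∀ j, ‖v j ε‖ ≤ K := by
    simp only [eventually_all]
    intro j
    filter_upwards [eventually_norm_le_of_analyticAt (hva j)] with ε hε
    exact hε.trans (Finset.single_le_sum (f := fun j => ‖v j 0‖ + 1)
      (fun _ _ => by positivity) (Finset.mem_univ j))
  have hK0 : 0 ≤ K := Finset.sum_nonneg fun _ _ => by positivity
  have hall : ∀ᶠ ε in 𝓝[≠] 0, (D ε⁻¹ ↔
      (Matrix.of ![fun j => Complex.exp (z j ε * ε⁻¹),
        fun j => z j ε ^ 2 * Complex.exp (z j ε * ε⁻¹), fun j => m j ε, fun j => l j ε]).det = 0) ∧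
      (‖P ε * N ε - 1 - h * ε‖ ≤ C₁ * ‖ε‖ ^ 2) ∧ (∀ i j k n, ‖T i j k n ε‖ ≤ B) ∧
      (∀ j, ‖v j ε‖ ≤ K) ∧ ‖N ε‖ ≤ ‖N 0‖ + 1 ∧ Q ε ≠ 0 ∧ DifferentiableAt ℂ P ε ∧
      DifferentiableAt ℂ N ε ∧ (∀ j, DifferentiableAt ℂ (z j) ε) ∧
      (∀ j, DifferentiableAt ℂ (m j) ε) ∧ (∀ j, DifferentiableAt ℂ (l j) ε) ∧
      ∀ j, DifferentiableAt ℂ (v j) ε := by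
    have hd : ∀ {f : ℂ → ℂ}, AnalyticAt ℂ f 0 → ∀ᶠ ε in 𝓝[≠] 0, DifferentiableAt ℂ f ε :=
      fun hf => (hf.eventually_analyticAt.mono fun _ h => h.differentiableAt).filter_mono
        nhdsWithin_le_nhds
    refine hD.and ((hC₁.filter_mono nhdsWithin_le_nhds).and
      ((hTb.filter_mono nhdsWithin_le_nhds).and ((hvb.filter_mono nhdsWithin_le_nhds).and
      (((eventually_norm_le_of_analyticAt hNa).filter_mono nhdsWithin_le_nhds).and
      (((hQa.continuousAt.eventually_ne hQ0).filter_mono nhdsWithin_le_nhds).and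
      ((hd hPa).and ((hd hNa).and (Eventually.and ?_ (Eventually.and ?_
        (Eventually.and ?_ ?_)))))))))) <;>
    rw [eventually_all] <;> intro j
    exacts [hd (hza j), hd (hm j), hd (hl j), hd (hva j)]
  obtain ⟨M, hM, hMall⟩ := exists_sectorAt_of_eventually hall
  set ζ : Fin 4 → ℂ := ![-Complex.I, Complex.I, 1, -1] with hζ
  set e : Fin 4 → ℂ → ℂ := fun j μ => Complex.exp (ζ j * μ + v j μ⁻¹) with he
  have hμ0 : ∀ μ ∈ sectorAt M, μ ≠ 0 := by
    rintro μ hμ rfl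
    have := hμ.1
    simp at this
    linarith
  have hexp : ∀ μ ∈ sectorAt M, ∀ j, z j μ⁻¹ * μ = ζ j * μ + v j μ⁻¹ := fun μ hμ j => by
    have := hμ0 μ hμ
    rw [hz, hv]
    field_simp
    ring
  set S : ℂ → ℂ := fun μ => smallTerms (fun j => z j μ⁻¹) (fun j => m j μ⁻¹)
    (fun j => l j μ⁻¹) (fun j => e j μ) with hS
  -- The `2` comes from the bound `Im μ > -2` of the sector, which limits `exp(iμ)`; `K` limits the
  -- corrections `v_j`.
  set W : ℝ := Real.exp (2 + K) with hW
  have hW1 : 1 ≤ W := Real.one_le_exp (by linarith)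
  have hSb : ∀ μ ∈ sectorAt M, ‖S μ‖ ≤ 4 * W ^ 4 * B * Real.exp (-μ.re) := by
    intro μ hμ
    obtain ⟨-, -, h3, h4, -⟩ := hMall μ hμ
    obtain ⟨k1, k2, k3⟩ := hμ
    have hre : ∀ j, |(v j μ⁻¹).re| ≤ K := fun j => (Complex.abs_re_le_norm _).trans (h4 j)
    have hx : Real.exp (-μ.re) ≤ 1 := Real.exp_le_one_iff.2 (by linarith)
    refine norm_smallTerms_le hW1 hx (fun i j k n => h3 i j k n) ?_ ?_ ?_ ?_
    · simp only [he, hζ, ← Complex.exp_neg, Complex.norm_exp, hW]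
      refine Real.exp_le_exp.2 ?_
      have := abs_le.1 (hre 0)
      simp
      linarith
    · simp only [he, hζ, Complex.norm_exp, hW]
      refine Real.exp_le_exp.2 ?_
      have := abs_le.1 (hre 1)
      simp
      linarith
    · simp only [he, hζ, ← Complex.exp_neg, Complex.norm_exp, hW, ← Real.exp_add]
      refine Real.exp_le_exp.2 ?_
      have := abs_le.1 (hre 2)
      simp
      linarith
    · simp only [he, hζ, Complex.norm_exp, hW, ← Real.exp_add]
      refine Real.exp_le_exp.2 ?_
      have := abs_le.1 (hre 3)
      simp
      linarith
  have hB0 : 0 ≤ B := Finset.sum_nonneg fun _ _ => Finset.sum_nonneg fun _ _ =>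
    Finset.sum_nonneg fun _ _ => Finset.sum_nonneg fun _ _ => by positivity
  refine ⟨M, C₁ + (4 * W ^ 4 * B * 18) * (‖N 0‖ + 1), fun μ => P μ⁻¹ * N μ⁻¹ - S μ * N μ⁻¹,
    ?_, ?_, ?_⟩
  · intro μ hμ
    obtain ⟨-, -, -, -, -, -, h7, h8, h9, h10, h11, h12⟩ := hMall μ hμ
    have hinv : DifferentiableAt ℂ (fun μ : ℂ => μ⁻¹) μ := differentiableAt_inv (hμ0 μ hμ)
    have cz := fun j => (h9 j).fun_comp' μ hinv
    have cm := fun j => (h10 j).fun_comp' μ hinv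
    have cl := fun j => (h11 j).fun_comp' μ hinv
    have cv := fun j => (h12 j).fun_comp' μ hinv
    have cP := h7.fun_comp' μ hinv
    have cN := h8.fun_comp' μ hinv
    have ce : ∀ j, DifferentiableAt ℂ (fun μ => e j μ) μ := fun j => by
      have := cv j
      simp only [he]; fun_prop
    have ci : ∀ j, DifferentiableAt ℂ (fun μ => (e j μ)⁻¹) μ := fun j =>
      (ce j).inv (Complex.exp_ne_zero _)
    refine DifferentiableAt.differentiableWithinAt ?_
    refine (cP.mul cN).sub (DifferentiableAt.mul ?_ cN)
    have dT : ∀ i j k n, DifferentiableAt ℂ (fun μ : ℂ => (z i μ⁻¹ ^ 2 - z j μ⁻¹ ^ 2) *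
        (m k μ⁻¹ * l n μ⁻¹ - m n μ⁻¹ * l k μ⁻¹)) μ := fun i j k n =>
      (((cz i).pow 2).sub ((cz j).pow 2)).mul (((cm k).mul (cl n)).sub ((cm n).mul (cl k)))
    exact ((((((ce 1).mul (ci 2)).mul (dT _ _ _ _)).add
      (((ce 3).mul (ci 2)).mul (dT _ _ _ _))).sub
      (((((ce 1).mul (ci 0)).mul (ce 3)).mul (ci 2)).mul (dT _ _ _ _))).add
      (((ce 3).mul (ci 0)).mul (dT _ _ _ _)))
  · intro μ hμ
    obtain ⟨-, h2, -, -, h5, -⟩ := hMall μ hμ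
    have h6 : ‖S μ‖ ≤ 4 * W ^ 4 * B * (18 / ‖μ‖ ^ 2) :=
      (hSb μ hμ).trans (by have := exp_neg_re_le hM hμ; gcongr)
    calc ‖P μ⁻¹ * N μ⁻¹ - S μ * N μ⁻¹ - 1 - h / μ‖
        = ‖(P μ⁻¹ * N μ⁻¹ - 1 - h * μ⁻¹) - S μ * N μ⁻¹‖ := by ring_nf
      _ ≤ C₁ * ‖μ⁻¹‖ ^ 2 + 4 * W ^ 4 * B * (18 / ‖μ‖ ^ 2) * (‖N 0‖ + 1) := by
          refine (norm_sub_le _ _).trans (add_le_add h2 ?_)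
          rw [norm_mul]
          gcongr
      _ = _ := by rw [norm_inv]; ring
  · intro μ hμ
    obtain ⟨h1, -, -, -, -, h6, -⟩ := hMall μ hμ
    rw [inv_inv] at h1
    have hee : (fun j => Complex.exp (z j μ⁻¹ * μ)) = fun j => e j μ := by
      funext j
      rw [hexp μ hμ j]
    have hee2 : (fun j => z j μ⁻¹ ^ 2 * Complex.exp (z j μ⁻¹ * μ))
        = fun j => z j μ⁻¹ ^ 2 * e j μ := by
      funext j
      rw [hexp μ hμ j]
    rw [h1, hee, hee2]
    rw [det_eq_zero_iff_smallTerms (z := fun j => z j μ⁻¹) (e := fun j => e j μ)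
      (Complex.exp_ne_zero _) (Complex.exp_ne_zero _)]
    rw [← hP, ← hQ]
    -- The constants cancel since `c 0 = c 1`, so only the second-order coefficients of the two
    -- imaginary branches enter.
    have hquot : e 1 μ * (e 0 μ)⁻¹
        = Complex.exp (2 * Complex.I * μ) * Complex.exp (μ⁻¹ * (u 1 μ⁻¹ - u 0 μ⁻¹)) := by
      simp only [he, hv, hc, ← Complex.exp_neg, ← Complex.exp_add]
      congr 1
      rw [show ζ 0 = -Complex.I from rfl, show ζ 1 = Complex.I from rfl]
      ring
    have hN' : N μ⁻¹ * (Complex.exp (μ⁻¹ * (u 1 μ⁻¹ - u 0 μ⁻¹)) * (G * Q μ⁻¹)) = 1 := by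
      simp only [hN, Complex.exp_neg]
      have hX := Complex.exp_ne_zero (μ⁻¹ * (u 1 μ⁻¹ - u 0 μ⁻¹))
      generalize Complex.exp (μ⁻¹ * (u 1 μ⁻¹ - u 0 μ⁻¹)) = X at hX ⊢
      clear h1 hee hee2
      generalize Q μ⁻¹ = q at h6 ⊢
      field_simp
    rw [hquot]
    have hne : Complex.exp (μ⁻¹ * (u 1 μ⁻¹ - u 0 μ⁻¹)) * Q μ⁻¹ ≠ 0 :=
      mul_ne_zero (Complex.exp_ne_zero _) h6
    constructor
    · intro hh
      refine mul_right_cancel₀ hne ?_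
      linear_combination hh - (P μ⁻¹ - S μ) * hN'
    · intro hh
      rw [hh]
      linear_combination (P μ⁻¹ - S μ) * hN'

/-! ### The two branches of eigenvalues -/

/-- The fourth roots of unity at which the branches of roots start. -/
def rootStart : Fin 4 → ℂ := ![-Complex.I, Complex.I, 1, -1]

/-- The first order coefficients of the branches of roots. -/
def rootSlope (p : Params) : Fin 4 → ℂ :=
  ![Complex.I * p.β * p.η / 2, Complex.I * p.β * p.η / 2, -(Complex.I * p.β * p.η / 2),
    -(Complex.I * p.β * p.η / 2)]

/-- The branches of roots with second order coefficients `u`. -/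
def rootBranch (p : Params) (u : Fin 4 → ℂ → ℂ) (j : Fin 4) (ε : ℂ) : ℂ :=
  rootStart j + rootSlope p j * ε + u j ε * ε ^ 2

/-- The difference of the second-order coefficients at `i` and `-i` is recorded because it alone
produces the frequency shift `(β²η²/2 + γ - η²)/2`. -/
theorem exists_rootBranch (p : Params) : ∃ u : Fin 4 → ℂ → ℂ, (∀ j, AnalyticAt ℂ (u j) 0) ∧
    u 1 0 - u 0 0 = -(Complex.I * ((p.β ^ 2 * p.η ^ 2 / 2 + p.γ - p.η ^ 2) / 2 : ℝ)) ∧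
    ∀ j, ∀ᶠ ε in 𝓝 0, rootPoly p ε (rootBranch p u j ε) = 0 := by
  have h4 : ∀ j, rootStart j ^ 4 = 1 := fun j => by
    have h : (-Complex.I) ^ 4 = 1 := by rw [Even.neg_pow (by decide), Complex.I_pow_four]
    have h' : (-1 : ℂ) ^ 4 = 1 := by norm_num
    fin_cases j <;> simp [rootStart, h, h', Complex.I_pow_four]
  choose u hu hu0 hroot using fun j => exists_root_branch p (h4 j)
  refine ⟨u, hu, ?_, fun j => ?_⟩
  · have e0 := hu0 0
    have e1 := hu0 1
    simp only [rootStart, Matrix.cons_val_zero, Matrix.cons_val_one] at e0 e1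
    push_cast
    linear_combination (exp := 1) (Complex.I / 4) * (e1 - (-1) * e0)
      + ((u 1 0 - u 0 0) * (1 - Complex.I ^ 2)
        + Complex.I * ((p.γ - p.η ^ 2) / 2 + p.β ^ 2 * p.η ^ 2 / 4)) * Complex.I_sq
  · filter_upwards [hroot j] with ε hε
    convert hε using 2
    rw [rootBranch, sub_eq_add_neg]
    congr 2
    fin_cases j <;> simp [rootStart, rootSlope]

theorem analyticAt_rootBranch {p : Params} {u : Fin 4 → ℂ → ℂ} (hu : ∀ j, AnalyticAt ℂ (u j) 0)
    (j : Fin 4) : AnalyticAt ℂ (rootBranch p u j) 0 := by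
  have := hu j
  unfold rootBranch
  fun_prop

theorem hasDerivAt_rootBranch {p : Params} {u : Fin 4 → ℂ → ℂ} (hu : ∀ j, AnalyticAt ℂ (u j) 0)
    (j : Fin 4) : HasDerivAt (rootBranch p u j) (rootSlope p j) 0 := by
  have h := (hu j).differentiableAt.hasDerivAt
  have hid := hasDerivAt_id (0 : ℂ)
  refine (((hid.const_mul (rootSlope p j)).const_add (rootStart j)).add
    (h.mul (hid.pow 2))).congr_deriv ?_
  simp

theorem rootBranch_zero (p : Params) (u : Fin 4 → ℂ → ℂ) (j : Fin 4) :
    rootBranch p u j 0 = rootStart j := by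
  simp [rootBranch]

theorem injective_rootStart : Function.Injective rootStart := by
  intro i j hij
  fin_cases i <;> fin_cases j <;> simp [rootStart, Complex.ext_iff] at hij ⊢ <;> norm_num at hij

/-- The vertex moment of an exponential, in the scaled variables. -/
def scaledMoment (p : Params) (ε z : ℂ) : ℂ :=
  z ^ 2 * ε - (p.α * ε ^ 2 + Complex.I * p.κ) * z

/-- The vertex force of an exponential, in the scaled variables. -/
def scaledForce (p : Params) (ε z : ℂ) : ℂ :=
  z ^ 3 - (p.γ - p.η ^ 2) * ε ^ 2 * z + Complex.I * p.β * p.η * ε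

theorem det_two_rows_scale (e z m l : Fin 4 → ℂ) (a b c : ℂ) :
    (Matrix.of ![e, fun j => (z j * a) ^ 2 * e j, fun j => b * m j, fun j => c * l j]).det
      = a ^ 2 * b * c * (Matrix.of ![e, fun j => z j ^ 2 * e j, m, l]).det := by
  rw [det_two_rows e (fun j => z j * a), det_two_rows]
  ring

theorem rootPoly_scale {p : Params} {ε z : ℂ} (hε : ε ≠ 0) (h : rootPoly p ε z = 0) :
    (z * ε⁻¹) ^ 4 - (p.γ - p.η ^ 2) * (z * ε⁻¹) ^ 2
      + 2 * (Complex.I * ε⁻¹ ^ 2) * p.β * p.η * (z * ε⁻¹) = -(Complex.I * ε⁻¹ ^ 2) ^ 2 := by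
  rw [rootPoly] at h
  have h2 : ε * ε⁻¹ = 1 := mul_inv_cancel₀ hε
  generalize ε⁻¹ = q at h2 ⊢
  have h3 : z ^ 4 - 1 + 2 * Complex.I * p.β * p.η * z * ε
    - (p.γ - p.η ^ 2) * z ^ 2 * ε ^ 2 = 0 := h
  have h5 : ε ^ 2 * q ^ 2 = 1 := by rw [← mul_pow, h2, one_pow]
  linear_combination q ^ 4 * h3 - 2 * Complex.I * p.β * p.η * z * q ^ 3 * h2
    + (p.γ - p.η ^ 2) * z ^ 2 * q ^ 2 * h5 + q ^ 4 * Complex.I_sq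

/-- The roots start at distinct points and remain distinct by continuity, as needed for the
exponentials to have an invertible jet matrix. -/
theorem eventually_injective_rootBranch {p : Params} {u : Fin 4 → ℂ → ℂ}
    (hu : ∀ j, AnalyticAt ℂ (u j) 0) :
    ∀ᶠ ε in 𝓝 0, Function.Injective fun j => rootBranch p u j ε := by
  have h : ∀ i j, ∀ᶠ ε in 𝓝 0, i ≠ j → rootBranch p u i ε ≠ rootBranch p u j ε := by
    intro i j
    by_cases hij : i = j
    · exact Eventually.of_forall fun _ h => absurd hij h
    · have hne : rootBranch p u i 0 ≠ rootBranch p u j 0 := by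
        simpa [rootBranch_zero] using injective_rootStart.ne hij
      have := ((analyticAt_rootBranch (p := p) hu i).continuousAt.ne_iff_eventually_ne
        (analyticAt_rootBranch (p := p) hu j).continuousAt).1 hne
      filter_upwards [this] with ε hε _ using hε
  have h' := eventually_all.2 fun i => eventually_all.2 (h i)
  filter_upwards [h'] with ε hε i j hij
  by_contra hne
  exact hε i j hne hij

/-- The rows are homogeneous in the scaled variables, so only nonzero powers of `ε⁻¹` are factored
out. -/
theorem det_expMat_scale {p : Params} {ε : ℂ} (hε : ε ≠ 0) (z l l' : Fin 4 → ℂ) {b : ℂ}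
    (hb : b ≠ 0) (hl : ∀ j, l' j = b * l j) :
    (expMat p (Complex.I * ε⁻¹ ^ 2) l' fun j => z j * ε⁻¹).det = 0 ↔
      (Matrix.of ![fun j => Complex.exp (z j * ε⁻¹), fun j => z j ^ 2 * Complex.exp (z j * ε⁻¹),
        fun j => scaledMoment p ε (z j), l]).det = 0 := by
  have h2 : ε * ε⁻¹ = 1 := mul_inv_cancel₀ hε
  have hm : (fun j => (z j * ε⁻¹) ^ 2 - (p.α + Complex.I * ε⁻¹ ^ 2 * p.κ) * (z j * ε⁻¹))
      = fun j => ε⁻¹ ^ 3 * scaledMoment p ε (z j) := by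
    funext j
    rw [scaledMoment]
    field_simp
  rw [expMat, hm, funext hl, det_two_rows_scale (fun j => Complex.exp (z j * ε⁻¹)) z]
  have := inv_ne_zero hε
  rw [mul_eq_zero, or_iff_right]
  positivity

/-- First order perturbation of the quotient that governs a branch. -/
theorem hasDerivAt_branch_quotient {P Q U : ℂ → ℂ} {P' Q' U' G a : ℂ} (hP : HasDerivAt P P' 0)
    (hQ : HasDerivAt Q Q' 0) (hU : HasDerivAt U U' 0) (hG : G ≠ 0) (hQ0 : Q 0 ≠ 0)
    (hPQ : P 0 = G * Q 0) (ha : P' - G * Q' = G * Q 0 * a) :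
    HasDerivAt (fun ε => P ε / (G * Q ε) * Complex.exp (-(ε * U ε))) (a - U 0) 0 := by
  have h1 := hP.div (hQ.const_mul G) (mul_ne_zero hG hQ0)
  have h2 := (((hasDerivAt_id (0 : ℂ)).mul hU).neg).cexp
  refine (h1.mul h2).congr_deriv ?_
  simp [hPQ]
  field_simp
  linear_combination ha

/-- The equation for the zeros of a characteristic determinant in a sector. -/
theorem exists_sector_equation_bcMat {p : Params} {l : ℂ → ℂ → ℂ} {l' : Fin 4 → ℂ} {G a : ℂ}
    (hl : ∀ z : ℂ → ℂ, AnalyticAt ℂ z 0 → AnalyticAt ℂ (fun ε => l ε (z ε)) 0)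
    (hl' : ∀ z : ℂ → ℂ, ∀ j, z 0 = rootStart j → HasDerivAt z (rootSlope p j) 0 →
      HasDerivAt (fun ε => l ε (z ε)) (l' j) 0)
    (hG : G ≠ 0) {P₀ P' Q₀ Q' : ℂ}
    (hP₀ : P₀ = (rootStart 2 ^ 2 - rootStart 0 ^ 2) *
      (scaledMoment p 0 (rootStart 1) * l 0 (rootStart 3)
        - scaledMoment p 0 (rootStart 3) * l 0 (rootStart 1)))
    (hQ₀ : Q₀ = (rootStart 2 ^ 2 - rootStart 1 ^ 2) *
      (scaledMoment p 0 (rootStart 0) * l 0 (rootStart 3)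
        - scaledMoment p 0 (rootStart 3) * l 0 (rootStart 0)))
    {m' : Fin 4 → ℂ} (hm' : ∀ j, m' j = rootStart j ^ 2 - Complex.I * p.κ * rootSlope p j)
    (hP' : P' = (2 * rootStart 2 * rootSlope p 2 - 2 * rootStart 0 * rootSlope p 0) *
      (scaledMoment p 0 (rootStart 1) * l 0 (rootStart 3)
        - scaledMoment p 0 (rootStart 3) * l 0 (rootStart 1)) +
      (rootStart 2 ^ 2 - rootStart 0 ^ 2) *
      ((m' 1 * l 0 (rootStart 3) + scaledMoment p 0 (rootStart 1) * l' 3)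
        - (m' 3 * l 0 (rootStart 1) + scaledMoment p 0 (rootStart 3) * l' 1)))
    (hQ' : Q' = (2 * rootStart 2 * rootSlope p 2 - 2 * rootStart 1 * rootSlope p 1) *
      (scaledMoment p 0 (rootStart 0) * l 0 (rootStart 3)
        - scaledMoment p 0 (rootStart 3) * l 0 (rootStart 0)) +
      (rootStart 2 ^ 2 - rootStart 1 ^ 2) *
      ((m' 0 * l 0 (rootStart 3) + scaledMoment p 0 (rootStart 0) * l' 3)
        - (m' 3 * l 0 (rootStart 0) + scaledMoment p 0 (rootStart 3) * l' 0)))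
    (hQ0 : Q₀ ≠ 0) (hPQ : P₀ = G * Q₀) (ha : P' - G * Q' = G * Q₀ * a) {D : ℂ → Prop}
    (hD : ∀ ε ≠ 0, ∀ z : Fin 4 → ℂ, Function.Injective z → (∀ j, rootPoly p ε (z j) = 0) →
      (D ε⁻¹ ↔ (Matrix.of ![fun j => Complex.exp (z j * ε⁻¹),
        fun j => z j ^ 2 * Complex.exp (z j * ε⁻¹),
        fun j => scaledMoment p ε (z j), fun j => l ε (z j)]).det = 0)) :
    ∃ (M C : ℝ) (H : ℂ → ℂ), DifferentiableOn ℂ H (sectorAt M) ∧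
      (∀ μ ∈ sectorAt M, ‖H μ - 1
        - (a + Complex.I * ((p.β ^ 2 * p.η ^ 2 / 2 + p.γ - p.η ^ 2) / 2 : ℝ)) / μ‖
          ≤ C / ‖μ‖ ^ 2) ∧
      ∀ μ ∈ sectorAt M, D μ ↔ Complex.exp (2 * Complex.I * μ) = G * H μ := by
  obtain ⟨u, hu, hu0, hroot⟩ := exists_rootBranch p
  set z := rootBranch p u with hz
  have hza := analyticAt_rootBranch (p := p) hu
  have hzd := hasDerivAt_rootBranch (p := p) hu
  have hz0 := rootBranch_zero p u
  have hmd : ∀ j, HasDerivAt (fun ε => scaledMoment p ε (z j ε)) (m' j) 0 := fun j => by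
    have hid := hasDerivAt_id (0 : ℂ)
    have h1 := (((hzd j).pow 2).mul hid).sub
      ((((hid.pow 2).const_mul (p.α : ℂ)).add_const (Complex.I * p.κ)).mul (hzd j))
    refine h1.congr_deriv ?_
    rw [hm']
    simp [hz0]
  have hld : ∀ j, HasDerivAt (fun ε => l ε (z j ε)) (l' j) 0 := fun j => hl' _ j (hz0 j) (hzd j)
  have hPQd : ∀ i j, HasDerivAt (fun ε => (z 2 ε ^ 2 - z i ε ^ 2) *
      (scaledMoment p ε (z j ε) * l ε (z 3 ε) - scaledMoment p ε (z 3 ε) * l ε (z j ε)))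
      ((2 * rootStart 2 * rootSlope p 2 - 2 * rootStart i * rootSlope p i) *
      (scaledMoment p 0 (rootStart j) * l 0 (rootStart 3)
        - scaledMoment p 0 (rootStart 3) * l 0 (rootStart j)) +
      (rootStart 2 ^ 2 - rootStart i ^ 2) *
      ((m' j * l 0 (rootStart 3) + scaledMoment p 0 (rootStart j) * l' 3)
        - (m' 3 * l 0 (rootStart j) + scaledMoment p 0 (rootStart 3) * l' j))) 0 := fun i j => by
    have := ((((hzd 2).pow 2).sub ((hzd i).pow 2)).mul
      (((hmd j).mul (hld 3)).sub ((hmd 3).mul (hld j))))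
    refine this.congr_deriv ?_
    simp [hz, hz0]
  refine exists_sector_equation (z := z) (m := fun j ε => scaledMoment p ε (z j ε))
    (l := fun j ε => l ε (z j ε)) (u := u) (c := rootSlope p) (fun j => ?_) (fun j => hl _ (hza j)) hu
    (fun j ε => rfl) rfl (P := fun ε => (z 2 ε ^ 2 - z 0 ε ^ 2) *
      (scaledMoment p ε (z 1 ε) * l ε (z 3 ε) - scaledMoment p ε (z 3 ε) * l ε (z 1 ε)))
    (Q := fun ε => (z 2 ε ^ 2 - z 1 ε ^ 2) *
      (scaledMoment p ε (z 0 ε) * l ε (z 3 ε) - scaledMoment p ε (z 3 ε) * l ε (z 0 ε)))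
    (fun _ => rfl) (fun _ => rfl) ?_ hG ?_ ?_ ?_
  · have := hza j
    unfold scaledMoment
    fun_prop
  · simpa only [hz, hz0, ← hQ₀] using hQ0
  · simpa only [hz, hz0, ← hQ₀, ← hP₀] using hPQ
  · have hU : HasDerivAt (fun ε => u 1 ε - u 0 ε) (deriv (u 1) 0 - deriv (u 0) 0) 0 :=
      (hu 1).differentiableAt.hasDerivAt.sub (hu 0).differentiableAt.hasDerivAt
    -- The coefficient `h` is `a - (u 1 0 - u 0 0)`, whose second part is `i` times the frequency
    -- shift.
    refine (hasDerivAt_branch_quotient (hPQd 0 1) (hPQd 1 0) hU hG (a := a) ?_ ?_ ?_).congr_deriv ?_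
    · simpa only [hz, hz0, ← hQ₀] using hQ0
    · simpa only [hz, hz0, ← hQ₀, ← hP₀] using hPQ
    · simpa only [hz, hz0, ← hQ₀, ← hP', ← hQ'] using ha
    · simp only [hu0]; ring
  · filter_upwards [(eventually_injective_rootBranch (p := p) hu).filter_mono nhdsWithin_le_nhds,
      (eventually_all.2 hroot).filter_mono nhdsWithin_le_nhds, self_mem_nhdsWithin] with ε h1 h2 h3
    exact hD ε h3 (fun j => z j ε) h1 h2

theorem scaledMoment_zero (p : Params) (z : ℂ) :
    scaledMoment p 0 z = -(Complex.I * p.κ) * z := by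
  simp [scaledMoment]

theorem scaledForce_zero (p : Params) (z : ℂ) : scaledForce p 0 z = z ^ 3 := by
  simp [scaledForce]

theorem I_pow_five : Complex.I ^ 5 = Complex.I := by
  rw [pow_succ, Complex.I_pow_four, one_mul]

theorem I_pow_six : Complex.I ^ 6 = -1 := by
  rw [pow_succ, I_pow_five, Complex.I_mul_I]

/-! ### Zeros of the two characteristic functions -/

theorem finite_zeros_force {p : Params} (hp : p.Admissible) (hκ : 0 < p.κ) (R : ℝ) :
    ({lam | (bcMat p lam (forceRow p lam)).det = 0} ∩ Metric.closedBall 0 R).Finite :=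
  finite_zeros (f := fun lam => (bcMat p lam (forceRow p lam)).det)
    (differentiable_det_bcMat p (differentiable_forceRow p))
    (det_bcMat_force_ne_zero hp hκ (by simp)) R

theorem finite_zeros_pin {p : Params} (hp : p.Admissible) (hκ : 0 < p.κ) (R : ℝ) :
    ({lam | (bcMat p lam pinRow).det = 0} ∩ Metric.closedBall 0 R).Finite :=
  finite_zeros (f := fun lam => (bcMat p lam pinRow).det)
    (differentiable_det_bcMat p (l := fun _ => pinRow) fun i => differentiable_const (pinRow i))
    (det_bcMat_pin_ne_zero hp hκ (by simp)) R

/-- At `ε = 0` the moment of the root `z` is `-iκz` and the force is `z³`, which gives the quotient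
`G = -1 = exp(2i · π/2)`, hence `δ = 1/2`. In the first-order coefficient the `βη` terms cancel and
`-1/κ` remains. -/
theorem hasBranchAsymptotics_force {p : Params} (hp : p.Admissible) (hκ : 0 < p.κ) :
    HasBranchAsymptotics p {lam | (bcMat p lam (forceRow p lam)).det = 0} (-1 / p.κ) (1 / 2) := by
  have hκ' : (p.κ : ℂ) ≠ 0 := by exact_mod_cast hκ.ne'
  obtain ⟨M, C, H, hH, hb, hD⟩ := exists_sector_equation_bcMat (p := p) (l := scaledForce p)
    (l' := fun j => 3 * rootStart j ^ 2 * rootSlope p j + Complex.I * p.β * p.η)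
    (G := -1) (a := -1 / p.κ)
    (fun z hz => by unfold scaledForce; fun_prop)
    (fun z j h0 hz => by
      have hid := hasDerivAt_id (0 : ℂ)
      refine (((hz.pow 3).sub (((hid.pow 2).const_mul ((p.γ : ℂ) - p.η ^ 2)).mul hz)).add
        (hid.const_mul (Complex.I * p.β * p.η))).congr_deriv ?_
      simp [h0])
    (by norm_num) rfl rfl (fun j => rfl) rfl rfl
    (by
      simp [scaledMoment_zero, scaledForce_zero, rootStart]
      ring_nf
      simp [hκ'])
    (by
      simp [scaledMoment_zero, scaledForce_zero, rootStart]
      ring_nf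
      simp only [Complex.I_sq, Complex.I_pow_four]
      ring)
    (by
      simp [scaledMoment_zero, scaledForce_zero, rootStart, rootSlope]
      field_simp
      ring_nf
      simp only [Complex.I_sq, Complex.I_pow_three, Complex.I_pow_four, I_pow_six]
      ring)
    (D := fun μ => (bcMat p (Complex.I * μ ^ 2) (forceRow p (Complex.I * μ ^ 2))).det = 0)
    (fun ε hε z hinj hroot => by
      rw [det_bcMat_force_eq_zero_iff (fun j => rootPoly_scale hε (hroot j))
        (fun i j h => hinj (mul_right_cancel₀ (inv_ne_zero hε) h))]
      refine det_expMat_scale hε z _ _ (pow_ne_zero 3 (inv_ne_zero hε)) fun j => ?_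
      rw [scaledForce]
      field_simp)
  refine hasBranchAsymptotics_of_sector p (fun lam h => ?_) (fun R => ?_) (fun lam h => ?_) hH
    (M := M) (C := C) (fun μ hμ => ?_) fun μ hμ => ?_
  · rw [mem_ofPred_eq] at h ⊢
    rw [det_bcMat_conj (forceRow_conj p lam), h, map_zero]
  · exact finite_zeros_force hp hκ R
  · by_contra hre
    exact det_bcMat_force_ne_zero hp hκ (not_lt.1 hre) h
  · simpa using hb μ hμ
  · rw [mem_ofPred_eq, hD μ hμ]
    have : (2 * Complex.I * ((1 / 2 : ℝ) * Real.pi) : ℂ) = Real.pi * Complex.I := by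
      push_cast; ring
    rw [this, Complex.exp_pi_mul_I]

/-- With the last row constant the quotient at `ε = 0` is `(1 + i)/(1 - i) = i = exp(2i · π/4)`,
hence `δ = 1/4`, and the first-order coefficient is `-2/κ`. -/
theorem hasBranchAsymptotics_pin {p : Params} (hp : p.Admissible) (hκ : 0 < p.κ) :
    HasBranchAsymptotics p {lam | (bcMat p lam pinRow).det = 0} (-2 / p.κ) (1 / 4) := by
  have hκ' : (p.κ : ℂ) ≠ 0 := by exact_mod_cast hκ.ne'
  obtain ⟨M, C, H, hH, hb, hD⟩ := exists_sector_equation_bcMat (p := p) (l := fun _ _ => 1)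
    (l' := fun _ => 0) (G := Complex.I) (a := -2 / p.κ)
    (fun z hz => analyticAt_const) (fun z j h0 hz => hasDerivAt_const _ _)
    Complex.I_ne_zero rfl rfl (fun j => rfl) rfl rfl
    (by
      simp [scaledMoment_zero, rootStart]
      intro h
      have := congrArg Complex.im h
      simp at this
      exact hκ.ne' this)
    (by
      simp [scaledMoment_zero, rootStart]
      ring_nf
      simp only [Complex.I_sq, Complex.I_pow_three]
      ring)
    (by
      simp [scaledMoment_zero, rootStart, rootSlope]
      field_simp
      ring_nf
      simp only [Complex.I_sq, Complex.I_pow_three, Complex.I_pow_four, I_pow_five]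
      ring)
    (D := fun μ => (bcMat p (Complex.I * μ ^ 2) pinRow).det = 0)
    (fun ε hε z hinj hroot => by
      rw [det_bcMat_pin_eq_zero_iff (fun j => rootPoly_scale hε (hroot j))
        (fun i j h => hinj (mul_right_cancel₀ (inv_ne_zero hε) h))]
      exact det_expMat_scale hε z _ _ one_ne_zero fun j => by simp)
  refine hasBranchAsymptotics_of_sector p (fun lam h => ?_) (fun R => ?_) (fun lam h => ?_) hH
    (M := M) (C := C) (fun μ hμ => ?_) fun μ hμ => ?_
  · rw [mem_ofPred_eq] at h ⊢
    rw [det_bcMat_conj pinRow_conj, h, map_zero]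
  · exact finite_zeros_pin hp hκ R
  · by_contra hre
    exact det_bcMat_pin_ne_zero hp hκ (not_lt.1 hre) h
  · simpa using hb μ hμ
  · rw [mem_ofPred_eq, hD μ hμ]
    have : (2 * Complex.I * ((1 / 4 : ℝ) * Real.pi) : ℂ) = Real.pi / 2 * Complex.I := by
      push_cast; ring
    rw [this, Complex.exp_pi_div_two_mul_I]

/-- A set with branch asymptotics in the open left half plane lies in a closed strip of it. -/
theorem HasBranchAsymptotics.exists_strip {p : Params} {Z : Set ℂ} {a δ : ℝ}
    (h : HasBranchAsymptotics p Z a δ) (ha : a < 0) (hneg : ∀ lam ∈ Z, lam.re < 0) :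
    ∃ A B : ℝ, B < 0 ∧ ∀ lam ∈ Z, A ≤ lam.re ∧ lam.re ≤ B := by
  obtain ⟨lam, n₀, -, hconj, -, hsub, hfin, -, hO, -⟩ := h
  have h0 : Tendsto (fun n : ℕ => (((n : ℝ) + δ) * Real.pi)⁻¹) atTop (𝓝 0) :=
    ((tendsto_atTop_add_const_right _ δ tendsto_natCast_atTop_atTop).atTop_mul_const
      Real.pi_pos).inv_tendsto_atTop
  have hre : Tendsto (fun n : ℕ => (lam n).re - a) atTop (𝓝 0) := by
    have := (Complex.continuous_re.tendsto 0).comp (hO.trans_tendsto h0)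
    simpa [Function.comp_def] using this
  -- This places the tail of the branch between `2a` and `a/2`. The remaining zeros form the finite
  -- set `F`, on which the real part attains a negative maximum.
  have hev : ∀ᶠ n : ℕ in atTop, |(lam n).re - a| < -a / 2 := by
    have := (hre.abs).eventually_lt_const (u := -a / 2) (by simp; linarith)
    simpa using this
  obtain ⟨N, hN⟩ := eventually_atTop.1 hev
  set F : Set ℂ := (Z \ lam '' {n | (n₀ : ℤ) ≤ |n|}) ∪ lam '' {n | (n₀ : ℤ) ≤ |n| ∧ |n| ≤ N}
    with hF
  have hFfin : F.Finite := by
    refine hfin.union (Set.Finite.image _ ((Set.finite_Icc (-(N : ℤ)) N).subset ?_))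
    rintro n ⟨-, hn⟩
    exact abs_le.1 hn
  have hFZ : F ⊆ Z := union_subset sdiff_subset
    ((image_mono fun n hn => hn.1).trans hsub)
  obtain ⟨b, hb0, hb⟩ : ∃ b < 0, ∀ z ∈ F, z.re ≤ b := by
    rcases F.eq_empty_or_nonempty with he | hne
    · exact ⟨-1, by norm_num, by simp [he]⟩
    · obtain ⟨z, hz, hmax⟩ := Set.exists_max_image F Complex.re hFfin hne
      exact ⟨z.re, hneg z (hFZ hz), hmax⟩
  obtain ⟨c, hc⟩ := (hFfin.image Complex.re).bddBelow
  refine ⟨min c (2 * a), max b (a / 2), max_lt hb0 (by linarith), fun z hz => ?_⟩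
  by_cases hzF : z ∈ F
  · exact ⟨(min_le_left _ _).trans (hc (mem_image_of_mem _ hzF)),
      (hb z hzF).trans (le_max_left _ _)⟩
  · obtain ⟨n, hn, rfl⟩ : z ∈ lam '' {n | (n₀ : ℤ) ≤ |n|} := by
      by_contra hcon
      exact hzF (Or.inl ⟨hz, hcon⟩)
    have hnN : (N : ℤ) < |n| := by
      by_contra hcon
      exact hzF (Or.inr ⟨n, ⟨hn, not_lt.1 hcon⟩, rfl⟩)
    have hre' : (lam n).re = (lam (n.natAbs : ℤ)).re := by
      rcases le_total 0 n with h' | h'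
      · rw [Int.natAbs_of_nonneg h']
      · rw [Int.ofNat_natAbs_of_nonpos h', hconj, Complex.conj_re]
    rw [Int.abs_eq_natAbs] at hnN
    have := abs_lt.1 (hN n.natAbs (by omega))
    rw [hre']
    exact ⟨(min_le_right _ _).trans (by linarith), le_trans (by linarith) (le_max_right _ _)⟩

end PipeStar

end

/-! ### Assembly of the spectral theorem -/

theorem theorem3p3 (p : PipeStar.Params) (hp : p.Admissible) (hκ : 0 < p.κ)
    (φ : ℂ → Fin 4 → ℝ → ℂ) (hφ : ∀ lam, PipeStar.IsFundamentalSystem p lam (φ lam)) :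
    (PipeStar.spectrumT p =
      {lam | PipeStar.Delta1 p lam (φ lam) = 0} ∪ {lam | PipeStar.Delta2 p lam (φ lam) = 0}) ∧
    (∀ lam ∈ PipeStar.spectrumT p, PipeStar.IsEigenvalueT p lam) ∧
    (∀ R : ℝ, (PipeStar.spectrumT p ∩ Metric.closedBall 0 R).Finite) ∧
    (∃ a b : ℝ, b < 0 ∧ ∀ lam ∈ PipeStar.spectrumT p, a ≤ lam.re ∧ lam.re ≤ b) ∧
    PipeStar.HasBranchAsymptotics p {lam | PipeStar.Delta1 p lam (φ lam) = 0}
      (-1 / p.κ) (1 / 2) ∧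
    PipeStar.HasBranchAsymptotics p {lam | PipeStar.Delta2 p lam (φ lam) = 0}
      (-2 / p.κ) (1 / 4) := by
  have e1 : {lam | PipeStar.Delta1 p lam (φ lam) = 0}
      = {lam | (PipeStar.bcMat p lam (PipeStar.forceRow p lam)).det = 0} :=
    Set.ext fun lam => PipeStar.Delta1_eq_zero_iff (hφ lam)
  have e2 : {lam | PipeStar.Delta2 p lam (φ lam) = 0}
      = {lam | (PipeStar.bcMat p lam PipeStar.pinRow).det = 0} :=
    Set.ext fun lam => PipeStar.Delta2_eq_zero_iff (hφ lam)
  rw [e1, e2]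
  -- Both inclusions pass through the determinants: nonzero determinants give a resolvent point, a
  -- zero determinant gives an eigenvalue.
  have hσ : PipeStar.spectrumT p = {lam | (PipeStar.bcMat p lam (PipeStar.forceRow p lam)).det = 0}
      ∪ {lam | (PipeStar.bcMat p lam PipeStar.pinRow).det = 0} :=
    Set.ext fun lam => ⟨PipeStar.det_eq_zero_of_mem_spectrumT hp, fun h =>
      (PipeStar.isEigenvalueT_of_det h).mem_spectrumT⟩
  have hB1 := PipeStar.hasBranchAsymptotics_force hp hκ
  have hB2 := PipeStar.hasBranchAsymptotics_pin hp hκ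
  refine ⟨hσ, fun lam h => PipeStar.isEigenvalueT_of_det
    (PipeStar.det_eq_zero_of_mem_spectrumT hp h), fun R => ?_, ?_, hB1, hB2⟩
  · rw [hσ, Set.union_inter_distrib_right]
    exact (PipeStar.finite_zeros_force hp hκ R).union (PipeStar.finite_zeros_pin hp hκ R)
  · obtain ⟨a₁, b₁, hb₁, h₁⟩ := hB1.exists_strip (div_neg_of_neg_of_pos (by norm_num) hκ)
      fun lam h => by
        by_contra hre
        exact PipeStar.det_bcMat_force_ne_zero hp hκ (not_lt.1 hre) h
    obtain ⟨a₂, b₂, hb₂, h₂⟩ := hB2.exists_strip (div_neg_of_neg_of_pos (by norm_num) hκ)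
      fun lam h => by
        by_contra hre
        exact PipeStar.det_bcMat_pin_ne_zero hp hκ (not_lt.1 hre) h
    refine ⟨min a₁ a₂, max b₁ b₂, max_lt hb₁ hb₂, fun lam h => ?_⟩
    rw [hσ] at h
    rcases h with h | h
    · exact ⟨(min_le_left _ _).trans (h₁ lam h).1, (h₁ lam h).2.trans (le_max_left _ _)⟩
    · exact ⟨(min_le_right _ _).trans (h₂ lam h).1, (h₂ lam h).2.trans (le_max_right _ _)⟩
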